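/- **Setting.** For each sample size $n\ge 1$ let $d=d_n$ be a dimension, $A(\cdot)=[\alpha_{ij}(\cdot)]$ and $\Sigma(\cdot)=[\sigma_{ij}(\cdot)]$ functions with values in the real $d\times d$ matrices ($\Sigma(\tau)$ positive semidefinite, $\tau\le 1$), all of them allowed to depend on $n$, and let $(\varepsilon_t)_{t\in\mathbb Z}$ be i.i.d. $d$-dimensional random vectors with mean zero and identity covariance. Put $\tau_t=t/n$, $e_t=\Sigma(\tau_t)^{1/2}\varepsilon_t$, $\Omega(\tau)=\Sigma(\tau)^{-1}=[\omega_{ij}(\tau)]$. Values of $A,\Sigma$ at $\tau<0$ only describe the past before the sample. Observe $X_0,\dots,X_n$ with $$X_t=A(\tau_t)X_{t-1}+e_t\quad(1\le t\le n),\qquad X_t=\sum_{k\ge0}\Phi_{t,k}e_{t-k}\quad(0\le t\le n)\quad\text{a.s.},$$ where $\Phi_{t,0}=I_d$ and $\Phi_{t,k}=A(\tau_t)A(\tau_{t-1})\cdots A(\tau_{t-k+1})$. All limits are as $n\to\infty$; "constant" means independent of $n$, of $\tau$ and of the matrix indices. Norms: $\|\cdot\|$ Euclidean/operator, $\|\cdot\|_F$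 Frobenius, $\|\cdot\|_{\max}$ maximal absolute entry, $\|\cdot\|_1$ maximal absolute column sum, $|\cdot|_1$ sum of absolute entries. Write $n\vee d=\max(n,d)$. **Sparsity sets.** $\mathcal J_i(\tau)=\{j:\alpha_{ij}(\tau)\ne0\}$, $\mathcal J_i'(\tau)=\{j:\alpha_{ij}'(\tau)\neq0\}$, $\mathcal J_i=\bigcup_{t=1}^n\mathcal J_i(\tau_t)$, $\mathcal J'_i=\bigcup_{t=1}^n\mathcal J'_i(\tau_t)$, $s=\max_i|\mathcal J_i|$, and it is assumed that $s\ge1$ for all large $n$. $D_{ij}^2=\sum_{t=1}^n\big[\alpha_{ij}(\tau_t)-\frac1n\sum_{r=1}^n\alpha_{ij}(\tau_r)\big]^2$. **Estimators.** Let $K$ be a kernel, $h,b>0$ bandwidths, $\lambda_1,\lambda_2>0$, $K_h(x)=K(x/h)/h$, and $$\mathcal L_i(\alpha,\beta\mid\tau)=\frac1n\sum_{t=1}^n\{x_{t,i}-[\alpha+\beta(\tau_t-\tau)]^\top X_{t-1}\}^2K_h(\tau_t-\tau).$$ 1. (LASSO) For all $i$ and $t=1,\dots,n$, $(\tilde\alpha_{i\bullet}(\tau_t),\tilde\alpha'_{i\bullet}(\tau_t))$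 minimises $\mathcal L_i(\alpha,\beta\mid\tau_t)+\lambda_1(|\alpha|_1+h|\beta|_1)$. 2. (Weighted group LASSO) For all $i$, $(\hat\alpha_{ij}(\tau_t),\hat\alpha_{ij}'(\tau_t))_{t\le n,\,j\le d}$ minimises over $(\alpha_{j|t},\beta_{j|t})$ $$\sum_{t=1}^n\mathcal L_i(\alpha_{\bullet t},\beta_{\bullet t}\mid\tau_t)+\sum_{j=1}^d p'_{\lambda_2}(\|\tilde\alpha_{i,j}\|)\,\|\alpha_j\|+\sum_{j=1}^d p'_{\lambda_2}(\tilde D_{ij})\,\|h\beta_j\|,$$ where $\alpha_{\bullet t}=(\alpha_{j|t})_{j\le d}$, $\alpha_j=(\alpha_{j|t})_{t\le n}$ and likewise for $\beta$, $\tilde\alpha_{i,j}=(\tilde\alpha_{ij}(\tau_t))_{t\le n}$, $\tilde D_{ij}$ is $D_{ij}$ computed from $\tilde\alpha_{ij}$, and $p'_\lambda(z)=\lambda\big[I(z\le\lambda)+\frac{(a_0\lambda-z)_+}{(a_0-1)\lambda}I(z>\lambda)\big]$ with $a_0=3.7$. 3. (Residual covariance) $\hat e_{t,i}=x_{t,i}-\sum_j\hat\alpha_{ij}(\tau_t)x_{t-1,j}$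 and $\hat\Sigma(\tau)=\sum_{t=1}^n\varpi_t(\tau)\hat e_t\hat e_t^\top\big/\sum_{t=1}^n\varpi_t(\tau)$ with $\varpi_t(\tau)=K(\tfrac{\tau_t-\tau}b)s_{n,2}(\tau)-\tfrac{\tau_t-\tau}bK(\tfrac{\tau_t-\tau}b)s_{n,1}(\tau)$, $s_{n,j}(\tau)=\sum_{t=1}^n(\tfrac{\tau_t-\tau}b)^jK(\tfrac{\tau_t-\tau}b)$. 4. (CLIME) $\tilde\Omega(\tau)$ minimises $|W|_1$ subject to $\|\hat\Sigma(\tau)W-I_d\|_{\max}\le\lambda_3$ (it is arbitrary if no $W$ is feasible), and $\hat\Omega(\tau)$ is the symmetric matrix with $\hat\omega_{ij}=\hat\omega_{ji}$ equal to the one of $\tilde\omega_{ij},\tilde\omega_{ji}$ of smaller modulus (if the moduli agree, the entry with $i\le j$). **Assumptions.** Put $$\zeta=\log(n\vee d)\big[(nh)^{-1/2}+sh^2\big],\qquad \nu^\diamond=\Big[\frac{\log(n\vee d)}{nb}\Big]^{1/2}+b^2,\qquad \nu^*=s\,\zeta\sqrt{\log(n\vee d)}.$$ * (1) $\det(I_d-A(\tau)z)\neq0$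 for $\tau\in[0,1]$, $z\in\mathbb C$, $|z|\le1$; there are constants $C_1>0$, $\rho\in(0,1)$ with $\|\Phi_{t,k}\|\le C_1\rho^k$ for $0\le t\le n$, $k\ge0$. The entries of $A,\Sigma,\Omega$ are $C^2$ on $[0,1]$, and the second derivatives of the entries of $A$ and $\Sigma$ are bounded there by a constant; $\Omega(\tau)$ is positive definite for $\tau\in[0,1]$, and $\|\Sigma(\tau)\|$ is bounded by a constant for $\tau\le1$. There are constants $\iota_1,C_0>0$ with $\mathsf E\exp\{\iota_1(u^\top\varepsilon_t)^2\}\le C_0$ for all unit vectors $u$. * (2) $K$ is a symmetric, Lipschitz continuous probability density (not depending on $n$) that vanishes outside $[-1,1]$; $nh/\log^2(n\vee d)\to\infty$ and $sh^2\log(n\vee d)\to0$. * (3) $\zeta=o(\lambda_1)$ and $\sqrt s\lambda_1/h\to0$; there is a constant $\kappa_0>0$ such that, with probability tending to one, $u^\top\Psi(\tau_t)u\ge\kappa_0$ for all $i$, all $t=1,\dots,n$ and all $u=(u_1^\top,u_2^\top)^\top\in\mathbb R^{2d}$ with $\|u\|=1$ and $|u|_1\le3\big(\sum_{j\in\mathcal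 J_i(\tau_t)}|u_{1,j}|+\sum_{j\in\mathcal J'_i(\tau_t)}|u_{2,j}|\big)$. Here $\Psi=\begin{pmatrix}\Psi_0&\Psi_1\\\Psi_1&\Psi_2\end{pmatrix}$, $\Psi_k(\tau)=\frac1n\sum_{t=1}^n(\frac{\tau_t-\tau}h)^kX_{t-1}X_{t-1}^\top K_h(\tau_t-\tau)$. * (4) $\sqrt n\,s\log(n\vee d)\,\zeta+\sqrt{ns}\,\lambda_1=o(\lambda_2)$; for all large $n$, $\big(\sum_{t=1}^n\alpha_{ij}^2(\tau_t)\big)^{1/2}\ge(a_0+1)\lambda_2$ for all $i$ and $j\in\mathcal J_i$, and $D_{ij}\ge(a_0+1)\lambda_2$ for all $i$ and $j\in\mathcal J_i'$. * (5) $b\to0$, $nb/\log^3(n\vee d)\to\infty$, $\nu^*\to0$; $\lambda_3=C_3(\nu^\diamond+\nu^*)$ with a constant $C_3$. * (Sparsity) For constants $q\in[0,1)$, $C_2$ and a sequence $\xi_d$ (indexed by $n$), and for all $\tau\in[0,1]$: $\Omega(\tau)$ is positive definite, $\|\Omega(\tau)\|_1\le C_2$, and $\max_i\sum_{j}|\omega_{ij}(\tau)|^q\le\xi_d$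 (with $0^0=0$). **Theorem.** Under these assumptions, if $C_3$ is sufficiently large, then for every choice of the minimisers above $$\sup_{0\le\tau\le1}\|\hat\Omega(\tau)-\Omega(\tau)\|_{\max}=O_P(\nu^\diamond+\nu^*),$$ $$\sup_{0\le\tau\le1}\|\hat\Omega(\tau)-\Omega(\tau)\|=O_P\big(\xi_d(\nu^\diamond+\nu^*)^{1-q}\big),$$ $$\sup_{0\le\tau\le1}\tfrac1d\|\hat\Omega(\tau)-\Omega(\tau)\|_F^2=O_P\big(\xi_d(\nu^\diamond+\nu^*)^{2-q}\big).$$ -/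

import Mathlib

open MeasureTheory ProbabilityTheory Filter Topology

noncomputable section

namespace TVNet

/-- Square matrices of size `d` with real entries. -/
abbrev Mat (d : ℕ) := Matrix (Fin d) (Fin d) ℝ

/-! ### Matrix norms -/

/-- Entrywise maximum norm. -/
def maxNorm {d : ℕ} (W : Mat d) : ℝ := ⨆ i, ⨆ j, |W i j|

/-- Maximal absolute column sum. -/
def colSumNorm {d : ℕ} (W : Mat d) : ℝ := ⨆ j, ∑ i, |W i j|

/-- Sum of the absolute values of all entries. -/
def entrySumNorm {d : ℕ} (W : Mat d) : ℝ := ∑ i, ∑ j, |W i j|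

/-- Operator norm with respect to the Euclidean norm. -/
def opNorm {d : ℕ} (W : Mat d) : ℝ := ‖Matrix.toEuclideanCLM (n := Fin d) (𝕜 := ℝ) W‖

/-- Frobenius norm. -/
def frobNorm {d : ℕ} (W : Mat d) : ℝ := √(W.transpose * W).trace

open scoped MatrixOrder in
/-- The positive semidefinite square root of a positive semidefinite matrix. -/
def matSqrt {d : ℕ} (S : Mat d) : Mat d := CFC.sqrt S

/-! ### The time-varying VAR(1) model

For each sample size `n`, the coefficient functions `A`, `Sig` are evaluated at the scaled
times `t / n`, for all integers `t ≤ n`; the values at `τ ≤ 0` describe the past before the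
sample (for instance `A τ = A 0` for `τ < 0`). -/

/-- The scaled time `τ_t = t / n`. -/
def gridPt (n : ℕ) (t : ℤ) : ℝ := (t : ℝ) / (n : ℝ)

/-- The observation times `1, …, n`. -/
def times (n : ℕ) : Finset ℤ := Finset.Icc 1 (n : ℤ)

/-- The moving average coefficients
`Φ_{t,k} = A(τ_t) A(τ_{t-1}) ⋯ A(τ_{t-k+1})`, with `Φ_{t,0}` the identity. -/
def maCoef {d : ℕ} (n : ℕ) (A : ℝ → Mat d) (t : ℤ) : ℕ → Mat d
  | 0 => 1
  | k + 1 => maCoef n A t k * A (gridPt n (t - k))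

/-- The VAR error `e_t = Σ(τ_t)^{1/2} ε_t`. -/
def varError {d : ℕ} (n : ℕ) (Sig : ℝ → Mat d) {S : Type*} (ε : ℤ → S → Fin d → ℝ)
    (t : ℤ) (ω : S) : Fin d → ℝ :=
  (matSqrt (Sig (gridPt n t))).mulVec (ε t ω)

/-- `X_0, …, X_n` is a sample from the time-varying VAR(1) model driven by the i.i.d.
standardised vectors `ε_t`: the autoregressive equation holds at times `1, …, n`, and the process
has the causal moving average representation in terms of present and past errors. -/
structure IsTVVAR {S : Type*} [MeasurableSpace S] (P : Measure S) (n d : ℕ)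
    (A Sig : ℝ → Mat d) (ε X : ℤ → S → Fin d → ℝ) : Prop where
  measurable : ∀ t, Measurable (ε t)
  indep : iIndepFun ε P
  ident : ∀ t, IdentDistrib (ε t) (ε 0) P P
  integrable : ∀ i, Integrable (fun ω => ε 0 ω i) P
  mean_zero : ∀ i, ∫ ω, ε 0 ω i ∂P = 0
  integrable_mul : ∀ i j, Integrable (fun ω => ε 0 ω i * ε 0 ω j) P
  cov_one : ∀ i j, ∫ ω, ε 0 ω i * ε 0 ω j ∂P = (1 : Mat d) i j
  autoregression : ∀ t ∈ times n, ∀ᵐ ω ∂P,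
    X t ω = (A (gridPt n t)).mulVec (X (t - 1) ω) + varError n Sig ε t ω
  moving_average : ∀ t ∈ Finset.Icc (0 : ℤ) (n : ℤ), ∀ᵐ ω ∂P,
    HasSum (fun k : ℕ => (maCoef n A t k).mulVec (varError n Sig ε (t - k) ω)) (X t ω)

/-! ### Local linear estimation -/

/-- The rescaled kernel `K_h(x) = K(x / h) / h`. -/
def scaledKernel (K : ℝ → ℝ) (h x : ℝ) : ℝ := K (x / h) / h

/-- Local linear least squares objective of the `i`-th equation at the point `τ`, for a sample
path `x`. -/
def locLoss {d : ℕ} (n : ℕ) (K : ℝ → ℝ) (h : ℝ) (x : ℤ → Fin d → ℝ) (i : Fin d)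
    (α β : Fin d → ℝ) (τ : ℝ) : ℝ :=
  (1 / (n : ℝ)) * ∑ t ∈ times n,
    (x t i - (α + (gridPt n t - τ) • β) ⬝ᵥ x (t - 1)) ^ 2 * scaledKernel K h (gridPt n t - τ)

/-- The LASSO-penalised local linear objective. -/
def lassoLoss {d : ℕ} (n : ℕ) (K : ℝ → ℝ) (h lam : ℝ) (x : ℤ → Fin d → ℝ) (i : Fin d)
    (α β : Fin d → ℝ) (τ : ℝ) : ℝ :=
  locLoss n K h x i α β τ + lam * ((∑ j, |α j|) + h * ∑ j, |β j|)

/-- `a i t`, `b i t` minimise the LASSO objective of equation `i` at the point `τ_t`, for all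
`i` and all `t = 1, …, n`. -/
def IsLasso {d : ℕ} (n : ℕ) (K : ℝ → ℝ) (h lam : ℝ) (x : ℤ → Fin d → ℝ)
    (a b : Fin d → ℤ → Fin d → ℝ) : Prop :=
  ∀ i, ∀ t ∈ times n, ∀ α β : Fin d → ℝ,
    lassoLoss n K h lam x i (a i t) (b i t) (gridPt n t) ≤
      lassoLoss n K h lam x i α β (gridPt n t)

/-- The constant of the SCAD penalty. -/
def scadConst : ℝ := 3.7

open Classical in
/-- Derivative of the SCAD penalty. -/
def scadDeriv (lam z : ℝ) : ℝ :=
  lam * ((if z ≤ lam then 1 else 0) +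
    max (scadConst * lam - z) 0 / ((scadConst - 1) * lam) * (if lam < z then 1 else 0))

/-- Euclidean norm of the vector `(f 1, …, f n)`. -/
def pathNorm (n : ℕ) (f : ℤ → ℝ) : ℝ := √(∑ t ∈ times n, f t ^ 2)

/-- Euclidean norm of the vector `(f 1, …, f n)` after subtracting its average. -/
def pathDev (n : ℕ) (f : ℤ → ℝ) : ℝ :=
  pathNorm n fun t => f t - (1 / (n : ℝ)) * ∑ s ∈ times n, f s

/-- The weighted group LASSO objective of equation `i`. Here `a t j` is the preliminary estimate
of the coefficient of the `j`-th predictor at time `τ_t`, and `α t j`, `β t j` are the arguments. -/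
def groupLoss {d : ℕ} (n : ℕ) (K : ℝ → ℝ) (h lam : ℝ) (x : ℤ → Fin d → ℝ) (i : Fin d)
    (a α β : ℤ → Fin d → ℝ) : ℝ :=
  (∑ t ∈ times n, locLoss n K h x i (α t) (β t) (gridPt n t))
    + (∑ j, scadDeriv lam (pathNorm n fun t => a t j) * pathNorm n fun t => α t j)
    + ∑ j, scadDeriv lam (pathDev n fun t => a t j) * pathNorm n fun t => h * β t j

/-- `α i`, `β i` minimise the weighted group LASSO objective of equation `i`, for all `i`, when the
weights are built from the preliminary estimates `a`. -/
def IsGroupLasso {d : ℕ} (n : ℕ) (K : ℝ → ℝ) (h lam : ℝ) (x : ℤ → Fin d → ℝ)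
    (a α β : Fin d → ℤ → Fin d → ℝ) : Prop :=
  ∀ i, ∀ α' β' : ℤ → Fin d → ℝ,
    groupLoss n K h lam x i (a i) (α i) (β i) ≤ groupLoss n K h lam x i (a i) α' β'

/-! ### Estimation of the precision matrix -/

/-- The VAR residual `ê_t` computed from estimated transition coefficients `α i t j`. -/
def residual {d : ℕ} (x : ℤ → Fin d → ℝ) (α : Fin d → ℤ → Fin d → ℝ) (t : ℤ) : Fin d → ℝ :=
  fun i => x t i - α i t ⬝ᵥ x (t - 1)

/-- `s_{n,j}(τ)`, the kernel moments with bandwidth `b`. -/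
def kernelMoment (n : ℕ) (K : ℝ → ℝ) (b : ℝ) (j : ℕ) (τ : ℝ) : ℝ :=
  ∑ t ∈ times n, ((gridPt n t - τ) / b) ^ j * K ((gridPt n t - τ) / b)

/-- The local linear weights `ϖ_{n,t}(τ)`. -/
def locWeight (n : ℕ) (K : ℝ → ℝ) (b : ℝ) (t : ℤ) (τ : ℝ) : ℝ :=
  K ((gridPt n t - τ) / b) * kernelMoment n K b 2 τ
    - (gridPt n t - τ) / b * K ((gridPt n t - τ) / b) * kernelMoment n K b 1 τ

/-- The local linear estimate `Σ̂(τ)` of the error covariance from residuals `e`. -/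
def sigmaHat {d : ℕ} (n : ℕ) (K : ℝ → ℝ) (b : ℝ) (e : ℤ → Fin d → ℝ) (τ : ℝ) : Mat d :=
  Matrix.of fun i j =>
    (∑ t ∈ times n, locWeight n K b t τ * e t i * e t j) / ∑ t ∈ times n, locWeight n K b t τ

/-- Feasible matrices of the CLIME problem for the covariance estimate `S`. -/
def ClimeFeasible {d : ℕ} (S : Mat d) (lam : ℝ) (W : Mat d) : Prop := maxNorm (S * W - 1) ≤ lam

/-- `W` solves the CLIME problem for the covariance estimate `S`. -/
def IsClime {d : ℕ} (S : Mat d) (lam : ℝ) (W : Mat d) : Prop :=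
  ClimeFeasible S lam W ∧ ∀ V, ClimeFeasible S lam V → entrySumNorm W ≤ entrySumNorm V

open Classical in
/-- Symmetrisation: of the two entries `W i j`, `W j i` keep the one of smaller modulus. -/
def symmetrise {d : ℕ} (W : Mat d) : Mat d :=
  Matrix.of fun i j => if i ≤ j then (if |W i j| ≤ |W j i| then W i j else W j i)
    else (if |W j i| ≤ |W i j| then W j i else W i j)

/-- `W ω τ` is a CLIME solution at every `τ ∈ [0, 1]` for which the CLIME problem is feasible. -/
def IsClimeSelection {S : Type*} {d : ℕ} (Sh : S → ℝ → Mat d) (lam : ℝ) (W : S → ℝ → Mat d) :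
    Prop :=
  ∀ ω, ∀ τ ∈ Set.Icc (0 : ℝ) 1,
    (∃ V, ClimeFeasible (Sh ω τ) lam V) → IsClime (Sh ω τ) lam (W ω τ)

/-! ### Sparsity -/

/-- The derivative `α'_{ij}(τ)` of the `(i, j)` entry of `A` on `[0, 1]`, one-sided at the end
points. -/
def entryDeriv {d : ℕ} (A : ℝ → Mat d) (i j : Fin d) (τ : ℝ) : ℝ :=
  derivWithin (fun u => A u i j) (Set.Icc 0 1) τ

/-- `𝒥_i(τ)`. -/
def supp {d : ℕ} (A : ℝ → Mat d) (i : Fin d) (τ : ℝ) : Set (Fin d) := {j | A τ i j ≠ 0}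

/-- `𝒥'_i(τ)`. -/
def suppDeriv {d : ℕ} (A : ℝ → Mat d) (i : Fin d) (τ : ℝ) : Set (Fin d) :=
  {j | entryDeriv A i j τ ≠ 0}

/-- `𝒥_i`, the union of the `𝒥_i(τ_t)` over `t = 1, …, n`. -/
def suppAll {d : ℕ} (n : ℕ) (A : ℝ → Mat d) (i : Fin d) : Set (Fin d) :=
  ⋃ t ∈ times n, supp A i (gridPt n t)

/-- `𝒥'_i`, the union of the `𝒥'_i(τ_t)` over `t = 1, …, n`. -/
def suppDerivAll {d : ℕ} (n : ℕ) (A : ℝ → Mat d) (i : Fin d) : Set (Fin d) :=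
  ⋃ t ∈ times n, suppDeriv A i (gridPt n t)

/-- `s`, the maximal cardinality of the `𝒥_i`. -/
def sparsity {d : ℕ} (n : ℕ) (A : ℝ → Mat d) : ℕ := Finset.univ.sup fun i => (suppAll n A i).ncard

open Classical in
/-- The class `𝒮(q, ξ)` of uniformly sparse families of positive definite matrices, with bound `C`
on the column sums. With `q = 0` the last sum counts the nonzero entries of a row. -/
def SparseClass {d : ℕ} (q ξ C : ℝ) (W : ℝ → Mat d) : Prop :=
  ∀ τ ∈ Set.Icc (0 : ℝ) 1, (W τ).PosDef ∧ colSumNorm (W τ) ≤ C ∧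
    ∀ i, ∑ j, (if W τ i j = 0 then 0 else |W τ i j| ^ q) ≤ ξ

/-! ### Restricted eigenvalues -/

/-- `Ψ_k(τ)`. -/
def psiBlock {d : ℕ} (n : ℕ) (K : ℝ → ℝ) (h : ℝ) (x : ℤ → Fin d → ℝ) (k : ℕ) (τ : ℝ) : Mat d :=
  (1 / (n : ℝ)) • ∑ t ∈ times n,
    (((gridPt n t - τ) / h) ^ k * scaledKernel K h (gridPt n t - τ)) •
      Matrix.vecMulVec (x (t - 1)) (x (t - 1))

/-- `Ψ(τ)`. -/
def psi {d : ℕ} (n : ℕ) (K : ℝ → ℝ) (h : ℝ) (x : ℤ → Fin d → ℝ) (τ : ℝ) :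
    Matrix (Fin d ⊕ Fin d) (Fin d ⊕ Fin d) ℝ :=
  Matrix.fromBlocks (psiBlock n K h x 0 τ) (psiBlock n K h x 1 τ)
    (psiBlock n K h x 1 τ) (psiBlock n K h x 2 τ)

/-- The set `ℬ_i(τ)` of unit vectors that are concentrated on `𝒥_i(τ)` and `𝒥'_i(τ)`. -/
def cone {d : ℕ} (A : ℝ → Mat d) (i : Fin d) (τ : ℝ) : Set (Fin d ⊕ Fin d → ℝ) :=
  {u | ∑ j, u j ^ 2 = 1 ∧
    ∑ j, |u j| ≤ 3 * ((∑ j, (supp A i τ).indicator (fun j => |u (Sum.inl j)|) j)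
      + ∑ j, (suppDeriv A i τ).indicator (fun j => |u (Sum.inr j)|) j)}

/-- The uniform restricted eigenvalue inequality with constant `κ` for the sample path `x`. -/
def RestrictedEigen {d : ℕ} (n : ℕ) (K : ℝ → ℝ) (h κ : ℝ) (A : ℝ → Mat d)
    (x : ℤ → Fin d → ℝ) : Prop :=
  ∀ i, ∀ t ∈ times n, ∀ u ∈ cone A i (gridPt n t),
    κ ≤ u ⬝ᵥ (psi n K h x (gridPt n t)).mulVec u

/-! ### Rates -/

/-- `log (n ∨ d)`. -/
def logMax (n d : ℕ) : ℝ := Real.log ((max n d : ℕ) : ℝ)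

/-- `ζ_{n,d} = log(n ∨ d) [(nh)^{-1/2} + s h²]`. -/
def zeta (n d s : ℕ) (h : ℝ) : ℝ := logMax n d * (1 / √(n * h) + s * h ^ 2)

/-- `ν⋄ = [log(n ∨ d) / (nb)]^{1/2} + b²`. -/
def nuDiamond (n d : ℕ) (b : ℝ) : ℝ := √(logMax n d / (n * b)) + b ^ 2

/-- `ν* = s ζ_{n,d} [log(n ∨ d)]^{1/2}`. -/
def nuStar (n d s : ℕ) (h : ℝ) : ℝ := s * zeta n d s h * √(logMax n d)

/-- `sup_{τ ∈ [0,1]} Y n ω τ = O_P(r n)`, where `Y` is nonnegative: the probability that the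
supremum exceeds `M r n` is at most `δ` for all large `n` if `M` is chosen large in terms of `δ`.
Probabilities of sets that may fail to be measurable are outer probabilities. -/
def SupIsBigOP {S : ℕ → Type*} [∀ n, MeasurableSpace (S n)] (P : ∀ n, Measure (S n))
    (Y : ∀ n, S n → ℝ → ℝ) (r : ℕ → ℝ) : Prop :=
  ∀ δ : ℝ, 0 < δ → ∃ M : ℝ, 0 < M ∧ ∀ᶠ n in atTop,
    P n {ω | ∃ τ ∈ Set.Icc (0 : ℝ) 1, M * r n < Y n ω τ} ≤ ENNReal.ofReal δ

/-! ### Assumptions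

All constants are uniform in the sample size `n`. -/

/-- Stability and smoothness of the coefficient functions, and sub-Gaussian innovations. -/
structure RegularVAR {S : ℕ → Type*} [∀ n, MeasurableSpace (S n)] (P : ∀ n, Measure (S n))
    (d : ℕ → ℕ) (A Sig : ∀ n, ℝ → Mat (d n)) (ε : ∀ n, ℤ → S n → Fin (d n) → ℝ) : Prop where
  stable : ∀ n, 1 ≤ n → ∀ τ ∈ Set.Icc (0 : ℝ) 1, ∀ z : ℂ, ‖z‖ ≤ 1 →
    (1 - z • (A n τ).map (algebraMap ℝ ℂ)).det ≠ 0
  ma_decay : ∃ C ρ : ℝ, 0 < C ∧ 0 < ρ ∧ ρ < 1 ∧ ∀ n : ℕ, 1 ≤ n →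
    ∀ t ∈ Finset.Icc (0 : ℤ) (n : ℤ), ∀ k : ℕ, opNorm (maCoef n (A n) t k) ≤ C * ρ ^ k
  smooth_A : ∀ n, 1 ≤ n → ∀ i j, ContDiffOn ℝ 2 (fun τ => A n τ i j) (Set.Icc 0 1)
  smooth_Sig : ∀ n, 1 ≤ n → ∀ i j, ContDiffOn ℝ 2 (fun τ => Sig n τ i j) (Set.Icc 0 1)
  smooth_Om : ∀ n, 1 ≤ n → ∀ i j, ContDiffOn ℝ 2 (fun τ => (Sig n τ)⁻¹ i j) (Set.Icc 0 1)
  second_deriv_bound : ∃ L : ℝ, ∀ n, 1 ≤ n → ∀ i j, ∀ τ ∈ Set.Icc (0 : ℝ) 1,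
    |iteratedDerivWithin 2 (fun τ => A n τ i j) (Set.Icc 0 1) τ| ≤ L ∧
    |iteratedDerivWithin 2 (fun τ => Sig n τ i j) (Set.Icc 0 1) τ| ≤ L
  posDef : ∀ n, 1 ≤ n → ∀ τ ∈ Set.Icc (0 : ℝ) 1, ((Sig n τ)⁻¹).PosDef
  posSemidef : ∀ n, 1 ≤ n → ∀ τ ≤ (1 : ℝ), (Sig n τ).PosSemidef
  bounded_Sig : ∃ C : ℝ, ∀ n, 1 ≤ n → ∀ τ ≤ (1 : ℝ), opNorm (Sig n τ) ≤ C
  subGaussian : ∃ ι C : ℝ, 0 < ι ∧ 0 < C ∧ ∀ n, 1 ≤ n → ∀ t, ∀ u : Fin (d n) → ℝ,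
    ∑ i, u i ^ 2 = 1 →
      ∫⁻ ω, ENNReal.ofReal (Real.exp (ι * (u ⬝ᵥ ε n t ω) ^ 2)) ∂(P n) ≤ ENNReal.ofReal C

/-- The kernel is a symmetric Lipschitz continuous (hence, with its compact support, bounded)
probability density supported in `[-1, 1]`. -/
structure IsKernel (K : ℝ → ℝ) : Prop where
  nonneg : ∀ x, 0 ≤ K x
  symm : ∀ x, K (-x) = K x
  lipschitz : ∃ L, LipschitzWith L K
  support : ∀ x, 1 < |x| → K x = 0
  integral_one : ∫ x, K x = 1

/-- Conditions on the bandwidth `h` of the local linear objective. -/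
structure BandwidthCond (d s : ℕ → ℕ) (h : ℕ → ℝ) : Prop where
  pos : ∀ n, 1 ≤ n → 0 < h n
  large : Tendsto (fun n : ℕ => n * h n / logMax n (d n) ^ 2) atTop atTop
  small : Tendsto (fun n : ℕ => s n * h n ^ 2 * logMax n (d n)) atTop (𝓝 0)

/-- Conditions on the LASSO tuning parameter, and the restricted eigenvalue condition. -/
structure LassoCond {S : ℕ → Type*} [∀ n, MeasurableSpace (S n)] (P : ∀ n, Measure (S n))
    (d s : ℕ → ℕ) (A : ∀ n, ℝ → Mat (d n)) (X : ∀ n, ℤ → S n → Fin (d n) → ℝ)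
    (K : ℝ → ℝ) (h lam1 : ℕ → ℝ) : Prop where
  pos : ∀ n, 1 ≤ n → 0 < lam1 n
  dominates : (fun n => zeta n (d n) (s n) (h n)) =o[atTop] lam1
  small : Tendsto (fun n => √(s n : ℝ) * lam1 n / h n) atTop (𝓝 0)
  restricted_eigen : ∃ κ : ℝ, 0 < κ ∧ Tendsto
    (fun n => P n {ω | ¬ RestrictedEigen n K (h n) κ (A n) (fun t => X n t ω)}) atTop (𝓝 0)

/-- Conditions on the group LASSO tuning parameter, and minimal signal strength. -/
structure GroupLassoCond (d s : ℕ → ℕ) (A : ∀ n, ℝ → Mat (d n)) (h lam1 lam2 : ℕ → ℝ) :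
    Prop where
  pos : ∀ n, 1 ≤ n → 0 < lam2 n
  dominates : (fun n : ℕ => √(n : ℝ) * s n * logMax n (d n) * zeta n (d n) (s n) (h n)
    + √((n : ℝ) * s n) * lam1 n) =o[atTop] lam2
  signal : ∀ᶠ n in atTop, ∀ i, ∀ j ∈ suppAll n (A n) i,
    (scadConst + 1) * lam2 n ≤ pathNorm n fun t => A n (gridPt n t) i j
  signal_deriv : ∀ᶠ n in atTop, ∀ i, ∀ j ∈ suppDerivAll n (A n) i,
    (scadConst + 1) * lam2 n ≤ pathDev n fun t => A n (gridPt n t) i j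

/-- Conditions on the bandwidth `b` of the covariance estimate, and on `ζ_{n,d}`. -/
structure ClimeBandwidthCond (d s : ℕ → ℕ) (h b : ℕ → ℝ) : Prop where
  pos : ∀ n, 1 ≤ n → 0 < b n
  small : Tendsto b atTop (𝓝 0)
  large : Tendsto (fun n : ℕ => n * b n / logMax n (d n) ^ 3) atTop atTop
  zeta_small : Tendsto
    (fun n => s n * zeta n (d n) (s n) (h n) * √(logMax n (d n))) atTop (𝓝 0)

end TVNet

end

noncomputable section

namespace TVNet

/-! ### Exponential moments -/

/-! All randomness is confined to one event, `GoodPath`, whose complement has probability O(1/(n ∨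
d)) (`VARBound.measure_not_goodPath_le`). On that event the argument is deterministic, so it covers
every choice of the minimisers, is uniform in τ, and one constant serves for all error
probabilities.

Probability. Write X_t = Y_t + e_t with Y_t determined by the innovations before t. The errors are
sub-Gaussian, their products sub-exponential, and Y_t inherits Gaussian tails from the geometric
decay of Φ. The sums Σ K x_{t-1,j} e_{t,i} and Σ K Y_{t-1,j} e_{t-1,i} have coefficients fixed by
the strict past, so after truncation a Bernstein bound for martingale transforms applies
(`measure_abs_sum_ge_le`). The centred products of errors are sums of independent variables. No
concentration of X Xᵀ is needed: (δ·Y + δ·e)² ≥ (δ·e)² + 2(δ·Y)(δ·e), the last product is a small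
martingale term, and (δ·e)² concentrates around a form in Σ, whose least eigenvalue is bounded below
through the column sums of Ω (`sum_sq_le_of_inv_colSum`). With the nondegeneracy of the local linear
design (`IsKernel.exists_design_bound`) this gives a restricted eigenvalue inequality
(`GoodPath.gramForm_ge`), whose ℓ₁ loss is negligible on sparse vectors because ν* → 0.

Transition matrices. The score at the truth is O(ζ): noise plus a Taylor remainder over at most s
coordinates. So the LASSO error is O(√s λ₁) at each grid point, hence o(λ₂) in path norm, and the
SCAD weights vanish on the true groups and equal λ₂ on all others. Least squares restricted to the
true groups has zero score there, and elsewhere a score of path norm O(√n s log(n ∨ d) ζ) = o(λ₂).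
By convexity every minimiser agrees with it at the observation times (`group_lasso_eq`). The group
LASSO is thus an oracle estimator without shrinkage bias, with ℓ₁ error O(sζ)
(`GoodPath.coef_error`).

Precision matrix. Residuals differ from errors by O(sζ√log(n ∨ d)) = O(ν*), and local linear
smoothing adds ν⋄ (`GoodPath.sigmaHat_error`). If λ₃ dominates this error then Ω is feasible for
CLIME, so each CLIME column has ℓ₁ norm at most that of the column of Ω, and feasibility yields the
maximum norm bound. A vector close to a weakly sparse one in maximum norm and not larger in ℓ₁ norm
is close in ℓ₁ norm; Schur's test and the product of maximum and ℓ₁ bounds then give the other two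
norms (`clime_error`). -/

theorem exp_le_add_exp_sq (x : ℝ) : Real.exp x ≤ x + Real.exp (x ^ 2) := by
  have h2 : x ^ 2 + 1 ≤ Real.exp (x ^ 2) := Real.add_one_le_exp _
  by_cases hx : |x| ≤ 1
  · have := abs_le.1 (Real.abs_exp_sub_one_sub_id_le hx)
    linarith [this.2]
  · rcases lt_abs.1 (not_le.1 hx) with h | h
    · have : Real.exp x ≤ Real.exp (x ^ 2) := Real.exp_le_exp.2 (by nlinarith)
      linarith
    · have : Real.exp x ≤ 1 := Real.exp_le_one_iff.2 (by linarith)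
      nlinarith

theorem exp_le_one_add_add_sq_mul (x : ℝ) :
    Real.exp x ≤ 1 + x + x ^ 2 * Real.exp |x| := by
  have h := Complex.norm_exp_sub_sum_le_norm_mul_exp (x : ℂ) 2
  have e1 : Complex.exp (x : ℂ) - ∑ m ∈ Finset.range 2, (x : ℂ) ^ m / (m.factorial : ℂ)
      = ((Real.exp x - (1 + x) : ℝ) : ℂ) := by
    simp [Finset.sum_range_succ]
  rw [e1, Complex.norm_real, Complex.norm_real, Real.norm_eq_abs, Real.norm_eq_abs, sq_abs] at h
  linarith [le_abs_self (Real.exp x - (1 + x))]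

theorem exp_mul_le_one_sub_add {r y : ℝ} (h0 : 0 ≤ r) (h1 : r ≤ 1) :
    Real.exp (r * y) ≤ 1 - r + r * Real.exp y := by
  have := convexOn_exp.2 (Set.mem_univ 0) (Set.mem_univ y) (sub_nonneg.2 h1) h0 (by ring)
  simpa using this

theorem integrable_of_lintegral_ofReal_le {Ω : Type*} [MeasurableSpace Ω] {μ : Measure Ω}
    {f : Ω → ℝ} {C : ℝ} (hf : AEMeasurable f μ) (h0 : ∀ ω, 0 ≤ f ω) (hC : 0 ≤ C)
    (h : ∫⁻ ω, ENNReal.ofReal (f ω) ∂μ ≤ ENNReal.ofReal C) :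
    Integrable f μ ∧ ∫ ω, f ω ∂μ ≤ C := by
  constructor
  · refine ⟨hf.aestronglyMeasurable, ?_⟩
    rw [hasFiniteIntegral_iff_ofReal (Eventually.of_forall h0)]
    exact h.trans_lt ENNReal.ofReal_lt_top
  · rw [integral_eq_lintegral_of_nonneg_ae (Eventually.of_forall h0) hf.aestronglyMeasurable]
    exact ENNReal.toReal_le_of_le_ofReal hC h

theorem lintegral_ofReal_le_of_le {Ω : Type*} [MeasurableSpace Ω] {μ : Measure Ω}
    {f g : Ω → ℝ} {C : ℝ} (hg : Integrable g μ) (h0 : ∀ ω, 0 ≤ f ω) (hfg : ∀ ω, f ω ≤ g ω)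
    (h : ∫ ω, g ω ∂μ ≤ C) : ∫⁻ ω, ENNReal.ofReal (f ω) ∂μ ≤ ENNReal.ofReal C := by
  calc ∫⁻ ω, ENNReal.ofReal (f ω) ∂μ ≤ ∫⁻ ω, ENNReal.ofReal (g ω) ∂μ :=
        lintegral_mono fun ω => ENNReal.ofReal_le_ofReal (hfg ω)
    _ = ENNReal.ofReal (∫ ω, g ω ∂μ) :=
        (ofReal_integral_eq_lintegral_ofReal hg
          (Eventually.of_forall fun ω => (h0 ω).trans (hfg ω))).symm
    _ ≤ _ := ENNReal.ofReal_le_ofReal h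

/-- A centred variable with a finite exponential square moment is sub-Gaussian. -/
theorem mgf_le_of_exp_sq {Ω : Type*} [MeasurableSpace Ω] {μ : Measure Ω} [IsProbabilityMeasure μ]
    {g : Ω → ℝ} {ι C : ℝ} (hι : 0 < ι) (hC : 0 ≤ C) (hg : Integrable g μ)
    (h0 : ∫ ω, g ω ∂μ = 0)
    (hexp : ∫⁻ ω, ENNReal.ofReal (Real.exp (ι * g ω ^ 2)) ∂μ ≤ ENNReal.ofReal C) (θ : ℝ) :
    ∫⁻ ω, ENNReal.ofReal (Real.exp (θ * g ω)) ∂μ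
      ≤ ENNReal.ofReal (Real.exp ((C + 1) / ι * θ ^ 2)) := by
  obtain ⟨hint, hle⟩ := integrable_of_lintegral_ofReal_le
    (f := fun ω => Real.exp (ι * g ω ^ 2))
    ((hg.aemeasurable.pow_const 2).const_mul ι).exp (fun ω => (Real.exp_pos _).le) hC hexp
  -- For small θ, `exp_le_add_exp_sq` leaves a linear term that integrates to zero, and convexity in
  -- the ratio θ²/ι ≤ 1 reduces exp(θ²g²) to exp(ιg²). For large θ centring is not needed: θg ≤ θ²/ι
  -- + ιg² by completing the square.
  by_cases hθ : θ ^ 2 ≤ ι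
  · have hr0 : 0 ≤ θ ^ 2 / ι := by positivity
    have hr1 : θ ^ 2 / ι ≤ 1 := (div_le_one hι).2 hθ
    refine lintegral_ofReal_le_of_le
      (g := fun ω => θ * g ω + (1 - θ ^ 2 / ι + θ ^ 2 / ι * Real.exp (ι * g ω ^ 2)))
      ((hg.const_mul θ).add ((integrable_const _).add (hint.const_mul _)))
      (fun ω => (Real.exp_pos _).le) (fun ω => ?_) ?_
    · refine (exp_le_add_exp_sq (θ * g ω)).trans (add_le_add le_rfl ?_)
      have := exp_mul_le_one_sub_add (y := ι * g ω ^ 2) hr0 hr1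
      have e : θ ^ 2 / ι * (ι * g ω ^ 2) = (θ * g ω) ^ 2 := by field_simp
      rwa [e] at this
    · have hi : Integrable (fun ω => 1 - θ ^ 2 / ι + θ ^ 2 / ι * Real.exp (ι * g ω ^ 2)) μ :=
        (integrable_const _).add (hint.const_mul _)
      rw [integral_add (hg.const_mul θ) hi,
        integral_add (integrable_const _) (hint.const_mul _), integral_const_mul,
        integral_const_mul, h0]
      simp only [integral_const, probReal_univ, one_smul, mul_zero, zero_add]
      have h1 : θ ^ 2 / ι * ∫ ω, Real.exp (ι * g ω ^ 2) ∂μ ≤ θ ^ 2 / ι * C :=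
        mul_le_mul_of_nonneg_left hle hr0
      have h2 := Real.add_one_le_exp ((C + 1) / ι * θ ^ 2)
      have e : (C + 1) / ι * θ ^ 2 = θ ^ 2 / ι * C + θ ^ 2 / ι := by field_simp
      linarith
  · have hθ' : 1 ≤ θ ^ 2 / ι := (one_le_div hι).2 (not_le.1 hθ).le
    refine lintegral_ofReal_le_of_le
      (g := fun ω => Real.exp (θ ^ 2 / ι) * Real.exp (ι * g ω ^ 2)) (hint.const_mul _)
      (fun ω => (Real.exp_pos _).le) (fun ω => ?_) ?_
    · rw [← Real.exp_add, Real.exp_le_exp]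
      have e : θ ^ 2 / ι + ι * g ω ^ 2 - θ * g ω
          = 3 / 4 * (θ ^ 2 / ι) + ι * (g ω - θ / (2 * ι)) ^ 2 := by field_simp; ring
      have : 0 ≤ 3 / 4 * (θ ^ 2 / ι) + ι * (g ω - θ / (2 * ι)) ^ 2 := by positivity
      linarith
    · rw [integral_const_mul]
      have e : (C + 1) / ι * θ ^ 2 = θ ^ 2 / ι + C * (θ ^ 2 / ι) := by field_simp; ring
      rw [e, Real.exp_add]
      refine mul_le_mul_of_nonneg_left ?_ (Real.exp_pos _).le
      have := Real.add_one_le_exp (C * (θ ^ 2 / ι))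
      nlinarith

/-- A centred variable with a finite exponential moment is sub-exponential. -/
theorem mgf_le_of_exp_abs {Ω : Type*} [MeasurableSpace Ω] {μ : Measure Ω} [IsProbabilityMeasure μ]
    {g : Ω → ℝ} {κ C : ℝ} (hκ : 0 < κ) (hC : 0 ≤ C) (hg : Integrable g μ)
    (h0 : ∫ ω, g ω ∂μ = 0)
    (hexp : ∫⁻ ω, ENNReal.ofReal (Real.exp (κ * |g ω|)) ∂μ ≤ ENNReal.ofReal C)
    {θ : ℝ} (hθ : |θ| ≤ κ / 2) :
    ∫⁻ ω, ENNReal.ofReal (Real.exp (θ * g ω)) ∂μ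
      ≤ ENNReal.ofReal (Real.exp (8 * C / κ ^ 2 * θ ^ 2)) := by
  obtain ⟨hint, hle⟩ := integrable_of_lintegral_ofReal_le
    (f := fun ω => Real.exp (κ * |g ω|))
    (hg.aemeasurable.abs.const_mul κ).exp (fun ω => (Real.exp_pos _).le) hC hexp
  refine lintegral_ofReal_le_of_le
      (g := fun ω => θ * g ω + (1 + 8 * θ ^ 2 / κ ^ 2 * Real.exp (κ * |g ω|)))
      ((hg.const_mul θ).add ((integrable_const _).add (hint.const_mul _)))
      (fun ω => (Real.exp_pos _).le) (fun ω => ?_) ?_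
  · have h1 := exp_le_one_add_add_sq_mul (θ * g ω)
    have h2 : Real.exp |θ * g ω| ≤ Real.exp (κ / 2 * |g ω|) := by
      rw [abs_mul]
      exact Real.exp_le_exp.2 (mul_le_mul_of_nonneg_right hθ (abs_nonneg _))
    have h3 := Real.quadratic_le_exp_of_nonneg (x := κ / 2 * |g ω|) (by positivity)
    -- Half of the exponent κ|g| absorbs the quadratic factor of the Taylor remainder, by y²/2 ≤ exp
    -- y at y = κ|g|/2; the other half covers exp|θg|, which is why |θ| ≤ κ/2 is required.
    have h4 : (κ * |g ω|) ^ 2 ≤ 8 * Real.exp (κ / 2 * |g ω|) := by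
      have : 0 ≤ κ / 2 * |g ω| := by positivity
      nlinarith
    have e : Real.exp (κ * |g ω|) = Real.exp (κ / 2 * |g ω|) * Real.exp (κ / 2 * |g ω|) := by
      rw [← Real.exp_add]; ring_nf
    have h5 : (θ * g ω) ^ 2 * Real.exp |θ * g ω| ≤ 8 * θ ^ 2 / κ ^ 2 * Real.exp (κ * |g ω|) := by
      calc (θ * g ω) ^ 2 * Real.exp |θ * g ω|
          ≤ (θ * g ω) ^ 2 * Real.exp (κ / 2 * |g ω|) :=
            mul_le_mul_of_nonneg_left h2 (sq_nonneg _)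
        _ = θ ^ 2 / κ ^ 2 * ((κ * |g ω|) ^ 2 * Real.exp (κ / 2 * |g ω|)) := by
            rw [mul_pow, mul_pow, sq_abs]; field_simp
        _ ≤ θ ^ 2 / κ ^ 2 * (8 * Real.exp (κ / 2 * |g ω|) * Real.exp (κ / 2 * |g ω|)) := by
            gcongr
        _ = _ := by rw [e]; ring
    linarith
  · have hi : Integrable (fun ω => 1 + 8 * θ ^ 2 / κ ^ 2 * Real.exp (κ * |g ω|)) μ :=
      (integrable_const _).add (hint.const_mul _)
    rw [integral_add (hg.const_mul θ) hi,
      integral_add (integrable_const _) (hint.const_mul _), integral_const_mul,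
      integral_const_mul, h0]
    simp only [integral_const, probReal_univ, one_smul, mul_zero, zero_add]
    have h1 : 8 * θ ^ 2 / κ ^ 2 * ∫ ω, Real.exp (κ * |g ω|) ∂μ ≤ 8 * θ ^ 2 / κ ^ 2 * C :=
      mul_le_mul_of_nonneg_left hle (by positivity)
    have h2 := Real.add_one_le_exp (8 * C / κ ^ 2 * θ ^ 2)
    have e : 8 * C / κ ^ 2 * θ ^ 2 = 8 * θ ^ 2 / κ ^ 2 * C := by field_simp
    linarith

/-- Exponential Markov inequality. -/
theorem measure_le_of_lintegral_exp {Ω : Type*} [MeasurableSpace Ω] {μ : Measure Ω}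
    {g : Ω → ℝ} (hg : AEMeasurable g μ) {B x : ℝ}
    (h : ∫⁻ ω, ENNReal.ofReal (Real.exp (g ω)) ∂μ ≤ ENNReal.ofReal B) :
    μ {ω | x ≤ g ω} ≤ ENNReal.ofReal (B * Real.exp (-x)) := by
  have h1 := mul_meas_ge_le_lintegral₀ (μ := μ) (f := fun ω => ENNReal.ofReal (Real.exp (g ω)))
    hg.exp.ennreal_ofReal (ENNReal.ofReal (Real.exp x))
  have h2 : {ω | x ≤ g ω}
      ⊆ {ω | ENNReal.ofReal (Real.exp x) ≤ ENNReal.ofReal (Real.exp (g ω))} := fun ω hω =>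
    ENNReal.ofReal_le_ofReal (Real.exp_le_exp.2 hω)
  have hx : ENNReal.ofReal (Real.exp x) ≠ 0 := by simp [Real.exp_pos]
  calc μ {ω | x ≤ g ω} ≤ _ := measure_mono h2
    _ = ENNReal.ofReal (Real.exp (-x)) * (ENNReal.ofReal (Real.exp x) *
        μ {ω | ENNReal.ofReal (Real.exp x) ≤ ENNReal.ofReal (Real.exp (g ω))}) := by
        rw [← mul_assoc, ← ENNReal.ofReal_mul (Real.exp_pos _).le, ← Real.exp_add]; simp
    _ ≤ ENNReal.ofReal (Real.exp (-x)) * ENNReal.ofReal B := by gcongr; exact h1.trans h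
    _ = _ := by rw [← ENNReal.ofReal_mul (Real.exp_pos _).le, mul_comm]

/-! ### Exponential inequality for martingale transforms -/

/-- One step of the exponential supermartingale argument, without conditional expectations: (W, Z)
is independent of η, so their joint law is a product, and Fubini lets η be integrated first with Z
frozen at a value in the admissible range. -/
theorem lintegral_exp_mul_indep_le {Ω : Type*} {F : MeasurableSpace Ω} [mΩ : MeasurableSpace Ω] {μ : Measure Ω}
    [IsProbabilityMeasure μ] (hF : F ≤ mΩ) {W Z η : Ω → ℝ}
    (hW : Measurable[F] W) (hZ : Measurable[F] Z) (hη : Measurable η)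
    (hind : Indep F (MeasurableSpace.comap η inferInstance) μ) {B R c : ℝ}
    (hZB : ∀ ω, |Z ω| ≤ B) (hBR : B ≤ R) (hc : 0 ≤ c)
    (hmgf : ∀ z : ℝ, |z| ≤ R →
      ∫⁻ ω, ENNReal.ofReal (Real.exp (z * η ω)) ∂μ ≤ ENNReal.ofReal (Real.exp (c * z ^ 2))) :
    ∫⁻ ω, ENNReal.ofReal (Real.exp (W ω + Z ω * η ω)) ∂μ
      ≤ ENNReal.ofReal (Real.exp (c * B ^ 2)) * ∫⁻ ω, ENNReal.ofReal (Real.exp (W ω)) ∂μ := by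
  have hU : Measurable[F] (fun ω => (W ω, Z ω)) := Measurable.prodMk hW hZ
  have hU' : Measurable (fun ω => (W ω, Z ω)) := hU.mono hF le_rfl
  have hindep : IndepFun (fun ω => (W ω, Z ω)) η μ := by
    rw [IndepFun_iff_Indep]
    exact indep_of_indep_of_le_left hind hU.comap_le
  have hprod := (indepFun_iff_map_prod_eq_prod_map_map hU'.aemeasurable hη.aemeasurable).1 hindep
  have hmeas : Measurable fun p : (ℝ × ℝ) × ℝ => ENNReal.ofReal (Real.exp (p.1.1 + p.1.2 * p.2)) :=
    by fun_prop
  have hηm : Measurable fun p : (ℝ × ℝ) => ∫⁻ y, ENNReal.ofReal (Real.exp (p.1 + p.2 * y))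
      ∂(μ.map η) := by
    have : IsProbabilityMeasure (μ.map η) := Measure.isProbabilityMeasure_map hη.aemeasurable
    exact Measurable.lintegral_prod_right' hmeas
  calc ∫⁻ ω, ENNReal.ofReal (Real.exp (W ω + Z ω * η ω)) ∂μ
      = ∫⁻ p, ENNReal.ofReal (Real.exp (p.1.1 + p.1.2 * p.2))
          ∂(μ.map fun ω => ((W ω, Z ω), η ω)) := by
        rw [lintegral_map hmeas (hU'.prodMk hη)]
    _ = ∫⁻ u, ∫⁻ y, ENNReal.ofReal (Real.exp (u.1 + u.2 * y)) ∂(μ.map η)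
          ∂(μ.map fun ω => (W ω, Z ω)) := by
        have : IsProbabilityMeasure (μ.map η) := Measure.isProbabilityMeasure_map hη.aemeasurable
        rw [hprod, lintegral_prod _ hmeas.aemeasurable]
    _ = ∫⁻ ω, ∫⁻ y, ENNReal.ofReal (Real.exp (W ω + Z ω * y)) ∂(μ.map η) ∂μ := by
        rw [lintegral_map hηm hU']
    _ ≤ ∫⁻ ω, ENNReal.ofReal (Real.exp (c * B ^ 2)) * ENNReal.ofReal (Real.exp (W ω)) ∂μ := by
        refine lintegral_mono fun ω => ?_
        have hm1 : Measurable fun y : ℝ => ENNReal.ofReal (Real.exp (W ω + Z ω * y)) := by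
          fun_prop
        rw [lintegral_map hm1 hη]
        simp_rw [Real.exp_add, ENNReal.ofReal_mul (Real.exp_pos _).le]
        have hm2 : Measurable fun ω' : Ω => ENNReal.ofReal (Real.exp (Z ω * η ω')) := by
          fun_prop
        rw [lintegral_const_mul _ hm2, mul_comm]
        gcongr
        refine (hmgf (Z ω) ((hZB ω).trans hBR)).trans (ENNReal.ofReal_le_ofReal
          (Real.exp_le_exp.2 (mul_le_mul_of_nonneg_left ?_ hc)))
        rw [← sq_abs]
        exact pow_le_pow_left₀ (abs_nonneg _) (hZB ω) 2
    _ = _ := lintegral_const_mul _ (((hW.mono hF le_rfl).exp).ennreal_ofReal)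

/-- Peeling off the last increment costs a factor exp(c B²), which is deterministic because the
bounds on the weights are; so the factors simply multiply. -/
theorem lintegral_exp_sum_le {Ω : Type*} {F : ℕ → MeasurableSpace Ω} [mΩ : MeasurableSpace Ω]
    {μ : Measure Ω} [IsProbabilityMeasure μ] (hmono : Monotone F)
    (hF : ∀ i, F i ≤ mΩ) {Z η : ℕ → Ω → ℝ}
    (hZ : ∀ i, Measurable[F i] (Z i)) (hη : ∀ i, Measurable[F (i + 1)] (η i))
    (hind : ∀ i, Indep (F i) (MeasurableSpace.comap (η i) inferInstance) μ) {B : ℕ → ℝ} {R c : ℝ}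
    (hZB : ∀ i ω, |Z i ω| ≤ B i) (hBR : ∀ i, B i ≤ R) (hc : 0 ≤ c)
    (hmgf : ∀ i, ∀ z : ℝ, |z| ≤ R →
      ∫⁻ ω, ENNReal.ofReal (Real.exp (z * η i ω)) ∂μ ≤ ENNReal.ofReal (Real.exp (c * z ^ 2)))
    (m : ℕ) :
    (Measurable[F m] fun ω => ∑ i ∈ Finset.range m, Z i ω * η i ω) ∧
    ∫⁻ ω, ENNReal.ofReal (Real.exp (∑ i ∈ Finset.range m, Z i ω * η i ω)) ∂μ
      ≤ ENNReal.ofReal (Real.exp (c * ∑ i ∈ Finset.range m, B i ^ 2)) := by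
  induction m with
  | zero => exact ⟨by simp, by simp⟩
  | succ m ih =>
    obtain ⟨ih1, ih2⟩ := ih
    refine ⟨?_, ?_⟩
    · simp_rw [Finset.sum_range_succ]
      exact (ih1.mono (hmono m.le_succ) le_rfl).add
        (((hZ m).mono (hmono m.le_succ) le_rfl).mul (hη m))
    · simp_rw [Finset.sum_range_succ]
      refine (lintegral_exp_mul_indep_le (hF m) ih1 (hZ m) ((hη m).mono (hF (m + 1)) le_rfl) (hind m)
        (hZB m) (hBR m) hc (hmgf m)).trans ?_
      rw [mul_add, Real.exp_add, ENNReal.ofReal_mul (Real.exp_pos _).le, mul_comm]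
      gcongr

/-- Bernstein type inequality for martingale transforms. -/
theorem measure_abs_sum_ge_le {Ω : Type*} {F : ℕ → MeasurableSpace Ω} [mΩ : MeasurableSpace Ω]
    {μ : Measure Ω} [IsProbabilityMeasure μ] (hmono : Monotone F)
    (hF : ∀ i, F i ≤ mΩ) {Z η : ℕ → Ω → ℝ}
    (hZ : ∀ i, Measurable[F i] (Z i)) (hη : ∀ i, Measurable[F (i + 1)] (η i))
    (hind : ∀ i, Indep (F i) (MeasurableSpace.comap (η i) inferInstance) μ) {B : ℕ → ℝ} {R c : ℝ}
    (hZB : ∀ i ω, |Z i ω| ≤ B i) {θ : ℝ} (hθ : 0 < θ) (hBR : ∀ i, θ * B i ≤ R) (hc : 0 ≤ c)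
    (hmgf : ∀ i, ∀ z : ℝ, |z| ≤ R →
      ∫⁻ ω, ENNReal.ofReal (Real.exp (z * η i ω)) ∂μ ≤ ENNReal.ofReal (Real.exp (c * z ^ 2)))
    (m : ℕ) (x : ℝ) :
    μ {ω | x ≤ |∑ i ∈ Finset.range m, Z i ω * η i ω|}
      ≤ ENNReal.ofReal (2 * Real.exp (c * θ ^ 2 * ∑ i ∈ Finset.range m, B i ^ 2 - θ * x)) := by
  have key : ∀ σ : ℝ, |σ| = 1 →
      μ {ω | θ * x ≤ ∑ i ∈ Finset.range m, (σ * θ * Z i ω) * η i ω}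
      ≤ ENNReal.ofReal (Real.exp (c * θ ^ 2 * ∑ i ∈ Finset.range m, B i ^ 2 - θ * x)) := by
    intro σ hσ
    obtain ⟨hm, hle⟩ := lintegral_exp_sum_le (μ := μ) hmono hF (Z := fun i ω => σ * θ * Z i ω)
      (fun i => (hZ i).const_mul (σ * θ)) hη hind (B := fun i => θ * B i)
      (fun i ω => by
        rw [abs_mul, abs_mul, hσ, one_mul, abs_of_pos hθ]
        exact mul_le_mul_of_nonneg_left (hZB i ω) hθ.le) hBR hc hmgf m
    refine (measure_le_of_lintegral_exp (hm.mono (hF m) le_rfl).aemeasurable hle).trans (le_of_eq ?_)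
    rw [← Real.exp_add]
    simp_rw [mul_pow]
    rw [← Finset.mul_sum]
    ring_nf
  have hsub : {ω | x ≤ |∑ i ∈ Finset.range m, Z i ω * η i ω|} ⊆
      {ω | θ * x ≤ ∑ i ∈ Finset.range m, (1 * θ * Z i ω) * η i ω} ∪
      {ω | θ * x ≤ ∑ i ∈ Finset.range m, (-1 * θ * Z i ω) * η i ω} := by
    intro ω hω
    have e1 : ∑ i ∈ Finset.range m, (1 * θ * Z i ω) * η i ω
        = θ * ∑ i ∈ Finset.range m, Z i ω * η i ω := by
      rw [Finset.mul_sum]; exact Finset.sum_congr rfl fun i _ => by ring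
    have e2 : ∑ i ∈ Finset.range m, (-1 * θ * Z i ω) * η i ω
        = θ * -∑ i ∈ Finset.range m, Z i ω * η i ω := by
      rw [← Finset.sum_neg_distrib, Finset.mul_sum]; exact Finset.sum_congr rfl fun i _ => by ring
    simp only [Set.mem_union, Set.mem_ofPred_eq, e1, e2]
    rcases le_abs.1 (show x ≤ |_| from hω) with h | h
    · exact Or.inl (mul_le_mul_of_nonneg_left h hθ.le)
    · exact Or.inr (mul_le_mul_of_nonneg_left h hθ.le)
  refine (measure_mono hsub).trans ((measure_union_le _ _).trans
    ((add_le_add (key 1 (by simp)) (key (-1) (by simp))).trans (le_of_eq ?_)))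
  rw [← ENNReal.ofReal_add (Real.exp_pos _).le (Real.exp_pos _).le, two_mul]

/-! ### Operator norm and matrix square root -/

section Matrices

variable {d : ℕ}

theorem opNorm_nonneg (W : Mat d) : 0 ≤ opNorm W := norm_nonneg _

theorem opNorm_mul_le (V W : Mat d) : opNorm (V * W) ≤ opNorm V * opNorm W := by
  unfold opNorm
  rw [map_mul]
  exact norm_mul_le _ _

theorem opNorm_transpose (W : Mat d) : opNorm W.transpose = opNorm W := by
  unfold opNorm
  have h : W.transpose = star W := by
    rw [Matrix.star_eq_conjTranspose, Matrix.conjTranspose_eq_transpose_of_trivial]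
  rw [h, map_star, ContinuousLinearMap.star_eq_adjoint, LinearIsometryEquiv.norm_map]

theorem abs_apply_le_opNorm (W : Mat d) (i j : Fin d) : |W i j| ≤ opNorm W := by
  have h := (Matrix.toEuclideanCLM (n := Fin d) (𝕜 := ℝ) W).le_opNorm
    (EuclideanSpace.single j (1 : ℝ))
  rw [EuclideanSpace.single, PiLp.norm_single, norm_one, mul_one] at h
  refine le_trans ?_ h
  refine le_trans (le_of_eq ?_) (PiLp.norm_apply_le _ i)
  rw [Real.norm_eq_abs]
  congr 1
  simp [Matrix.ofLp_toEuclideanCLM]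

open scoped MatrixOrder in
theorem matSqrt_mul_self {W : Mat d} (hW : W.PosSemidef) : matSqrt W * matSqrt W = W :=
  CFC.sqrt_mul_sqrt_self W hW.nonneg

open scoped MatrixOrder in
theorem matSqrt_transpose (W : Mat d) : (matSqrt W).transpose = matSqrt W := by
  have h : (matSqrt W).PosSemidef := Matrix.nonneg_iff_posSemidef.1 (CFC.sqrt_nonneg W)
  have := h.isHermitian
  rwa [Matrix.IsHermitian, Matrix.conjTranspose_eq_transpose_of_trivial] at this

/-- Turns inner products of coefficient rows into covariances: V = 1 identifies the covariance of
e_t, and V = Φ_{t,k} gives the variance proxy of a moving average term. -/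
theorem row_mul_matSqrt_dotProduct {W : Mat d} (hW : W.PosSemidef) (V : Mat d) (i j : Fin d) :
    (V * matSqrt W) i ⬝ᵥ (V * matSqrt W) j = (V * W * V.transpose) i j := by
  have h : V * W * V.transpose = (V * matSqrt W) * (V * matSqrt W).transpose := by
    rw [Matrix.transpose_mul, matSqrt_transpose]
    simp only [Matrix.mul_assoc]
    rw [← Matrix.mul_assoc (matSqrt W), matSqrt_mul_self hW]
  rw [h, Matrix.mul_apply]
  rfl

theorem sum_sq_row_mul_matSqrt_le {W : Mat d} (hW : W.PosSemidef) (V : Mat d) (i : Fin d) :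
    ∑ k, (V * matSqrt W) i k ^ 2 ≤ opNorm V ^ 2 * opNorm W := by
  have h := row_mul_matSqrt_dotProduct hW V i i
  have h2 := (le_abs_self _).trans (abs_apply_le_opNorm (V * W * V.transpose) i i)
  have h3 := opNorm_mul_le (V * W) V.transpose
  have h4 := opNorm_mul_le V W
  rw [opNorm_transpose] at h3
  have e : ∑ k, (V * matSqrt W) i k ^ 2 = (V * matSqrt W) i ⬝ᵥ (V * matSqrt W) i := by
    simp only [dotProduct, sq]
  rw [e, h]
  nlinarith [opNorm_nonneg V]

end Matrices

/-! ### The filtration of the innovations. -/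

section Past

variable {S : Type*} {d : ℕ}

/-- The σ-algebra generated by the innovations up to time `t`. -/
@[reducible]
def pastSigma (ε : ℤ → S → Fin d → ℝ) (t : ℤ) : MeasurableSpace S :=
  ⨆ s ∈ Set.Iic t, MeasurableSpace.comap (ε s) inferInstance

theorem pastSigma_mono (ε : ℤ → S → Fin d → ℝ) : Monotone (pastSigma ε) := fun _ _ h =>
  biSup_mono fun _ hs => le_trans hs h

theorem measurable_pastSigma (ε : ℤ → S → Fin d → ℝ) {s t : ℤ} (h : s ≤ t) :
    Measurable[pastSigma ε t] (ε s) := by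
  rw [measurable_iff_comap_le]
  exact le_biSup (fun s => MeasurableSpace.comap (ε s) inferInstance) (Set.mem_Iic.2 h)

end Past

/-! ### Linear forms of the innovations -/

section LinearForms

variable {S : Type*} [MeasurableSpace S] {P : Measure S} {n d : ℕ} {A Sig : ℝ → Mat d}
  {ε X : ℤ → S → Fin d → ℝ}

/-- The innovations have uniform Gaussian tails in all directions. -/
def SubGaussianInnov (P : Measure S) (ε : ℤ → S → Fin d → ℝ) (ι C : ℝ) : Prop :=
  ∀ t, ∀ u : Fin d → ℝ, ∑ i, u i ^ 2 = 1 →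
    ∫⁻ ω, ENNReal.ofReal (Real.exp (ι * (u ⬝ᵥ ε t ω) ^ 2)) ∂P ≤ ENNReal.ofReal C

/-- Normalise v to a unit vector; any upper bound V of |v|² only weakens the exponent. The
degenerate case v = 0 is the reason for asking 1 ≤ C. -/
theorem SubGaussianInnov.lintegral_exp_le [IsProbabilityMeasure P] {ι C : ℝ}
    (h : SubGaussianInnov P ε ι C) (hι : 0 < ι) (hC : 1 ≤ C) {v : Fin d → ℝ} {V : ℝ}
    (hv : ∑ i, v i ^ 2 ≤ V) (t : ℤ) :
    ∫⁻ ω, ENNReal.ofReal (Real.exp (ι / V * (v ⬝ᵥ ε t ω) ^ 2)) ∂P ≤ ENNReal.ofReal C := by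
  have hr0 : 0 ≤ ∑ i, v i ^ 2 := Finset.sum_nonneg fun i _ => sq_nonneg _
  rcases hr0.eq_or_lt with hr | hr
  · have hv0 : v = 0 := by
      funext i
      have := (Finset.sum_eq_zero_iff_of_nonneg (fun i _ => sq_nonneg (v i))).1 hr.symm i
        (Finset.mem_univ i)
      simpa using this
    simp [hv0, hC]
  · set r := ∑ i, v i ^ 2 with hrdef
    have hs : 0 < √r := Real.sqrt_pos.2 hr
    have hu : ∑ i, ((√r)⁻¹ • v) i ^ 2 = 1 := by
      simp only [Pi.smul_apply, smul_eq_mul, mul_pow]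
      rw [← Finset.mul_sum, ← hrdef, inv_pow, Real.sq_sqrt hr0, inv_mul_cancel₀ hr.ne']
    refine le_trans (lintegral_mono fun ω => ENNReal.ofReal_le_ofReal (Real.exp_le_exp.2 ?_))
      (h t _ hu)
    rw [smul_dotProduct, smul_eq_mul, mul_pow, inv_pow, Real.sq_sqrt hr0]
    have : (v ⬝ᵥ ε t ω) ^ 2 / V ≤ (v ⬝ᵥ ε t ω) ^ 2 / r :=
      div_le_div_of_nonneg_left (sq_nonneg _) hr hv
    calc ι / V * (v ⬝ᵥ ε t ω) ^ 2 = ι * ((v ⬝ᵥ ε t ω) ^ 2 / V) := by ring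
      _ ≤ ι * ((v ⬝ᵥ ε t ω) ^ 2 / r) := mul_le_mul_of_nonneg_left this hι.le
      _ = _ := by ring

theorem IsTVVAR.identDistrib_comp (hm : IsTVVAR P n d A Sig ε X) {f : (Fin d → ℝ) → ℝ}
    (hf : Measurable f) (t : ℤ) :
    IdentDistrib (fun ω => f (ε t ω)) (fun ω => f (ε 0 ω)) P P :=
  (hm.ident t).comp hf

theorem IsTVVAR.integrable_dot (hm : IsTVVAR P n d A Sig ε X) (v : Fin d → ℝ) (t : ℤ) :
    Integrable (fun ω => v ⬝ᵥ ε t ω) P ∧ ∫ ω, v ⬝ᵥ ε t ω ∂P = 0 := by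
  have hf : Measurable fun x : Fin d → ℝ => v ⬝ᵥ x := by
    simp only [dotProduct]; fun_prop
  have hid := hm.identDistrib_comp hf t
  have h0 : Integrable (fun ω => v ⬝ᵥ ε 0 ω) P := by
    simp only [dotProduct]
    exact integrable_finsetSum _ fun i _ => (hm.integrable i).const_mul _
  refine ⟨hid.integrable_iff.2 h0, ?_⟩
  rw [hid.integral_eq]
  simp only [dotProduct]
  rw [integral_finsetSum _ fun i _ => (hm.integrable i).const_mul _]
  simp_rw [integral_const_mul, hm.mean_zero]
  simp

theorem IsTVVAR.integrable_dot_mul (hm : IsTVVAR P n d A Sig ε X) (v w : Fin d → ℝ) (t : ℤ) :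
    Integrable (fun ω => (v ⬝ᵥ ε t ω) * (w ⬝ᵥ ε t ω)) P ∧
      ∫ ω, (v ⬝ᵥ ε t ω) * (w ⬝ᵥ ε t ω) ∂P = v ⬝ᵥ w := by
  have hf : Measurable fun x : Fin d → ℝ => (v ⬝ᵥ x) * (w ⬝ᵥ x) := by
    simp only [dotProduct]; fun_prop
  have hid := hm.identDistrib_comp hf t
  have e : (fun ω => (v ⬝ᵥ ε 0 ω) * (w ⬝ᵥ ε 0 ω))
      = fun ω => ∑ i, ∑ j, v i * w j * (ε 0 ω i * ε 0 ω j) := by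
    funext ω
    simp only [dotProduct, Finset.sum_mul_sum]
    exact Finset.sum_congr rfl fun i _ => Finset.sum_congr rfl fun j _ => by ring
  have hi : ∀ i, Integrable (fun ω => ∑ j, v i * w j * (ε 0 ω i * ε 0 ω j)) P := fun i =>
    integrable_finsetSum _ fun j _ => (hm.integrable_mul i j).const_mul _
  have h0 : Integrable (fun ω => (v ⬝ᵥ ε 0 ω) * (w ⬝ᵥ ε 0 ω)) P := by
    rw [e]
    exact integrable_finsetSum _ fun i _ => hi i
  refine ⟨hid.integrable_iff.2 h0, ?_⟩
  rw [hid.integral_eq, e, integral_finsetSum _ fun i _ => hi i]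
  have : ∀ i, ∫ ω, ∑ j, v i * w j * (ε 0 ω i * ε 0 ω j) ∂P = v i * w i := by
    intro i
    rw [integral_finsetSum _ fun j _ => (hm.integrable_mul i j).const_mul _]
    simp_rw [integral_const_mul, hm.cov_one]
    simp [Matrix.one_apply]
  simp_rw [this]
  rfl

theorem pastSigma_le (h : ∀ t, Measurable (ε t)) (t : ℤ) :
    pastSigma ε t ≤ (inferInstance : MeasurableSpace S) :=
  iSup₂_le fun s _ => (h s).comap_le

theorem IsTVVAR.indep_pastSigma (hm : IsTVVAR P n d A Sig ε X) {s t : ℤ} (h : s < t) :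
    Indep (pastSigma ε s) (MeasurableSpace.comap (ε t) inferInstance) P := by
  have hd : Disjoint (Set.Iic s) ({t} : Set ℤ) := by
    rw [Set.disjoint_singleton_right]
    exact fun h' => absurd (Set.mem_Iic.1 h') (not_le.2 h)
  have := indep_iSup_of_disjoint (fun i => (hm.measurable i).comap_le)
    ((iIndepFun_iff_iIndep _ _ _).1 hm.indep) hd
  simpa [pastSigma] using this

theorem sum_times {M : Type*} [AddCommMonoid M] (n : ℕ) (f : ℤ → M) :
    ∑ t ∈ times n, f t = ∑ i ∈ Finset.range n, f (i + 1) := by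
  symm
  refine Finset.sum_bij (fun i _ => (i : ℤ) + 1) ?_ ?_ ?_ ?_
  · intro i hi
    simp only [times, Finset.mem_Icc, Finset.mem_range] at *
    omega
  · intro a _ b _ h
    have h' : (a : ℤ) + 1 = (b : ℤ) + 1 := h
    omega
  · intro t ht
    simp only [times, Finset.mem_Icc] at ht
    exact ⟨(t - 1).toNat, by simp only [Finset.mem_range]; omega, by omega⟩
  · intros; rfl

/-- Bernstein type inequality for weighted sums of functions of the innovations, with weights
that depend on the strict past. -/
theorem IsTVVAR.measure_abs_sum_ge_le [IsProbabilityMeasure P] (hm : IsTVVAR P n d A Sig ε X)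
    (a : ℤ) {Z : ℤ → S → ℝ} (hZ : ∀ t, Measurable[pastSigma ε (t - a - 1)] (Z t))
    {f : ℤ → (Fin d → ℝ) → ℝ} (hf : ∀ t, Measurable (f t)) {B : ℤ → ℝ}
    (hZB : ∀ t ω, |Z t ω| ≤ B t) {R c θ : ℝ} (hθ : 0 < θ) (hBR : ∀ t, θ * B t ≤ R) (hc : 0 ≤ c)
    (hmgf : ∀ t ∈ times n, ∀ z : ℝ, |z| ≤ R →
      ∫⁻ ω, ENNReal.ofReal (Real.exp (z * f t (ε (t - a) ω))) ∂P
        ≤ ENNReal.ofReal (Real.exp (c * z ^ 2))) (x : ℝ) :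
    P {ω | x ≤ |∑ t ∈ times n, Z t ω * f t (ε (t - a) ω)|}
      ≤ ENNReal.ofReal (2 * Real.exp (c * θ ^ 2 * ∑ t ∈ times n, B t ^ 2 - θ * x)) := by
  classical
  -- The abstract inequality wants the moment bound at every index, whereas it is available only at
  -- observation times; outside them the summand is replaced by zero.
  let f' : ℤ → (Fin d → ℝ) → ℝ := fun t => if t ∈ times n then f t else 0
  have hf' : ∀ t, Measurable (f' t) := by
    intro t
    by_cases ht : t ∈ times n
    · simpa only [f', ht, if_true] using hf t
    · simp only [f', ht, if_false]; exact measurable_const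
  -- Index i stands for time t = i + 1. The weight at t is known at time t - a - 1 = i - a, and the
  -- innovation at t - a = i + 1 - a becomes known one filtration step later.
  have key := TVNet.measure_abs_sum_ge_le (μ := P) (F := fun i : ℕ => pastSigma ε ((i : ℤ) - a))
    (fun i j hij => pastSigma_mono ε (by omega)) (fun i => pastSigma_le hm.measurable _)
    (Z := fun i => Z (i + 1)) (η := fun i ω => f' (i + 1) (ε ((i : ℤ) + 1 - a) ω))
    (fun i => by
      have := hZ (i + 1)
      have e : (i : ℤ) + 1 - a - 1 = i - a := by ring
      rwa [e] at this)
    (fun i => (hf' _).comp (measurable_pastSigma ε (by push_cast; omega)))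
    (fun i => indep_of_indep_of_le_right (hm.indep_pastSigma (s := (i : ℤ) - a)
        (t := (i : ℤ) + 1 - a) (by omega)) (by
      rintro _ ⟨u, hu, rfl⟩
      exact ⟨_, hf' ((i : ℤ) + 1) hu, rfl⟩))
    (B := fun i => B (i + 1)) (R := R) (c := c) (fun i ω => hZB _ ω) hθ (fun i => hBR _) hc
    (fun i z hz => by
      by_cases ht : ((i : ℤ) + 1) ∈ times n
      · simpa only [f', ht, if_true] using hmgf _ ht z hz
      · simp only [f', ht, if_false, Pi.zero_apply, mul_zero, Real.exp_zero, ENNReal.ofReal_one,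
          lintegral_const, measure_univ, mul_one]
        rw [← ENNReal.ofReal_one]
        exact ENNReal.ofReal_le_ofReal (Real.one_le_exp (by positivity)))
    n x
  rw [sum_times]
  refine le_trans (le_of_eq ?_) key
  congr 1
  ext ω
  simp only [Set.mem_ofPred_eq]
  rw [sum_times]
  have : ∀ i ∈ Finset.range n, Z ((i : ℤ) + 1) ω * f ((i : ℤ) + 1) (ε ((i : ℤ) + 1 - a) ω)
      = Z ((i : ℤ) + 1) ω * f' ((i : ℤ) + 1) (ε ((i : ℤ) + 1 - a) ω) := by
    intro i hi
    have ht : ((i : ℤ) + 1) ∈ times n := by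
      simp only [times, Finset.mem_Icc, Finset.mem_range] at *; omega
    simp only [f', ht, if_true]
  rw [Finset.sum_congr rfl this]

end LinearForms

/-! ### Moments of the errors and of the process -/

/-- Uniform bounds on the second moments and moving average coefficients of a time-varying VAR
with Gaussian tails. -/
structure VARBound {S : Type*} [MeasurableSpace S] (P : Measure S) (n d : ℕ)
    (A Sig : ℝ → Mat d) (ε : ℤ → S → Fin d → ℝ) (ι C D C₁ ρ : ℝ) : Prop where
  n_pos : 1 ≤ n
  iota_pos : 0 < ι
  one_le_C : 1 ≤ C
  D_pos : 0 < D
  C₁_pos : 0 < C₁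
  rho_pos : 0 < ρ
  rho_lt : ρ < 1
  subGaussian : SubGaussianInnov P ε ι C
  posSemidef : ∀ τ ≤ (1 : ℝ), (Sig τ).PosSemidef
  bound : ∀ τ ≤ (1 : ℝ), opNorm (Sig τ) ≤ D
  decay : ∀ t ∈ Finset.Icc (0 : ℤ) (n : ℤ), ∀ k : ℕ, opNorm (maCoef n A t k) ≤ C₁ * ρ ^ k

/-- The part of `X_t` that is determined by the errors before time `t`. -/
def pastPart {S : Type*} {d : ℕ} (n : ℕ) (A Sig : ℝ → Mat d) (ε : ℤ → S → Fin d → ℝ) (t : ℤ)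
    (ω : S) (j : Fin d) : ℝ :=
  limsup (fun m : ℕ => ∑ k ∈ Finset.range m, ((maCoef n A t (k + 1)).mulVec
    (varError n Sig ε (t - ((k + 1 : ℕ) : ℤ)) ω)) j) atTop

section

variable {S : Type*} {d : ℕ}

theorem measurable_varError_pastSigma (n : ℕ) (Sig : ℝ → Mat d) (ε : ℤ → S → Fin d → ℝ) {s t : ℤ}
    (h : s ≤ t) (i : Fin d) :
    Measurable[pastSigma ε t] fun ω => varError n Sig ε s ω i := by
  have h1 : Measurable fun x : Fin d → ℝ => matSqrt (Sig (gridPt n s)) i ⬝ᵥ x := by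
    simp only [dotProduct]; fun_prop
  exact h1.comp (measurable_pastSigma ε h)

theorem measurable_mulVec_varError (n : ℕ) (Sig : ℝ → Mat d) (ε : ℤ → S → Fin d → ℝ) {s t : ℤ}
    (h : s ≤ t) (M : Mat d) (i : Fin d) :
    Measurable[pastSigma ε t] fun ω => M.mulVec (varError n Sig ε s ω) i := by
  have h1 : Measurable fun x : Fin d → ℝ => (M * matSqrt (Sig (gridPt n s))) i ⬝ᵥ x := by
    simp only [dotProduct]; fun_prop
  have h2 := h1.comp (measurable_pastSigma ε h)
  refine (congrArg (Measurable[pastSigma ε t]) ?_).mp h2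
  funext ω
  simp only [varError, Matrix.mulVec_mulVec]
  rfl

/-- Taking a limsup instead of the almost sure limit makes the past part measurable for the strict
past itself, not merely up to null sets. -/
theorem measurable_pastPart (n : ℕ) (A Sig : ℝ → Mat d) (ε : ℤ → S → Fin d → ℝ) (t : ℤ)
    (j : Fin d) : Measurable[pastSigma ε (t - 1)] fun ω => pastPart n A Sig ε t ω j := by
  let _ : MeasurableSpace S := pastSigma ε (t - 1)
  refine Measurable.limsup fun m => ?_
  refine Finset.measurable_fun_sum _ fun k _ => ?_
  exact measurable_mulVec_varError n Sig ε (by push_cast; omega) _ _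

end

section

variable {S : Type*} [MeasurableSpace S] {P : Measure S} {n d : ℕ} {A Sig : ℝ → Mat d}
  {ε X : ℤ → S → Fin d → ℝ} {ι C D C₁ ρ : ℝ}

theorem gridPt_le_one (hn : 1 ≤ n) {t : ℤ} (ht : t ≤ n) : gridPt n t ≤ 1 := by
  have : (0 : ℝ) < n := by exact_mod_cast hn
  unfold gridPt
  rw [div_le_one this]
  exact_mod_cast ht

theorem gridPt_nonneg {t : ℤ} (ht : 0 ≤ t) : 0 ≤ gridPt n t := by
  unfold gridPt
  have : (0 : ℝ) ≤ t := by exact_mod_cast ht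
  positivity

theorem VARBound.sum_sq_le (hb : VARBound P n d A Sig ε ι C D C₁ ρ) {t : ℤ} (ht : t ≤ n)
    (i : Fin d) : ∑ k, matSqrt (Sig (gridPt n t)) i k ^ 2 ≤ D := by
  have hτ := gridPt_le_one hb.n_pos ht
  have h := row_mul_matSqrt_dotProduct (hb.posSemidef _ hτ) 1 i i
  rw [Matrix.transpose_one, Matrix.mul_one, Matrix.one_mul, Matrix.one_mul] at h
  have h2 := (le_abs_self _).trans ((abs_apply_le_opNorm (Sig (gridPt n t)) i i).trans
    (hb.bound _ hτ))
  rw [← h] at h2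
  simpa only [dotProduct, sq] using h2

theorem VARBound.abs_Sig_le (hb : VARBound P n d A Sig ε ι C D C₁ ρ) {τ : ℝ} (hτ : τ ≤ 1)
    (i j : Fin d) : |Sig τ i j| ≤ D :=
  (abs_apply_le_opNorm _ i j).trans (hb.bound _ hτ)

theorem VARBound.lintegral_exp_varError_sq_le [IsProbabilityMeasure P]
    (hb : VARBound P n d A Sig ε ι C D C₁ ρ) {t : ℤ} (ht : t ≤ n) (i : Fin d) :
    ∫⁻ ω, ENNReal.ofReal (Real.exp (ι / D * varError n Sig ε t ω i ^ 2)) ∂P ≤ ENNReal.ofReal C :=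
  hb.subGaussian.lintegral_exp_le hb.iota_pos hb.one_le_C (hb.sum_sq_le ht i) t

theorem VARBound.mgf_varError_le [IsProbabilityMeasure P]
    (hb : VARBound P n d A Sig ε ι C D C₁ ρ) (hm : IsTVVAR P n d A Sig ε X) {t : ℤ} (ht : t ≤ n)
    (i : Fin d) (z : ℝ) :
    ∫⁻ ω, ENNReal.ofReal (Real.exp (z * varError n Sig ε t ω i)) ∂P
      ≤ ENNReal.ofReal (Real.exp ((C + 1) / (ι / D) * z ^ 2)) :=
  mgf_le_of_exp_sq (div_pos hb.iota_pos hb.D_pos) (zero_le_one.trans hb.one_le_C)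
    (hm.integrable_dot _ t).1 (hm.integrable_dot _ t).2 (hb.lintegral_exp_varError_sq_le ht i) z

/-- Products of sub-Gaussian variables are sub-exponential: |ab| ≤ (a² + b²)/2 and convexity of the
exponential reduce the exponential moment of the product to those of the squares. The centring Σ_ij
costs only the factor exp(ι), in the form exp(ι/D · D). The bound holds for small z only. -/
theorem VARBound.mgf_varError_mul_le [IsProbabilityMeasure P]
    (hb : VARBound P n d A Sig ε ι C D C₁ ρ) (hm : IsTVVAR P n d A Sig ε X) {t : ℤ} (ht : t ≤ n)
    (i j : Fin d) {z : ℝ} (hz : |z| ≤ ι / D / 2) :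
    ∫⁻ ω, ENNReal.ofReal (Real.exp (z * (varError n Sig ε t ω i * varError n Sig ε t ω j
        - Sig (gridPt n t) i j))) ∂P
      ≤ ENNReal.ofReal (Real.exp (8 * (Real.exp (ι / D * D) * C) / (ι / D) ^ 2 * z ^ 2)) := by
  have hτ := gridPt_le_one hb.n_pos ht
  have hκ : 0 < ι / D := div_pos hb.iota_pos hb.D_pos
  have hC : 0 ≤ C := zero_le_one.trans hb.one_le_C
  obtain ⟨h1, h2⟩ := hm.integrable_dot_mul (matSqrt (Sig (gridPt n t)) i)
    (matSqrt (Sig (gridPt n t)) j) t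
  have h3 := row_mul_matSqrt_dotProduct (hb.posSemidef _ hτ) 1 i j
  rw [Matrix.transpose_one, Matrix.mul_one, Matrix.one_mul, Matrix.one_mul] at h3
  rw [h3] at h2
  have hint : ∀ i, Integrable (fun ω => Real.exp (ι / D * varError n Sig ε t ω i ^ 2)) P ∧
      ∫ ω, Real.exp (ι / D * varError n Sig ε t ω i ^ 2) ∂P ≤ C := fun i =>
    integrable_of_lintegral_ofReal_le
      ((((hm.integrable_dot _ t).1.aemeasurable.pow_const 2).const_mul _).exp)
      (fun ω => (Real.exp_pos _).le) hC (hb.lintegral_exp_varError_sq_le ht i)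
  refine mgf_le_of_exp_abs hκ (by positivity) (h1.sub (integrable_const _)) ?_ ?_ hz
  · refine (integral_sub h1 (integrable_const _)).trans ?_
    rw [h2]
    simp
  · refine lintegral_ofReal_le_of_le (g := fun ω => Real.exp (ι / D * D) *
      ((1 / 2) * (Real.exp (ι / D * varError n Sig ε t ω i ^ 2)
        + Real.exp (ι / D * varError n Sig ε t ω j ^ 2))))
      ((((hint i).1.add (hint j).1).const_mul _).const_mul _) (fun ω => (Real.exp_pos _).le) ?_ ?_
    · intro ω
      set a := varError n Sig ε t ω i
      set b := varError n Sig ε t ω j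
      have hab : |a * b - Sig (gridPt n t) i j| ≤ (a ^ 2 + b ^ 2) / 2 + D := by
        have e1 := abs_sub (a * b) (Sig (gridPt n t) i j)
        have e2 := hb.abs_Sig_le hτ i j
        have e3 : |a * b| ≤ (a ^ 2 + b ^ 2) / 2 := by
          rw [abs_mul]; nlinarith [sq_nonneg (|a| - |b|), sq_abs a, sq_abs b]
        linarith
      have hcx := convexOn_exp.2 (Set.mem_univ (ι / D * a ^ 2)) (Set.mem_univ (ι / D * b ^ 2))
        (by norm_num : (0 : ℝ) ≤ 1 / 2) (by norm_num : (0 : ℝ) ≤ 1 / 2) (by norm_num)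
      simp only [smul_eq_mul] at hcx
      calc Real.exp (ι / D * |a * b - Sig (gridPt n t) i j|)
          ≤ Real.exp (ι / D * D + (1 / 2 * (ι / D * a ^ 2) + 1 / 2 * (ι / D * b ^ 2))) := by
            apply Real.exp_le_exp.2
            nlinarith
        _ ≤ _ := by
            rw [Real.exp_add]
            refine mul_le_mul_of_nonneg_left ?_ (Real.exp_pos _).le
            linarith
    · rw [integral_const_mul, integral_const_mul, integral_add (hint i).1 (hint j).1]
      refine mul_le_mul_of_nonneg_left ?_ (Real.exp_pos _).le
      linarith [(hint i).2, (hint j).2]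

/-- Jensen's inequality for the exponential with subprobability weights. -/
theorem exp_sum_mul_le {κ : Type*} (s : Finset κ) {p y : κ → ℝ} (hp : ∀ k ∈ s, 0 ≤ p k)
    (hp1 : ∑ k ∈ s, p k ≤ 1) :
    Real.exp (∑ k ∈ s, p k * y k) ≤ 1 - ∑ k ∈ s, p k + ∑ k ∈ s, p k * Real.exp (y k) := by
  set m := ∑ k ∈ s, p k * y k with hm
  -- Tangent line of the exponential at the weighted sum m. The missing mass 1 - Σp is placed at the
  -- point 0; its tangent inequality is `h3` below.
  have h1 : ∀ k ∈ s, p k * (Real.exp m * (1 + (y k - m))) ≤ p k * Real.exp (y k) := by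
    intro k hk
    refine mul_le_mul_of_nonneg_left ?_ (hp k hk)
    have := Real.add_one_le_exp (y k - m)
    calc Real.exp m * (1 + (y k - m)) ≤ Real.exp m * Real.exp (y k - m) :=
          mul_le_mul_of_nonneg_left (by linarith) (Real.exp_pos _).le
      _ = Real.exp (y k) := by rw [← Real.exp_add]; ring_nf
  have h2 := Finset.sum_le_sum h1
  have e : ∑ k ∈ s, p k * (Real.exp m * (1 + (y k - m)))
      = Real.exp m * ((1 - m) * ∑ k ∈ s, p k + m) := by
    rw [hm, mul_add, Finset.mul_sum, Finset.mul_sum, ← hm, Finset.mul_sum, ← Finset.sum_add_distrib]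
    exact Finset.sum_congr rfl fun k _ => by ring
  rw [e] at h2
  have h3 : Real.exp m * (1 - m) ≤ 1 := by
    have := Real.add_one_le_exp (-m)
    calc Real.exp m * (1 - m) ≤ Real.exp m * Real.exp (-m) :=
          mul_le_mul_of_nonneg_left (by linarith) (Real.exp_pos _).le
      _ = 1 := by rw [← Real.exp_add]; simp
  nlinarith

/-- Cauchy–Schwarz with weights p gives (Σg)² ≤ Σ p (g/p)², and Jensen finishes. Dependence between
the summands plays no role; all that matters is that each g/p has the same exponential square
moment. -/
theorem lintegral_exp_sq_sum_le [IsProbabilityMeasure P] {κ : Type*} (s : Finset κ) {p : κ → ℝ}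
    {g : κ → S → ℝ} {γ C : ℝ} (hγ : 0 ≤ γ) (hC : 1 ≤ C) (hp : ∀ k ∈ s, 0 < p k)
    (hp1 : ∑ k ∈ s, p k ≤ 1) (hg : ∀ k ∈ s, AEMeasurable (g k) P)
    (h : ∀ k ∈ s, ∫⁻ ω, ENNReal.ofReal (Real.exp (γ * (g k ω / p k) ^ 2)) ∂P ≤ ENNReal.ofReal C) :
    ∫⁻ ω, ENNReal.ofReal (Real.exp (γ * (∑ k ∈ s, g k ω) ^ 2)) ∂P ≤ ENNReal.ofReal C := by
  have hint : ∀ k ∈ s, Integrable (fun ω => Real.exp (γ * (g k ω / p k) ^ 2)) P ∧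
      ∫ ω, Real.exp (γ * (g k ω / p k) ^ 2) ∂P ≤ C := fun k hk =>
    integrable_of_lintegral_ofReal_le
      (((((hg k hk).div_const _).pow_const 2).const_mul _).exp)
      (fun ω => (Real.exp_pos _).le) (zero_le_one.trans hC) (h k hk)
  have hi : Integrable (fun ω => ∑ k ∈ s, p k * Real.exp (γ * (g k ω / p k) ^ 2)) P :=
    integrable_finsetSum _ fun k hk => (hint k hk).1.const_mul _
  refine lintegral_ofReal_le_of_le (g := fun ω => 1 - ∑ k ∈ s, p k
    + ∑ k ∈ s, p k * Real.exp (γ * (g k ω / p k) ^ 2)) ((integrable_const _).add hi)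
    (fun ω => (Real.exp_pos _).le) ?_ ?_
  · intro ω
    refine le_trans (Real.exp_le_exp.2 ?_) (exp_sum_mul_le s (fun k hk => (hp k hk).le) hp1)
    have h1 : (∑ k ∈ s, g k ω) ^ 2 ≤ (∑ k ∈ s, p k) * ∑ k ∈ s, p k * (g k ω / p k) ^ 2 := by
      refine Finset.sum_sq_le_sum_mul_sum_of_sq_le_mul s (fun k hk => (hp k hk).le)
        (fun k hk => mul_nonneg (hp k hk).le (sq_nonneg _)) fun k hk => ?_
      have := (hp k hk).ne'
      refine le_of_eq ?_
      field_simp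
    have h2 : 0 ≤ ∑ k ∈ s, p k * (g k ω / p k) ^ 2 :=
      Finset.sum_nonneg fun k hk => mul_nonneg (hp k hk).le (sq_nonneg _)
    calc γ * (∑ k ∈ s, g k ω) ^ 2 ≤ γ * ∑ k ∈ s, p k * (g k ω / p k) ^ 2 :=
          mul_le_mul_of_nonneg_left (by nlinarith) hγ
      _ = _ := by rw [Finset.mul_sum]; exact Finset.sum_congr rfl fun k _ => by ring
  · rw [integral_add (integrable_const _) hi,
      integral_finsetSum _ fun k hk => (hint k hk).1.const_mul _]
    simp_rw [integral_const_mul]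
    have h1 : ∑ k ∈ s, p k * ∫ ω, Real.exp (γ * (g k ω / p k) ^ 2) ∂P ≤ ∑ k ∈ s, p k * C :=
      Finset.sum_le_sum fun k hk => mul_le_mul_of_nonneg_left (hint k hk).2 (hp k hk).le
    rw [← Finset.sum_mul] at h1
    simp only [integral_const, probReal_univ, one_smul]
    nlinarith

theorem IsTVVAR.tendsto_pastPart (hm : IsTVVAR P n d A Sig ε X) {t : ℤ}
    (ht : t ∈ Finset.Icc (0 : ℤ) n) : ∀ᵐ ω ∂P, ∀ j,
      Tendsto (fun m : ℕ => ∑ k ∈ Finset.range m, ((maCoef n A t (k + 1)).mulVec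
        (varError n Sig ε (t - ((k + 1 : ℕ) : ℤ)) ω)) j) atTop
        (𝓝 (X t ω j - varError n Sig ε t ω j)) := by
  filter_upwards [hm.moving_average t ht] with ω hω j
  have h1 : HasSum _ (X t ω j) := (Pi.hasSum.1 hω) j
  rw [← hasSum_nat_add_iff' 1] at h1
  have h2 := h1.tendsto_sum_nat
  simpa [maCoef] using h2

theorem IsTVVAR.eq_pastPart_add (hm : IsTVVAR P n d A Sig ε X) {t : ℤ}
    (ht : t ∈ Finset.Icc (0 : ℤ) n) :
    ∀ᵐ ω ∂P, ∀ j, X t ω j = pastPart n A Sig ε t ω j + varError n Sig ε t ω j := by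
  filter_upwards [hm.tendsto_pastPart ht] with ω hω j
  have : pastPart n A Sig ε t ω j = X t ω j - varError n Sig ε t ω j := (hω j).limsup_eq
  rw [this]; ring

/-- With weights ρ^k(1 - ρ) the rescaled moving average terms have a variance proxy bounded
uniformly in k, by C₁²D/(1 - ρ)², since ‖Φ_{t,k+1}‖ ≤ C₁ρ^k. The bound for partial sums passes to
the limit by Fatou. -/
theorem VARBound.lintegral_exp_pastPart_sq_le [IsProbabilityMeasure P]
    (hb : VARBound P n d A Sig ε ι C D C₁ ρ) (hm : IsTVVAR P n d A Sig ε X) {t : ℤ}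
    (ht : t ∈ Finset.Icc (0 : ℤ) n) (j : Fin d) :
    ∫⁻ ω, ENNReal.ofReal (Real.exp (ι / (C₁ ^ 2 * D) * (1 - ρ) ^ 2
      * pastPart n A Sig ε t ω j ^ 2)) ∂P ≤ ENNReal.ofReal C := by
  set γ := ι / (C₁ ^ 2 * D) * (1 - ρ) ^ 2 with hγ
  have hρ := hb.rho_pos
  have hρ1 := sub_pos.2 hb.rho_lt
  have hC₁ := hb.C₁_pos
  have hD := hb.D_pos
  have hι := hb.iota_pos
  let g : ℕ → S → ℝ := fun k ω => ((maCoef n A t (k + 1)).mulVec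
        (varError n Sig ε (t - ((k + 1 : ℕ) : ℤ)) ω)) j
  have hgm : ∀ k, Measurable (g k) := fun k =>
    (measurable_mulVec_varError n Sig ε (t := t) (by push_cast; omega) _ _).mono
      (pastSigma_le hm.measurable _) le_rfl
  have hpart : ∀ m, ∫⁻ ω, ENNReal.ofReal (Real.exp (γ * (∑ k ∈ Finset.range m, g k ω) ^ 2)) ∂P
      ≤ ENNReal.ofReal C := by
    intro m
    refine lintegral_exp_sq_sum_le _ (p := fun k => ρ ^ k * (1 - ρ)) (by positivity) hb.one_le_C
      (fun k _ => by positivity) ?_ (fun k _ => (hgm k).aemeasurable) fun k _ => ?_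
    · rw [← Finset.sum_mul, geom_sum_mul_neg]
      have : 0 ≤ ρ ^ m := by positivity
      linarith
    · have htk : t - ((k + 1 : ℕ) : ℤ) ≤ n := by
        have := (Finset.mem_Icc.1 ht).2
        push_cast; omega
      have hτ := gridPt_le_one hb.n_pos htk
      have hsq := sum_sq_row_mul_matSqrt_le (hb.posSemidef _ hτ) (maCoef n A t (k + 1)) j
      have hle : opNorm (maCoef n A t (k + 1)) ^ 2 * opNorm (Sig (gridPt n (t - ((k + 1 : ℕ) : ℤ))))
          ≤ (C₁ * ρ ^ k) ^ 2 * D := by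
        have h1 : opNorm (maCoef n A t (k + 1)) ≤ C₁ * ρ ^ k :=
          (hb.decay t ht (k + 1)).trans (mul_le_mul_of_nonneg_left
            (pow_le_pow_of_le_one hρ.le hb.rho_lt.le k.le_succ) hC₁.le)
        exact mul_le_mul (pow_le_pow_left₀ (opNorm_nonneg _) h1 2) (hb.bound _ hτ)
          (opNorm_nonneg _) (by positivity)
      refine le_trans (le_of_eq ?_) (hb.subGaussian.lintegral_exp_le hι hb.one_le_C (hsq.trans hle)
        (t - ((k + 1 : ℕ) : ℤ)))
      refine lintegral_congr fun ω => ?_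
      have e : g k ω = (maCoef n A t (k + 1) * matSqrt (Sig (gridPt n (t - ((k + 1 : ℕ) : ℤ))))) j
          ⬝ᵥ ε (t - ((k + 1 : ℕ) : ℤ)) ω := by
        simp only [g, varError, Matrix.mulVec_mulVec]
        rfl
      rw [← e, hγ]
      congr 2
      field_simp
  calc ∫⁻ ω, ENNReal.ofReal (Real.exp (γ * pastPart n A Sig ε t ω j ^ 2)) ∂P
      = ∫⁻ ω, liminf (fun m : ℕ =>
          ENNReal.ofReal (Real.exp (γ * (∑ k ∈ Finset.range m, g k ω) ^ 2))) atTop ∂P := by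
        refine lintegral_congr_ae ?_
        filter_upwards [hm.tendsto_pastPart ht] with ω hω
        have h1 : pastPart n A Sig ε t ω j = X t ω j - varError n Sig ε t ω j :=
          (hω j).limsup_eq
        have h2 := (hω j)
        rw [← h1] at h2
        have h3 : Continuous fun y : ℝ => ENNReal.ofReal (Real.exp (γ * y ^ 2)) :=
          ENNReal.continuous_ofReal.comp (by fun_prop)
        exact ((h3.tendsto _).comp h2).liminf_eq.symm
    _ ≤ liminf (fun m : ℕ => ∫⁻ ω,
          ENNReal.ofReal (Real.exp (γ * (∑ k ∈ Finset.range m, g k ω) ^ 2)) ∂P) atTop := by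
        refine lintegral_liminf_le fun m => ?_
        exact (((Finset.measurable_fun_sum _ fun k _ => hgm k).pow_const 2).const_mul γ).exp.ennreal_ofReal
    _ ≤ ENNReal.ofReal C := by
        refine liminf_le_of_le (by isBoundedDefault) fun b hb' => ?_
        obtain ⟨m, hm'⟩ := hb'.exists
        exact hm'.trans (hpart m)

end

/-! ### Kernel sums over the grid -/

/-- The function `x ^ p * K x`. -/
def kernelPow (K : ℝ → ℝ) (p : ℕ) (x : ℝ) : ℝ := x ^ p * K x

section Kernel

variable {K : ℝ → ℝ}

theorem IsKernel.exists_bound (hK : IsKernel K) : ∃ B : ℝ, 1 ≤ B ∧ ∀ x, K x ≤ B := by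
  obtain ⟨L, hL⟩ := hK.lipschitz
  obtain ⟨B, hB⟩ := (isCompact_Icc (a := (-1 : ℝ)) (b := 1)).bddAbove_image hL.continuous.continuousOn
  refine ⟨max B 1, le_max_right _ _, fun x => ?_⟩
  by_cases hx : 1 < |x|
  · rw [hK.support x hx]; exact zero_le_one.trans (le_max_right _ _)
  · exact (hB ⟨x, abs_le.1 (not_lt.1 hx), rfl⟩).trans (le_max_left _ _)

theorem IsKernel.abs_kernelPow_le (hK : IsKernel K) {B : ℝ} (hB : ∀ x, K x ≤ B) (p : ℕ) (x : ℝ) :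
    |kernelPow K p x| ≤ K x ∧ K x ≤ B := by
  refine ⟨?_, hB x⟩
  unfold kernelPow
  by_cases hx : 1 < |x|
  · simp [hK.support x hx]
  · rw [abs_mul, abs_pow, abs_of_nonneg (hK.nonneg x)]
    exact mul_le_of_le_one_left (hK.nonneg x) (pow_le_one₀ (abs_nonneg _) (not_lt.1 hx))

theorem IsKernel.kernelPow_eq_zero (hK : IsKernel K) (p : ℕ) {x : ℝ} (hx : 1 < |x|) :
    kernelPow K p x = 0 := by
  simp [kernelPow, hK.support x hx]

/-- For x K(x) the product rule needs only one of the two points in [-1, 1], where the identity is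
bounded; with both outside, everything vanishes. Used to pass from a fine grid to all τ. -/
theorem IsKernel.exists_lipschitz_kernelPow (hK : IsKernel K) :
    ∃ L : ℝ, 0 ≤ L ∧ ∀ p ≤ 1, ∀ x y, |kernelPow K p x - kernelPow K p y| ≤ L * |x - y| := by
  obtain ⟨L, hL⟩ := hK.lipschitz
  obtain ⟨B, hB1, hB⟩ := hK.exists_bound
  have hL' : ∀ x y, |K x - K y| ≤ L * |x - y| := fun x y => by
    simpa [Real.dist_eq] using hL.dist_le_mul x y
  have hL0 : (0 : ℝ) ≤ L := L.2
  have key : ∀ x y, |y| ≤ 1 → |x * K x - y * K y| ≤ (L + B) * |x - y| := by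
    intro x y hy
    have e : x * K x - y * K y = (x - y) * K x + y * (K x - K y) := by ring
    rw [e]
    refine (abs_add_le _ _).trans ?_
    rw [abs_mul, abs_mul, abs_of_nonneg (hK.nonneg x)]
    have h1 : |y| * |K x - K y| ≤ 1 * (L * |x - y|) :=
      mul_le_mul hy (hL' x y) (abs_nonneg _) zero_le_one
    have h2 : |x - y| * K x ≤ |x - y| * B := mul_le_mul_of_nonneg_left (hB x) (abs_nonneg _)
    linarith
  refine ⟨L + B, by positivity, fun p hp x y => ?_⟩
  have hp' : p = 0 ∨ p = 1 := by omega
  rcases hp' with rfl | rfl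
  · simp only [kernelPow, pow_zero, one_mul]
    refine (hL' x y).trans (mul_le_mul_of_nonneg_right (by linarith) (abs_nonneg _))
  · simp only [kernelPow, pow_one]
    by_cases hy : |y| ≤ 1
    · exact key x y hy
    · by_cases hx : |x| ≤ 1
      · rw [abs_sub_comm, abs_sub_comm x y]; exact key y x hx
      · rw [hK.support x (not_le.1 hx), hK.support y (not_le.1 hy)]
        simp only [mul_zero, sub_zero, abs_zero]
        positivity

/-- If K vanished on (0, 1) then by symmetry it would vanish off the null set {-1, 0, 1},
contradicting its integral. Positivity on one side of the origin is what survives at the ends of [0,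
1], where only half of the window contains data. -/
theorem IsKernel.exists_pos_interval (hK : IsKernel K) :
    ∃ l u κ : ℝ, 0 < l ∧ l < u ∧ u < 1 ∧ 0 < κ ∧ ∀ x ∈ Set.Icc l u, κ ≤ K x := by
  obtain ⟨L, hL⟩ := hK.lipschitz
  have hex : ∃ x ∈ Set.Ioo (0 : ℝ) 1, 0 < K x := by
    by_contra hcon
    push Not at hcon
    have h0 : ∀ x ∈ Set.Ioo (0 : ℝ) 1, K x = 0 := fun x hx => le_antisymm (hcon x hx) (hK.nonneg x)
    have hz : ∀ x, x ∉ ({-1, 0, 1} : Set ℝ) → K x = 0 := by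
      intro x hx
      simp only [Set.mem_insert_iff, Set.mem_singleton_iff, not_or] at hx
      by_cases h1 : 1 < |x|
      · exact hK.support x h1
      · obtain ⟨h2, h3⟩ := abs_le.1 (not_lt.1 h1)
        rcases lt_or_gt_of_ne hx.2.1 with h | h
        · rw [← hK.symm]
          exact h0 _ ⟨by linarith, by linarith [lt_of_le_of_ne h2 (Ne.symm hx.1)]⟩
        · exact h0 _ ⟨h, lt_of_le_of_ne h3 hx.2.2⟩
    have hfin : ({-1, 0, 1} : Set ℝ).Finite := by simp
    have hae : K =ᵐ[volume] 0 := by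
      have : ∀ᵐ x ∂(volume : Measure ℝ), x ∉ ({-1, 0, 1} : Set ℝ) :=
        measure_eq_zero_iff_ae_notMem.1 (hfin.measure_zero _)
      filter_upwards [this] with x hx
      exact hz x hx
    have h1 := hK.integral_one
    rw [integral_congr_ae hae] at h1
    simp at h1
  obtain ⟨x, hx, hKx⟩ := hex
  have hev : ∀ᶠ y in 𝓝 x, y ∈ Set.Ioo (0 : ℝ) 1 ∧ K x / 2 < K y :=
    Filter.Eventually.and (isOpen_Ioo.mem_nhds hx) (hL.continuous.continuousAt.eventually_const_lt (by linarith))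
  obtain ⟨r, hr, hball⟩ := Metric.eventually_nhds_iff.1 hev
  have hmem : ∀ y, |y - x| ≤ r / 2 → y ∈ Set.Ioo (0 : ℝ) 1 ∧ K x / 2 < K y := fun y hy =>
    hball (by rw [Real.dist_eq]; linarith)
  refine ⟨x - r / 2, x + r / 2, K x / 2, ?_, by linarith, ?_, by linarith, ?_⟩
  · exact (hmem (x - r / 2) (by
      rw [show x - r / 2 - x = -(r / 2) by ring, abs_neg, abs_of_pos (by linarith)])).1.1
  · exact (hmem (x + r / 2) (by
      rw [show x + r / 2 - x = r / 2 by ring, abs_of_pos (by linarith)])).1.2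
  · intro y hy
    exact (hmem y (abs_le.2 ⟨by linarith [hy.1], by linarith [hy.2]⟩)).2.le

end Kernel

/-! ### Number of grid points in an interval. -/

section Counting

variable {n : ℕ}

theorem gridPt_mem_iff (hn : 1 ≤ n) {t : ℤ} {l u : ℝ} :
    (l ≤ gridPt n t ∧ gridPt n t ≤ u) ↔ t ∈ Finset.Icc ⌈(n : ℝ) * l⌉ ⌊(n : ℝ) * u⌋ := by
  have hn' : (0 : ℝ) < n := by exact_mod_cast hn
  rw [Finset.mem_Icc, Int.ceil_le, Int.le_floor, gridPt, le_div_iff₀ hn', div_le_iff₀ hn',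
    mul_comm l, mul_comm u]

theorem card_times_filter_le (hn : 1 ≤ n) {l u : ℝ} (hlu : l ≤ u) :
    (((times n).filter fun t => l ≤ gridPt n t ∧ gridPt n t ≤ u).card : ℝ) ≤ n * (u - l) + 1 := by
  have hn' : (0 : ℝ) < n := by exact_mod_cast hn
  have h1 : ((times n).filter fun t => l ≤ gridPt n t ∧ gridPt n t ≤ u)
      ⊆ Finset.Icc ⌈(n : ℝ) * l⌉ ⌊(n : ℝ) * u⌋ := fun t ht =>
    (gridPt_mem_iff hn).1 (Finset.mem_filter.1 ht).2
  have h2 : (((times n).filter fun t => l ≤ gridPt n t ∧ gridPt n t ≤ u).card : ℝ)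
      ≤ ((⌊(n : ℝ) * u⌋ + 1 - ⌈(n : ℝ) * l⌉).toNat : ℝ) := by
    rw [← Int.card_Icc]
    exact_mod_cast Finset.card_le_card h1
  refine h2.trans ?_
  have h3 := Int.floor_le ((n : ℝ) * u)
  have h4 := Int.le_ceil ((n : ℝ) * l)
  have h5 : (0 : ℝ) ≤ n * (u - l) := mul_nonneg hn'.le (by linarith)
  rcases le_total 0 (⌊(n : ℝ) * u⌋ + 1 - ⌈(n : ℝ) * l⌉) with h | h
  · have : (((⌊(n : ℝ) * u⌋ + 1 - ⌈(n : ℝ) * l⌉).toNat : ℤ) : ℝ)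
        = (⌊(n : ℝ) * u⌋ : ℝ) + 1 - ⌈(n : ℝ) * l⌉ := by
      rw [Int.toNat_of_nonneg h]; push_cast; ring
    rw [Int.cast_natCast] at this
    rw [this]
    linarith
  · rw [Int.toNat_of_nonpos h]
    simp only [Nat.cast_zero]
    linarith

theorem le_card_times_filter (hn : 1 ≤ n) {l u : ℝ} (hl : 0 < l) (hu : u ≤ 1) :
    n * (u - l) - 1
      ≤ (((times n).filter fun t => l ≤ gridPt n t ∧ gridPt n t ≤ u).card : ℝ) := by
  have hn' : (0 : ℝ) < n := by exact_mod_cast hn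
  have h1 : Finset.Icc ⌈(n : ℝ) * l⌉ ⌊(n : ℝ) * u⌋
      ⊆ ((times n).filter fun t => l ≤ gridPt n t ∧ gridPt n t ≤ u) := by
    intro t ht
    obtain ⟨h2, h3⟩ := (gridPt_mem_iff hn).2 ht
    refine Finset.mem_filter.2 ⟨?_, h2, h3⟩
    have h4 : 0 < gridPt n t := hl.trans_le h2
    have h5 : gridPt n t ≤ 1 := h3.trans hu
    unfold gridPt at h4 h5
    rw [div_le_one hn'] at h5
    have h6 : (0 : ℝ) < t := by
      by_contra hcon
      exact absurd h4 (not_lt.2 (div_nonpos_of_nonpos_of_nonneg (not_lt.1 hcon) hn'.le))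
    rw [times, Finset.mem_Icc]
    refine ⟨by exact_mod_cast h6, by exact_mod_cast h5⟩
  have h2 : ((⌊(n : ℝ) * u⌋ + 1 - ⌈(n : ℝ) * l⌉).toNat : ℝ)
      ≤ (((times n).filter fun t => l ≤ gridPt n t ∧ gridPt n t ≤ u).card : ℝ) := by
    rw [← Int.card_Icc]
    exact_mod_cast Finset.card_le_card h1
  refine le_trans ?_ h2
  have h3 := (Int.lt_floor_add_one ((n : ℝ) * u)).le
  have h4 := (Int.ceil_lt_add_one ((n : ℝ) * l)).le
  have h5 : (((⌊(n : ℝ) * u⌋ + 1 - ⌈(n : ℝ) * l⌉ : ℤ)) : ℝ)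
      ≤ ((⌊(n : ℝ) * u⌋ + 1 - ⌈(n : ℝ) * l⌉).toNat : ℝ) := by
    rw [← Int.cast_natCast (R := ℝ)]
    exact_mod_cast Int.self_le_toNat _
  push_cast at h5
  linarith

/-- A bounded function supported in `[-1, 1]` has at most of order `n h` nonzero terms. -/
theorem sum_times_le {f : ℝ → ℝ} {F : ℝ} (hf0 : ∀ x, 0 ≤ f x) (hf : ∀ x, f x ≤ F)
    (hsupp : ∀ x, 1 < |x| → f x = 0) (hn : 1 ≤ n) {h : ℝ} (hh : 0 < h) (hnh : 1 ≤ n * h) (τ : ℝ) :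
    ∑ t ∈ times n, f ((gridPt n t - τ) / h) ≤ 3 * F * (n * h) := by
  have hF : 0 ≤ F := (hf0 0).trans (hf 0)
  have h1 : ∑ t ∈ times n, f ((gridPt n t - τ) / h)
      = ∑ t ∈ (times n).filter (fun t => τ - h ≤ gridPt n t ∧ gridPt n t ≤ τ + h),
        f ((gridPt n t - τ) / h) := by
    symm
    refine Finset.sum_filter_of_ne fun t _ hne => ?_
    by_contra hcon
    refine hne (hsupp _ ?_)
    by_contra h2
    rw [not_lt, abs_le, le_div_iff₀ hh, div_le_iff₀ hh] at h2
    exact hcon ⟨by linarith [h2.1], by linarith [h2.2]⟩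
  rw [h1]
  refine (Finset.sum_le_card_nsmul _ _ F fun t _ => hf _).trans ?_
  rw [nsmul_eq_mul]
  have h2 := card_times_filter_le hn (l := τ - h) (u := τ + h) (by linarith)
  nlinarith

end Counting

/-! ### Nondegeneracy of the local linear design. -/

section Design

variable {K : ℝ → ℝ}

theorem IsKernel.sum_le (hK : IsKernel K) {B : ℝ} (hB : ∀ x, K x ≤ B) {n : ℕ} (hn : 1 ≤ n) {h : ℝ}
    (hh : 0 < h) (hnh : 1 ≤ n * h) (τ : ℝ) :
    ∑ t ∈ times n, K ((gridPt n t - τ) / h) ≤ 3 * B * (n * h) :=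
  sum_times_le hK.nonneg hB hK.support hn hh hnh τ

theorem IsKernel.sum_abs_kernelPow_le (hK : IsKernel K) {B : ℝ} (hB : ∀ x, K x ≤ B) {n : ℕ}
    (hn : 1 ≤ n) {h : ℝ} (hh : 0 < h) (hnh : 1 ≤ n * h) (p : ℕ) (τ : ℝ) :
    ∑ t ∈ times n, |kernelPow K p ((gridPt n t - τ) / h)| ≤ 3 * B * (n * h) :=
  (Finset.sum_le_sum fun _ _ => (hK.abs_kernelPow_le hB p _).1).trans (hK.sum_le hB hn hh hnh τ)

theorem IsKernel.sum_sq_kernelPow_le (hK : IsKernel K) {B : ℝ} (hB : ∀ x, K x ≤ B) {n : ℕ}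
    (hn : 1 ≤ n) {h : ℝ} (hh : 0 < h) (hnh : 1 ≤ n * h) (p : ℕ) (τ : ℝ) :
    ∑ t ∈ times n, kernelPow K p ((gridPt n t - τ) / h) ^ 2 ≤ 3 * B ^ 2 * (n * h) := by
  refine sum_times_le (f := fun x => kernelPow K p x ^ 2) (fun x => sq_nonneg _) (fun x => ?_)
    (fun x hx => by simp [hK.kernelPow_eq_zero p hx]) hn hh hnh τ
  obtain ⟨h1, h2⟩ := hK.abs_kernelPow_le hB p x
  rw [← sq_abs]
  exact pow_le_pow_left₀ (abs_nonneg _) (h1.trans h2) 2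

/-- If an affine function were small at a point of the left third and at a point of the right third
of [l, u], its slope and then its intercept would be small. So on at least one third it is bounded
below throughout; the constant is the one that closes this contradiction. -/
theorem sq_add_mul_dichotomy {l u : ℝ} (hl : 0 < l) (hlu : l < u) (hu : u < 1) (a b : ℝ) :
    (∀ y ∈ Set.Icc l ((2 * l + u) / 3),
      1 / (2 + 12 / ((u - l) / 3) ^ 2) * (a ^ 2 + b ^ 2) ≤ (a + b * y) ^ 2) ∨
    (∀ y ∈ Set.Icc ((l + 2 * u) / 3) u,
      1 / (2 + 12 / ((u - l) / 3) ^ 2) * (a ^ 2 + b ^ 2) ≤ (a + b * y) ^ 2) := by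
  by_contra hcon
  push Not at hcon
  obtain ⟨⟨y, hy, h1⟩, z, hz, h2⟩ := hcon
  set η := (u - l) / 3 with hη
  have hη0 : 0 < η := by rw [hη]; linarith
  have hzy : η ≤ z - y := by have := hy.2; have := hz.1; rw [hη]; linarith
  set Q := a ^ 2 + b ^ 2 with hQ
  set c := 1 / (2 + 12 / η ^ 2) with hc
  have hc0 : 0 < c := by rw [hc]; positivity
  have e1 : b ^ 2 * η ^ 2 ≤ b ^ 2 * (z - y) ^ 2 :=
    mul_le_mul_of_nonneg_left (pow_le_pow_left₀ hη0.le hzy 2) (sq_nonneg _)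
  have e2 : b ^ 2 * (z - y) ^ 2 ≤ 2 * (a + b * y) ^ 2 + 2 * (a + b * z) ^ 2 := by
    nlinarith [sq_nonneg ((a + b * y) + (a + b * z))]
  have e3 : b ^ 2 * η ^ 2 < 4 * (c * Q) := by linarith
  have e4 : b ^ 2 < 4 * (c * Q) / η ^ 2 := (lt_div_iff₀ (by positivity)).2 e3
  have hy0 : 0 ≤ y := hl.le.trans hy.1
  have hy1 : y ≤ 1 := by have := hy.2; linarith
  have e5 : a ^ 2 ≤ 2 * (a + b * y) ^ 2 + 2 * b ^ 2 := by
    have : b ^ 2 * y ^ 2 ≤ b ^ 2 := mul_le_of_le_one_right (sq_nonneg _) (pow_le_one₀ hy0 hy1)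
    nlinarith [sq_nonneg ((a + b * y) + b * y)]
  have e6 : Q < 2 * (c * Q) + 3 * (4 * (c * Q) / η ^ 2) := by
    have : Q = a ^ 2 + b ^ 2 := hQ
    linarith
  have e7 : 2 * (c * Q) + 3 * (4 * (c * Q) / η ^ 2) = c * (2 + 12 / η ^ 2) * Q := by ring
  have e8 : c * (2 + 12 / η ^ 2) = 1 := by
    rw [hc]; exact one_div_mul_cancel (by positivity)
  rw [e7, e8, one_mul] at e6
  exact lt_irrefl _ e6

/-- The local linear design is uniformly nondegenerate on `[0, 1]`. -/
theorem IsKernel.exists_design_bound (hK : IsKernel K) :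
    ∃ c N : ℝ, 0 < c ∧ ∀ n : ℕ, 1 ≤ n → ∀ h : ℝ, 0 < h → h ≤ 1 / 2 → N ≤ n * h →
      ∀ τ ∈ Set.Icc (0 : ℝ) 1, ∀ a b : ℝ, c * (n * h) * (a ^ 2 + b ^ 2) ≤
        ∑ t ∈ times n, K ((gridPt n t - τ) / h) * (a + b * ((gridPt n t - τ) / h)) ^ 2 := by
  obtain ⟨l, u, κ, hl, hlu, hu, hκ, hKκ⟩ := hK.exists_pos_interval
  set c' := 1 / (2 + 12 / ((u - l) / 3) ^ 2) with hc'
  have hul : 0 < u - l := sub_pos.2 hlu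
  have hc'0 : 0 < c' := by rw [hc']; positivity
  -- A third of the window contains about nh(u - l)/3 grid points; requiring nh ≥ 6/(u - l) makes
  -- the rounding loss of one point at most half of that.
  refine ⟨(u - l) / 6 * κ * c', 6 / (u - l), by positivity, ?_⟩
  intro n hn h hh hh2 hN τ hτ a b
  have hn' : (0 : ℝ) < n := by exact_mod_cast hn
  have hcount : ∀ v : ℝ, v = (u - l) / 3 → (u - l) / 6 * (n * h) ≤ n * (h * v) - 1 := by
    intro v hv
    rw [div_le_iff₀ hul] at hN
    rw [hv]; nlinarith
  have hterm : ∀ t, 0 ≤ K ((gridPt n t - τ) / h) * (a + b * ((gridPt n t - τ) / h)) ^ 2 :=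
    fun t => mul_nonneg (hK.nonneg _) (sq_nonneg _)
  -- σ is the side of τ from which data are taken: the right if τ ≤ 1/2, the left otherwise. As h ≤
  -- 1/2, a one-sided window then lies inside [0, 1], so the end points need no special treatment.
  have main : ∀ σ : ℝ, (σ = 1 ∨ σ = -1) → ∀ l' u' : ℝ, l ≤ l' → u' ≤ u → u' - l' = (u - l) / 3 →
      (∀ y ∈ Set.Icc l' u', c' * (a ^ 2 + (σ * b) ^ 2) ≤ (a + σ * b * y) ^ 2) →
      (σ = 1 → τ ≤ 1 / 2) → (σ = -1 → 1 / 2 ≤ τ) →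
      (u - l) / 6 * κ * c' * (n * h) * (a ^ 2 + b ^ 2) ≤
        ∑ t ∈ times n, K ((gridPt n t - τ) / h) * (a + b * ((gridPt n t - τ) / h)) ^ 2 := by
    intro σ hσ l' u' hl' hu' hlen hy hσ1 hσ2
    have hσσ : σ * σ = 1 := by rcases hσ with rfl | rfl <;> norm_num
    have hstep : ∀ T : Finset ℤ, T ⊆ times n → (u - l) / 6 * (n * h) ≤ T.card →
        (∀ t ∈ T, σ * ((gridPt n t - τ) / h) ∈ Set.Icc l' u') →
        (u - l) / 6 * κ * c' * (n * h) * (a ^ 2 + b ^ 2) ≤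
          ∑ t ∈ times n, K ((gridPt n t - τ) / h) * (a + b * ((gridPt n t - τ) / h)) ^ 2 := by
      intro T hT hcard hmem
      refine le_trans ?_ (Finset.sum_le_sum_of_subset_of_nonneg hT fun t _ _ => hterm t)
      have h1 : ∀ t ∈ T, κ * (c' * (a ^ 2 + b ^ 2)) ≤
          K ((gridPt n t - τ) / h) * (a + b * ((gridPt n t - τ) / h)) ^ 2 := by
        intro t ht
        have hm := hmem t ht
        have h2 := hy _ hm
        have h3 := hKκ _ ⟨hl'.trans hm.1, hm.2.trans hu'⟩
        have e1 : (σ * b) ^ 2 = b ^ 2 := by rw [mul_pow, sq, hσσ, one_mul]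
        have e2 : σ * b * (σ * ((gridPt n t - τ) / h)) = b * ((gridPt n t - τ) / h) := by
          linear_combination (b * ((gridPt n t - τ) / h)) * hσσ
        have e3 : K (σ * ((gridPt n t - τ) / h)) = K ((gridPt n t - τ) / h) := by
          rcases hσ with rfl | rfl
          · rw [one_mul]
          · rw [neg_one_mul, hK.symm]
        rw [e1, e2] at h2
        rw [e3] at h3
        exact mul_le_mul h3 h2 (by positivity) (hK.nonneg _)
      have h4 := Finset.card_nsmul_le_sum T _ _ h1
      rw [nsmul_eq_mul] at h4
      refine le_trans ?_ h4
      have : 0 ≤ κ * (c' * (a ^ 2 + b ^ 2)) := by positivity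
      nlinarith
    rcases hσ with rfl | rfl
    · have hτ2 := hσ1 rfl
      refine hstep ((times n).filter fun t => τ + h * l' ≤ gridPt n t ∧ gridPt n t ≤ τ + h * u')
        (Finset.filter_subset _ _) ?_ ?_
      · have h1 := le_card_times_filter hn (l := τ + h * l') (u := τ + h * u')
          (by have := hτ.1; have : 0 < h * l' := mul_pos hh (hl.trans_le hl'); linarith)
          (by nlinarith)
        rw [show τ + h * u' - (τ + h * l') = h * (u' - l') by ring] at h1
        exact (hcount _ hlen).trans h1
      · intro t ht
        obtain ⟨h1, h2⟩ := (Finset.mem_filter.1 ht).2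
        rw [one_mul]
        exact ⟨(le_div_iff₀ hh).2 (by linarith), (div_le_iff₀ hh).2 (by linarith)⟩
    · have hτ2 := hσ2 rfl
      refine hstep ((times n).filter fun t => τ - h * u' ≤ gridPt n t ∧ gridPt n t ≤ τ - h * l')
        (Finset.filter_subset _ _) ?_ ?_
      · have h1 := le_card_times_filter hn (l := τ - h * u') (u := τ - h * l')
          (by
            have : h * u' < h * 1 := mul_lt_mul_of_pos_left (by linarith) hh
            linarith)
          (by have := hτ.2; have : 0 < h * l' := mul_pos hh (hl.trans_le hl'); linarith)
        rw [show τ - h * l' - (τ - h * u') = h * (u' - l') by ring] at h1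
        exact (hcount _ hlen).trans h1
      · intro t ht
        obtain ⟨h1, h2⟩ := (Finset.mem_filter.1 ht).2
        rw [neg_one_mul, ← neg_div]
        exact ⟨(le_div_iff₀ hh).2 (by linarith), (div_le_iff₀ hh).2 (by linarith)⟩
  rcases le_total τ (1 / 2) with hcase | hcase
  · rcases sq_add_mul_dichotomy hl hlu hu a (1 * b) with hd | hd
    · exact main 1 (Or.inl rfl) _ _ le_rfl (by linarith) (by ring) hd (fun _ => hcase)
        (fun h => by norm_num at h)
    · exact main 1 (Or.inl rfl) _ _ (by linarith) le_rfl (by ring) hd (fun _ => hcase)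
        (fun h => by norm_num at h)
  · rcases sq_add_mul_dichotomy hl hlu hu a (-1 * b) with hd | hd
    · exact main (-1) (Or.inr rfl) _ _ le_rfl (by linarith) (by ring) hd
        (fun h => by norm_num at h) (fun _ => hcase)
    · exact main (-1) (Or.inr rfl) _ _ (by linarith) le_rfl (by ring) hd
        (fun h => by norm_num at h) (fun _ => hcase)

theorem sum_locWeight (n : ℕ) (K : ℝ → ℝ) (b τ : ℝ) :
    ∑ t ∈ times n, locWeight n K b t τ
      = kernelMoment n K b 0 τ * kernelMoment n K b 2 τ - kernelMoment n K b 1 τ ^ 2 := by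
  simp only [locWeight, Finset.sum_sub_distrib, ← Finset.sum_mul]
  simp only [kernelMoment, pow_zero, one_mul, pow_one]
  ring

/-- Local linear weights annihilate linear functions; this removes the first-order bias at interior
and boundary points alike. -/
theorem sum_locWeight_mul (n : ℕ) (K : ℝ → ℝ) (b τ : ℝ) :
    ∑ t ∈ times n, locWeight n K b t τ * ((gridPt n t - τ) / b) = 0 := by
  have e : ∀ t, locWeight n K b t τ * ((gridPt n t - τ) / b)
      = (gridPt n t - τ) / b * K ((gridPt n t - τ) / b) * kernelMoment n K b 2 τ
        - ((gridPt n t - τ) / b) ^ 2 * K ((gridPt n t - τ) / b) * kernelMoment n K b 1 τ := by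
    intro t; unfold locWeight; ring
  simp only [e, Finset.sum_sub_distrib, ← Finset.sum_mul]
  simp only [kernelMoment, pow_one]
  ring

/-- The total weight is the determinant s₀s₂ - s₁² of the local design matrix. Testing the quadratic
form at (1, 0) gives s₀ ≥ c, and at (s₁, -s₀) it gives s₀ · det ≥ c s₀². -/
theorem le_sum_locWeight {n : ℕ} {b τ c : ℝ} (hc : 0 < c)
    (hdes : ∀ x y : ℝ, c * (x ^ 2 + y ^ 2) ≤
      ∑ t ∈ times n, K ((gridPt n t - τ) / b) * (x + y * ((gridPt n t - τ) / b)) ^ 2) :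
    c ^ 2 ≤ ∑ t ∈ times n, locWeight n K b t τ := by
  have e : ∀ x y : ℝ,
      ∑ t ∈ times n, K ((gridPt n t - τ) / b) * (x + y * ((gridPt n t - τ) / b)) ^ 2
      = x ^ 2 * kernelMoment n K b 0 τ + 2 * x * y * kernelMoment n K b 1 τ
        + y ^ 2 * kernelMoment n K b 2 τ := by
    intro x y
    simp only [kernelMoment, Finset.mul_sum, ← Finset.sum_add_distrib]
    exact Finset.sum_congr rfl fun t _ => by ring
  simp only [e] at hdes
  rw [sum_locWeight]
  set s0 := kernelMoment n K b 0 τ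
  set s1 := kernelMoment n K b 1 τ
  set s2 := kernelMoment n K b 2 τ
  have h0 := hdes 1 0
  have h1 := hdes s1 (-s0)
  have h2 : c ≤ s0 := by nlinarith
  have h3 : c * s0 ^ 2 ≤ s0 * (s0 * s2 - s1 ^ 2) := by nlinarith [sq_nonneg s1]
  have h4 : c * s0 ≤ s0 * s2 - s1 ^ 2 := by
    have hs0 : 0 < s0 := hc.trans_le h2
    refine le_of_mul_le_mul_left ?_ hs0
    nlinarith
  nlinarith

end Design

/-! ### The event on which all deviations are controlled -/

/-- A sample path `x` with errors `e` along which the process and all the empirical moments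
that enter the estimators deviate by at most `M` times their stochastic order. -/
structure GoodPath (n d : ℕ) (K : ℝ → ℝ) (h b M : ℝ) (A Sig : ℝ → Mat d)
    (x e : ℤ → Fin d → ℝ) : Prop where
  autoreg : ∀ t ∈ times n, x t = (A (gridPt n t)).mulVec (x (t - 1)) + e t
  abs_x : ∀ t ∈ Finset.Icc (0 : ℤ) n, ∀ j, |x t j| ≤ M * √(logMax n d)
  abs_e : ∀ t ∈ Finset.Icc (0 : ℤ) n, ∀ j, |e t j| ≤ M * √(logMax n d)
  score : ∀ p ≤ 1, ∀ r ∈ times n, ∀ i j,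
    |∑ t ∈ times n, kernelPow K p ((gridPt n t - gridPt n r) / h) * x (t - 1) j * e t i|
      ≤ M * (logMax n d * √(n * h))
  cross : ∀ p ≤ 2, ∀ r ∈ times n, ∀ i j,
    |∑ t ∈ times n, kernelPow K p ((gridPt n t - gridPt n r) / h)
      * (x (t - 1) j - e (t - 1) j) * e (t - 1) i| ≤ M * (logMax n d * √(n * h))
  gram : ∀ p ≤ 2, ∀ r ∈ times n, ∀ i j,
    |∑ t ∈ times n, kernelPow K p ((gridPt n t - gridPt n r) / h)
      * (e (t - 1) i * e (t - 1) j - Sig (gridPt n (t - 1)) i j)| ≤ M * (logMax n d * √(n * h))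
  cov : ∀ p ≤ 1, ∀ τ ∈ Set.Icc (0 : ℝ) 1, ∀ i j,
    |∑ t ∈ times n, kernelPow K p ((gridPt n t - τ) / b)
      * (e t i * e t j - Sig (gridPt n t) i j)| ≤ M * √(logMax n d * (n * b))

/-- Truncation at level `T`. -/
def trunc (T y : ℝ) : ℝ := max (-T) (min T y)

theorem abs_trunc_le {T : ℝ} (hT : 0 ≤ T) (y : ℝ) : |trunc T y| ≤ T :=
  abs_le.2 ⟨le_max_left _ _, max_le (by linarith) (min_le_left _ _)⟩

theorem trunc_eq {T y : ℝ} (h : |y| ≤ T) : trunc T y = y := by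
  obtain ⟨h1, h2⟩ := abs_le.1 h
  rw [trunc, min_eq_right h2, max_eq_right h1]

theorem measurable_trunc (T : ℝ) : Measurable (trunc T) := by
  unfold trunc; fun_prop

/-! ### Union bounds for the deviations. -/

section

variable {S : Type*} [MeasurableSpace S] {P : Measure S} {n d : ℕ} {A Sig : ℝ → Mat d}
  {ε X : ℤ → S → Fin d → ℝ} {ι C D C₁ ρ : ℝ} {K : ℝ → ℝ}

theorem exp_neg_mul_logMax (hn : 1 ≤ n) (k : ℕ) :
    Real.exp (-(k * logMax n d)) = 1 / ((max n d : ℕ) : ℝ) ^ k := by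
  have : (0 : ℝ) < ((max n d : ℕ) : ℝ) := by
    exact_mod_cast lt_of_lt_of_le hn (le_max_left n d)
  rw [Real.exp_neg, Real.exp_nat_mul, logMax, Real.exp_log this, one_div]

/-- Union bound over polynomially many events. -/
theorem measure_exists_le (hn : 1 ≤ n) {κ : Type*} (s : Finset κ) (E : κ → Set S) {q c : ℝ} {k : ℕ}
    (hq : 0 ≤ q) (hcard : (s.card : ℝ) ≤ c * ((max n d : ℕ) : ℝ) ^ k)
    (hE : ∀ i ∈ s, P (E i) ≤ ENNReal.ofReal (q * Real.exp (-((k + 1 : ℕ) * logMax n d)))) :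
    P {ω | ∃ i ∈ s, ω ∈ E i} ≤ ENNReal.ofReal (c * q / ((max n d : ℕ) : ℝ)) := by
  have hN : (0 : ℝ) < ((max n d : ℕ) : ℝ) := by
    exact_mod_cast lt_of_lt_of_le hn (le_max_left n d)
  have e : {ω | ∃ i ∈ s, ω ∈ E i} = ⋃ i ∈ s, E i := by ext; simp
  rw [e]
  refine (measure_biUnion_finset_le s E).trans ((Finset.sum_le_card_nsmul _ _ _ hE).trans ?_)
  rw [nsmul_eq_mul, ← ENNReal.ofReal_natCast, ← ENNReal.ofReal_mul (by positivity),
    exp_neg_mul_logMax hn]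
  refine ENNReal.ofReal_le_ofReal ?_
  calc (s.card : ℝ) * (q * (1 / ((max n d : ℕ) : ℝ) ^ (k + 1)))
      ≤ (c * ((max n d : ℕ) : ℝ) ^ k) * (q * (1 / ((max n d : ℕ) : ℝ) ^ (k + 1))) :=
        mul_le_mul_of_nonneg_right hcard (by positivity)
    _ = _ := by rw [pow_succ]; field_simp

/-- Markov's inequality for exp(γg²). The exponent 3L supplies two powers of n ∨ d for the union
over time and coordinate, and one power that remains. -/
theorem measure_abs_gt_le {g : S → ℝ} (hg : AEMeasurable g P) {γ C M₀ L : ℝ} (hM : 0 ≤ M₀)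
    (hL : 0 ≤ L) (hγ : 0 ≤ γ) (hγM : 3 ≤ γ * M₀ ^ 2)
    (h : ∫⁻ ω, ENNReal.ofReal (Real.exp (γ * g ω ^ 2)) ∂P ≤ ENNReal.ofReal C) :
    P {ω | M₀ * √L < |g ω|} ≤ ENNReal.ofReal (C * Real.exp (-((2 + 1 : ℕ) * L))) := by
  refine le_trans (measure_mono ?_) (measure_le_of_lintegral_exp
    (x := ((2 + 1 : ℕ) : ℝ) * L) ((hg.pow_const 2).const_mul γ) h)
  intro ω hω
  have h1 : (M₀ * √L) ^ 2 ≤ g ω ^ 2 := by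
    rw [← sq_abs (g ω)]
    exact pow_le_pow_left₀ (by positivity) (le_of_lt hω) 2
  rw [mul_pow, Real.sq_sqrt hL] at h1
  have h2 : γ * (M₀ ^ 2 * L) ≤ γ * g ω ^ 2 := mul_le_mul_of_nonneg_left h1 hγ
  show ((2 + 1 : ℕ) : ℝ) * L ≤ γ * g ω ^ 2
  push_cast
  nlinarith

theorem card_times (n : ℕ) : (times n).card = n := by
  simp [times]

theorem VARBound.measure_varError_le [IsProbabilityMeasure P]
    (hb : VARBound P n d A Sig ε ι C D C₁ ρ) (hm : IsTVVAR P n d A Sig ε X) {M₀ : ℝ} (hM : 0 ≤ M₀)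
    (hM1 : 3 ≤ ι / D * M₀ ^ 2) :
    P {ω | ∃ u ∈ Finset.Icc (0 : ℤ) n ×ˢ (Finset.univ : Finset (Fin d)),
      M₀ * √(logMax n d) < |varError n Sig ε u.1 ω u.2|}
      ≤ ENNReal.ofReal (2 * C / ((max n d : ℕ) : ℝ)) ∧
    ((3 ≤ ι / (C₁ ^ 2 * D) * (1 - ρ) ^ 2 * M₀ ^ 2) →
      P {ω | ∃ u ∈ Finset.Icc (0 : ℤ) n ×ˢ (Finset.univ : Finset (Fin d)),
        M₀ * √(logMax n d) < |pastPart n A Sig ε u.1 ω u.2|}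
        ≤ ENNReal.ofReal (2 * C / ((max n d : ℕ) : ℝ))) := by
  have hn := hb.n_pos
  have hC : 0 ≤ C := zero_le_one.trans hb.one_le_C
  have hL : 0 ≤ logMax n d := Real.log_natCast_nonneg _
  have hcard : (((Finset.Icc (0 : ℤ) n ×ˢ (Finset.univ : Finset (Fin d))).card : ℕ) : ℝ)
      ≤ 2 * ((max n d : ℕ) : ℝ) ^ 2 := by
    rw [Finset.card_product, Int.card_Icc, Finset.card_univ, Fintype.card_fin]
    have : ((n : ℤ) + 1 - 0).toNat = n + 1 := by omega
    rw [this]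
    have h1 : n ≤ max n d := le_max_left _ _
    have h2 : d ≤ max n d := le_max_right _ _
    have h3 : (n + 1) * d ≤ 2 * (max n d) ^ 2 := by
      calc (n + 1) * d ≤ (2 * max n d) * max n d := Nat.mul_le_mul (by omega) h2
        _ = _ := by ring
    exact_mod_cast h3
  constructor
  · refine measure_exists_le hn _ (fun u : ℤ × Fin d => {ω | M₀ * √(logMax n d)
      < |varError n Sig ε u.1 ω u.2|}) hC hcard fun u hu => ?_
    have ht : u.1 ≤ n := (Finset.mem_Icc.1 (Finset.mem_product.1 hu).1).2
    exact measure_abs_gt_le (hm.integrable_dot _ _).1.aemeasurable hM hL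
      (div_pos hb.iota_pos hb.D_pos).le hM1 (hb.lintegral_exp_varError_sq_le ht u.2)
  · intro hM2
    refine measure_exists_le hn _ (fun u : ℤ × Fin d => {ω | M₀ * √(logMax n d)
      < |pastPart n A Sig ε u.1 ω u.2|}) hC hcard fun u hu => ?_
    have := hb.iota_pos
    have := hb.D_pos
    exact measure_abs_gt_le (((measurable_pastPart n A Sig ε u.1 u.2).mono
      (pastSigma_le hm.measurable _) le_rfl).aemeasurable) hM hL (by positivity) hM2
      (hb.lintegral_exp_pastPart_sq_le hm (Finset.mem_product.1 hu).1 u.2)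

/-- The index set of the deviations that are controlled at grid points. -/
def devIndex (n d q : ℕ) : Finset (ℕ × ℤ × Fin d × Fin d) :=
  Finset.range q ×ˢ times n ×ˢ Finset.univ ×ˢ Finset.univ

theorem card_devIndex_le (n d q : ℕ) :
    ((devIndex n d q).card : ℝ) ≤ q * ((max n d : ℕ) : ℝ) ^ 3 := by
  simp only [devIndex, Finset.card_product, Finset.card_range, card_times, Finset.card_univ,
    Fintype.card_fin]
  have h1 : n ≤ max n d := le_max_left _ _
  have h2 : d ≤ max n d := le_max_right _ _
  have h3 : q * (n * (d * d)) ≤ q * (max n d) ^ 3 := by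
    refine Nat.mul_le_mul_left q ?_
    calc n * (d * d) ≤ max n d * (max n d * max n d) :=
          Nat.mul_le_mul h1 (Nat.mul_le_mul h2 h2)
      _ = _ := by ring
  exact_mod_cast h3

theorem measurable_row_dot {d : ℕ} (v : Fin d → ℝ) : Measurable fun x : Fin d → ℝ => v ⬝ᵥ x := by
  simp only [dotProduct]; fun_prop

/-- Deviation of a kernel weighted martingale transform of the errors at lag `a`. -/
theorem VARBound.measure_transform_le [IsProbabilityMeasure P]
    (hb : VARBound P n d A Sig ε ι C D C₁ ρ) (hm : IsTVVAR P n d A Sig ε X)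
    (hK : IsKernel K) {B : ℝ} (hB : ∀ x, K x ≤ B) {h : ℝ} (hh : 0 < h) (hnh : 1 ≤ n * h)
    {a : ℤ} (ha : 0 ≤ a) {T M : ℝ} (hT : 0 ≤ T) (g : ℤ → Fin d → S → ℝ)
    (hg : ∀ t j, Measurable[pastSigma ε (t - a - 1)] (g t j))
    (hgT : ∀ t j ω, |g t j ω| ≤ T * √(logMax n d))
    (hM : (C + 1) / (ι / D) * (3 * B ^ 2 * T ^ 2) + 4 ≤ M) (q : ℕ) :
    P {ω | ∃ u ∈ devIndex n d q, M * (logMax n d * √(n * h)) ≤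
      |∑ t ∈ times n, (kernelPow K u.1 ((gridPt n t - gridPt n u.2.1) / h) * g t u.2.2.2 ω)
        * varError n Sig ε (t - a) ω u.2.2.1|}
      ≤ ENNReal.ofReal (q * 2 / ((max n d : ℕ) : ℝ)) := by
  have hn := hb.n_pos
  have hL : 0 ≤ logMax n d := Real.log_natCast_nonneg _
  have hnh0 : 0 < n * h := zero_lt_one.trans_le hnh
  have hs : 0 < √(n * h) := Real.sqrt_pos.2 hnh0
  have hι := hb.iota_pos
  have hD := hb.D_pos
  have hC : 0 ≤ C := zero_le_one.trans hb.one_le_C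
  have hB0 : 0 ≤ B := (hK.nonneg 0).trans (hB 0)
  refine measure_exists_le hn _ (fun u : ℕ × ℤ × Fin d × Fin d => {ω | M * (logMax n d * √(n * h)) ≤
      |∑ t ∈ times n, (kernelPow K u.1 ((gridPt n t - gridPt n u.2.1) / h) * g t u.2.2.2 ω)
        * varError n Sig ε (t - a) ω u.2.2.1|}) zero_le_two (card_devIndex_le n d q) fun u _ => ?_
  obtain ⟨p, r, i, j⟩ := u
  set c := (C + 1) / (ι / D) with hc
  have hc0 : 0 ≤ c := by rw [hc]; positivity
  have key := hm.measure_abs_sum_ge_le a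
    (Z := fun t ω => kernelPow K p ((gridPt n t - gridPt n r) / h) * g t j ω)
    (fun t => (hg t j).const_mul _)
    (f := fun t x => matSqrt (Sig (gridPt n (t - a))) i ⬝ᵥ x) (fun t => measurable_row_dot _)
    (B := fun t => |kernelPow K p ((gridPt n t - gridPt n r) / h)| * (T * √(logMax n d)))
    (fun t ω => by
      rw [abs_mul]; exact mul_le_mul_of_nonneg_left (hgT t j ω) (abs_nonneg _))
    -- With θ = (nh)^{-1/2} the quadratic term of the Bernstein exponent is a constant times log(n ∨
    -- d). The errors are sub-Gaussian, so the range R is no restriction. The surplus 4 in M pays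
    -- for the three powers of n ∨ d in the index set and leaves one.
    (R := (√(n * h))⁻¹ * (B * (T * √(logMax n d)))) (c := c) (θ := (√(n * h))⁻¹)
    (inv_pos.2 hs)
    (fun t => by
      have h1 := hK.abs_kernelPow_le hB p ((gridPt n t - gridPt n r) / h)
      refine mul_le_mul_of_nonneg_left ?_ (inv_pos.2 hs).le
      exact mul_le_mul_of_nonneg_right (h1.1.trans h1.2) (by positivity))
    hc0
    (fun t ht z _ => hb.mgf_varError_le hm (by
      have := (Finset.mem_Icc.1 ht).2; omega) i z)
    (M * (logMax n d * √(n * h)))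
  refine key.trans (ENNReal.ofReal_le_ofReal (mul_le_mul_of_nonneg_left
    (Real.exp_le_exp.2 ?_) zero_le_two))
  simp_rw [mul_pow, sq_abs]
  rw [← Finset.sum_mul, Real.sq_sqrt hL, inv_pow, Real.sq_sqrt hnh0.le]
  have h2 := hK.sum_sq_kernelPow_le hB hn hh hnh p (gridPt n r)
  have h3 : c * (n * h)⁻¹ * ((∑ t ∈ times n, kernelPow K p ((gridPt n t - gridPt n r) / h) ^ 2)
      * (T ^ 2 * logMax n d)) ≤ c * (n * h)⁻¹ * ((3 * B ^ 2 * (n * h)) * (T ^ 2 * logMax n d)) := by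
    gcongr
  have h4 : c * (n * h)⁻¹ * ((3 * B ^ 2 * (n * h)) * (T ^ 2 * logMax n d))
      = c * (3 * B ^ 2 * T ^ 2) * logMax n d := by field_simp
  have h5 : (√(n * h))⁻¹ * (M * (logMax n d * √(n * h))) = M * logMax n d := by field_simp
  rw [h5]
  push_cast
  nlinarith

/-- Deviation of kernel weighted second moments of the errors. -/
theorem VARBound.measure_gram_le [IsProbabilityMeasure P]
    (hb : VARBound P n d A Sig ε ι C D C₁ ρ) (hm : IsTVVAR P n d A Sig ε X)
    (hK : IsKernel K) {B : ℝ} (hB : ∀ x, K x ≤ B) {h : ℝ} (hh : 0 < h) (hnh : 1 ≤ n * h)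
    {a : ℤ} (ha : 0 ≤ a) {θ x E : ℝ} (hθ : 0 < θ) (hθB : θ * B ≤ ι / D / 2)
    (hE : 8 * (Real.exp (ι / D * D) * C) / (ι / D) ^ 2 * θ ^ 2 * (3 * B ^ 2 * (n * h)) - θ * x
      ≤ -E) (p : ℕ) (τ : ℝ) (i j : Fin d) :
    P {ω | x ≤ |∑ t ∈ times n, kernelPow K p ((gridPt n t - τ) / h)
        * (varError n Sig ε (t - a) ω i * varError n Sig ε (t - a) ω j
          - Sig (gridPt n (t - a)) i j)|}
      ≤ ENNReal.ofReal (2 * Real.exp (-E)) := by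
  have hn := hb.n_pos
  have hι := hb.iota_pos
  have hD := hb.D_pos
  have hC : 0 ≤ C := zero_le_one.trans hb.one_le_C
  have hB0 : 0 ≤ B := (hK.nonneg 0).trans (hB 0)
  set c := 8 * (Real.exp (ι / D * D) * C) / (ι / D) ^ 2 with hc
  have hc0 : 0 ≤ c := by rw [hc]; positivity
  have key := hm.measure_abs_sum_ge_le a
    (Z := fun t _ => kernelPow K p ((gridPt n t - τ) / h))
    (fun t => measurable_const)
    (f := fun t x => (matSqrt (Sig (gridPt n (t - a))) i ⬝ᵥ x)
      * (matSqrt (Sig (gridPt n (t - a))) j ⬝ᵥ x) - Sig (gridPt n (t - a)) i j)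
    (fun t => ((measurable_row_dot _).mul (measurable_row_dot _)).sub_const _)
    (B := fun t => |kernelPow K p ((gridPt n t - τ) / h)|) (fun t ω => le_rfl)
    (R := ι / D / 2) (c := c) (θ := θ) hθ
    (fun t => by
      have h1 := hK.abs_kernelPow_le hB p ((gridPt n t - τ) / h)
      exact (mul_le_mul_of_nonneg_left (h1.1.trans h1.2) hθ.le).trans hθB)
    hc0
    (fun t ht z hz => hb.mgf_varError_mul_le hm (by
      have := (Finset.mem_Icc.1 ht).2; omega) i j hz) x
  refine key.trans (ENNReal.ofReal_le_ofReal (mul_le_mul_of_nonneg_left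
    (Real.exp_le_exp.2 (le_trans ?_ hE)) zero_le_two))
  simp_rw [sq_abs]
  have h2 := hK.sum_sq_kernelPow_le hB hn hh hnh p τ
  have h3 := mul_le_mul_of_nonneg_left h2 (by positivity : 0 ≤ c * θ ^ 2)
  linarith

/-- The choice θ = (nh)^{-1/2} stays within the sub-exponential range. It gives a deviation log(n ∨
d)·√(nh), coarser than optimal by a root of the logarithm but of the same order as the score. -/
theorem VARBound.measure_gram_grid_le [IsProbabilityMeasure P]
    (hb : VARBound P n d A Sig ε ι C D C₁ ρ) (hm : IsTVVAR P n d A Sig ε X)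
    (hK : IsKernel K) {B : ℝ} (hB : ∀ x, K x ≤ B) {h : ℝ} (hh : 0 < h) (hnh : 1 ≤ n * h)
    (hL : 1 ≤ logMax n d) (hnhB : (√(n * h))⁻¹ * B ≤ ι / D / 2)
    {a : ℤ} (ha : 0 ≤ a) {M : ℝ}
    (hM : 8 * (Real.exp (ι / D * D) * C) / (ι / D) ^ 2 * (3 * B ^ 2) + 4 ≤ M) (q : ℕ) :
    P {ω | ∃ u ∈ devIndex n d q, M * (logMax n d * √(n * h)) ≤
      |∑ t ∈ times n, kernelPow K u.1 ((gridPt n t - gridPt n u.2.1) / h)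
        * (varError n Sig ε (t - a) ω u.2.2.1 * varError n Sig ε (t - a) ω u.2.2.2
          - Sig (gridPt n (t - a)) u.2.2.1 u.2.2.2)|}
      ≤ ENNReal.ofReal (q * 2 / ((max n d : ℕ) : ℝ)) := by
  have hn := hb.n_pos
  have hnh0 : 0 < n * h := zero_lt_one.trans_le hnh
  have hs : 0 < √(n * h) := Real.sqrt_pos.2 hnh0
  have hι := hb.iota_pos
  have hD := hb.D_pos
  have hC : 0 ≤ C := zero_le_one.trans hb.one_le_C
  refine measure_exists_le hn _ (fun u : ℕ × ℤ × Fin d × Fin d => {ω | M * (logMax n d * √(n * h)) ≤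
      |∑ t ∈ times n, kernelPow K u.1 ((gridPt n t - gridPt n u.2.1) / h)
        * (varError n Sig ε (t - a) ω u.2.2.1 * varError n Sig ε (t - a) ω u.2.2.2
          - Sig (gridPt n (t - a)) u.2.2.1 u.2.2.2)|}) zero_le_two (card_devIndex_le n d q)
    fun u _ => ?_
  refine hb.measure_gram_le hm hK hB hh hnh ha (inv_pos.2 hs) hnhB ?_ _ _ _ _
  set c := 8 * (Real.exp (ι / D * D) * C) / (ι / D) ^ 2 with hc
  have hc0 : 0 ≤ c := by rw [hc]; positivity
  rw [inv_pow, Real.sq_sqrt hnh0.le]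
  have h4 : c * (n * h)⁻¹ * (3 * B ^ 2 * (n * h)) = c * (3 * B ^ 2) := by field_simp
  have h5 : (√(n * h))⁻¹ * (M * (logMax n d * √(n * h))) = M * logMax n d := by field_simp
  rw [h4, h5]
  have : 0 ≤ c * (3 * B ^ 2) := by positivity
  push_cast
  nlinarith

/-- The index set of the deviations that are controlled on a fine grid of `[0, 1]`. -/
def fineIndex (n d : ℕ) : Finset (ℕ × ℕ × Fin d × Fin d) :=
  Finset.range 2 ×ˢ Finset.range (n ^ 2 + 1) ×ˢ Finset.univ ×ˢ Finset.univ

theorem card_fineIndex_le (hn : 1 ≤ n) (d : ℕ) :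
    ((fineIndex n d).card : ℝ) ≤ 4 * ((max n d : ℕ) : ℝ) ^ 4 := by
  simp only [fineIndex, Finset.card_product, Finset.card_range, Finset.card_univ,
    Fintype.card_fin]
  have h1 : n ≤ max n d := le_max_left _ _
  have h2 : d ≤ max n d := le_max_right _ _
  have h3 : 2 * ((n ^ 2 + 1) * (d * d)) ≤ 4 * (max n d) ^ 4 := by
    have h4 : n ^ 2 + 1 ≤ 2 * (max n d) ^ 2 := by
      have h5 : n ^ 2 ≤ (max n d) ^ 2 := Nat.pow_le_pow_left h1 2
      have h6 : 1 ≤ (max n d) ^ 2 := Nat.one_le_pow _ _ (lt_of_lt_of_le hn h1)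
      omega
    calc 2 * ((n ^ 2 + 1) * (d * d)) ≤ 2 * ((2 * (max n d) ^ 2) * (max n d * max n d)) :=
          Nat.mul_le_mul_left 2 (Nat.mul_le_mul h4 (Nat.mul_le_mul h2 h2))
      _ = _ := by ring
  exact_mod_cast h3

/-- Here the sharp order √(log(n ∨ d)·nb) is needed for ν⋄, so θ = √(log(n ∨ d)/(nb)) balances the
two terms of the exponent. The fine grid raises the index count to four powers of n ∨ d, hence the
surplus 5. -/
theorem VARBound.measure_cov_grid_le [IsProbabilityMeasure P]
    (hb : VARBound P n d A Sig ε ι C D C₁ ρ) (hm : IsTVVAR P n d A Sig ε X)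
    (hK : IsKernel K) {B : ℝ} (hB : ∀ x, K x ≤ B) {b : ℝ} (hbp : 0 < b) (hnb : 1 ≤ n * b)
    (hL : 1 ≤ logMax n d) (hnbB : √(logMax n d / (n * b)) * B ≤ ι / D / 2) {M : ℝ}
    (hM : 8 * (Real.exp (ι / D * D) * C) / (ι / D) ^ 2 * (3 * B ^ 2) + 5 ≤ M) :
    P {ω | ∃ u ∈ fineIndex n d, M * √(logMax n d * (n * b)) ≤
      |∑ t ∈ times n, kernelPow K u.1 ((gridPt n t - (u.2.1 : ℝ) / (n : ℝ) ^ 2) / b)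
        * (varError n Sig ε t ω u.2.2.1 * varError n Sig ε t ω u.2.2.2
          - Sig (gridPt n t) u.2.2.1 u.2.2.2)|}
      ≤ ENNReal.ofReal (4 * 2 / ((max n d : ℕ) : ℝ)) := by
  have hn := hb.n_pos
  have hnb0 : 0 < n * b := zero_lt_one.trans_le hnb
  have hι := hb.iota_pos
  have hD := hb.D_pos
  have hC : 0 ≤ C := zero_le_one.trans hb.one_le_C
  have hL0 : 0 < logMax n d := zero_lt_one.trans_le hL
  refine measure_exists_le hn _ (fun u : ℕ × ℕ × Fin d × Fin d =>
    {ω | M * √(logMax n d * (n * b)) ≤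
      |∑ t ∈ times n, kernelPow K u.1 ((gridPt n t - (u.2.1 : ℝ) / (n : ℝ) ^ 2) / b)
        * (varError n Sig ε t ω u.2.2.1 * varError n Sig ε t ω u.2.2.2
          - Sig (gridPt n t) u.2.2.1 u.2.2.2)|}) zero_le_two (card_fineIndex_le hn d)
    fun u _ => ?_
  set c := 8 * (Real.exp (ι / D * D) * C) / (ι / D) ^ 2 with hc
  have hc0 : 0 ≤ c := by rw [hc]; positivity
  have hfin : c * √(logMax n d / (n * b)) ^ 2 * (3 * B ^ 2 * (n * b))
      - √(logMax n d / (n * b)) * (M * √(logMax n d * (n * b)))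
      ≤ -((4 + 1 : ℕ) * logMax n d) := by
    rw [Real.sq_sqrt (by positivity)]
    have h4 : c * (logMax n d / (n * b)) * (3 * B ^ 2 * (n * b)) = c * (3 * B ^ 2) * logMax n d := by
      field_simp
    have h5 : √(logMax n d / (n * b)) * (M * √(logMax n d * (n * b))) = M * logMax n d := by
      have : √(logMax n d / (n * b)) * √(logMax n d * (n * b)) = logMax n d := by
        rw [← Real.sqrt_mul (by positivity)]
        rw [show logMax n d / (n * b) * (logMax n d * (n * b)) = logMax n d ^ 2 by field_simp]
        exact Real.sqrt_sq hL0.le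
      linear_combination M * this
    rw [h4, h5]
    push_cast
    nlinarith
  have := hb.measure_gram_le hm hK hB hbp hnb (le_refl (0 : ℤ)) (Real.sqrt_pos.2 (by positivity))
    hnbB hfin u.1 ((u.2.1 : ℝ) / (n : ℝ) ^ 2) u.2.2.1 u.2.2.2
  simpa only [sub_zero] using this

end

section

variable {S : Type*} [MeasurableSpace S] {P : Measure S} {n d : ℕ} {A Sig : ℝ → Mat d}
  {ε X : ℤ → S → Fin d → ℝ} {ι C D C₁ ρ : ℝ} {K : ℝ → ℝ}

/-- Passing from a grid of mesh `n⁻²` to the whole unit interval. -/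
theorem abs_sum_kernelPow_le_of_grid {Lk : ℝ} (hLk0 : 0 ≤ Lk)
    (hLk : ∀ p ≤ 1, ∀ x y, |kernelPow K p x - kernelPow K p y| ≤ Lk * |x - y|) (hn : 1 ≤ n)
    {b : ℝ} (hb : 0 < b) (hnb : 1 ≤ n * b) {L : ℝ} (hL : 1 ≤ L) (hLb : L ≤ n * b)
    {y : ℤ → ℝ} {Y : ℝ} (hY : 0 ≤ Y) (hy : ∀ t ∈ times n, |y t| ≤ Y * L) {p : ℕ} (hp : p ≤ 1)
    {M₁ : ℝ} (hgrid : ∀ m ∈ Finset.range (n ^ 2 + 1),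
      |∑ t ∈ times n, kernelPow K p ((gridPt n t - (m : ℝ) / (n : ℝ) ^ 2) / b) * y t|
        ≤ M₁ * √(L * (n * b))) {τ : ℝ} (hτ : τ ∈ Set.Icc (0 : ℝ) 1) :
    |∑ t ∈ times n, kernelPow K p ((gridPt n t - τ) / b) * y t|
      ≤ (M₁ + Lk * Y) * √(L * (n * b)) := by
  have hn' : (0 : ℝ) < n := by exact_mod_cast hn
  have hn2 : (0 : ℝ) < (n : ℝ) ^ 2 := by positivity
  have hτn : 0 ≤ τ * (n : ℝ) ^ 2 := mul_nonneg hτ.1 hn2.le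
  set m := ⌊τ * (n : ℝ) ^ 2⌋₊ with hm
  have hm1 : (m : ℝ) ≤ τ * (n : ℝ) ^ 2 := Nat.floor_le hτn
  have hm2 : τ * (n : ℝ) ^ 2 < m + 1 := Nat.lt_floor_add_one _
  have hmem : m ∈ Finset.range (n ^ 2 + 1) := by
    rw [Finset.mem_range, Nat.lt_succ_iff]
    have : (m : ℝ) ≤ ((n ^ 2 : ℕ) : ℝ) := by
      push_cast
      nlinarith [hτ.2]
    exact_mod_cast this
  have hd : |τ - (m : ℝ) / (n : ℝ) ^ 2| ≤ 1 / (n : ℝ) ^ 2 := by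
    rw [abs_le]
    constructor
    · have : (m : ℝ) / (n : ℝ) ^ 2 ≤ τ := (div_le_iff₀ hn2).2 hm1
      have : 0 ≤ 1 / (n : ℝ) ^ 2 := by positivity
      linarith
    · rw [sub_le_iff_le_add, ← add_div, le_div_iff₀ hn2]
      linarith
  -- Moving τ by n⁻² moves the kernel argument by at most 1/n, as nb ≥ 1. Summed over n terms the
  -- change is of order L, which is below √(L·nb) because L ≤ nb.
  have hstep : ∀ t ∈ times n, |kernelPow K p ((gridPt n t - τ) / b) * y t
      - kernelPow K p ((gridPt n t - (m : ℝ) / (n : ℝ) ^ 2) / b) * y t| ≤ Lk * Y * L / n := by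
    intro t ht
    rw [← sub_mul, abs_mul]
    have h1 := hLk p hp ((gridPt n t - τ) / b) ((gridPt n t - (m : ℝ) / (n : ℝ) ^ 2) / b)
    have h2 : |(gridPt n t - τ) / b - (gridPt n t - (m : ℝ) / (n : ℝ) ^ 2) / b| ≤ 1 / n := by
      rw [← sub_div, abs_div, abs_of_pos hb, div_le_iff₀ hb,
        show gridPt n t - τ - (gridPt n t - (m : ℝ) / (n : ℝ) ^ 2)
          = -(τ - (m : ℝ) / (n : ℝ) ^ 2) by ring, abs_neg]
      refine hd.trans ?_
      rw [div_le_iff₀ hn2]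
      have : 1 / (n : ℝ) * b * (n : ℝ) ^ 2 = n * b := by field_simp
      rw [this]; exact hnb
    calc _ ≤ (Lk * (1 / n)) * (Y * L) :=
          mul_le_mul (h1.trans (mul_le_mul_of_nonneg_left h2 hLk0)) (hy t ht) (abs_nonneg _)
            (by positivity)
      _ = _ := by ring
  have hsum : |∑ t ∈ times n, kernelPow K p ((gridPt n t - τ) / b) * y t
      - ∑ t ∈ times n, kernelPow K p ((gridPt n t - (m : ℝ) / (n : ℝ) ^ 2) / b) * y t|
      ≤ Lk * Y * L := by
    rw [← Finset.sum_sub_distrib]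
    refine (Finset.abs_sum_le_sum_abs _ _).trans ((Finset.sum_le_card_nsmul _ _ _ hstep).trans ?_)
    rw [card_times, nsmul_eq_mul]
    refine le_of_eq ?_
    field_simp
  have hLs : L ≤ √(L * (n * b)) := by
    refine Real.le_sqrt_of_sq_le ?_
    rw [sq]
    exact mul_le_mul_of_nonneg_left hLb (by linarith)
  have h3 := hgrid m hmem
  have h4 := abs_sub_abs_le_abs_sub
    (∑ t ∈ times n, kernelPow K p ((gridPt n t - τ) / b) * y t)
    (∑ t ∈ times n, kernelPow K p ((gridPt n t - (m : ℝ) / (n : ℝ) ^ 2) / b) * y t)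
  have h5 : Lk * Y * L ≤ Lk * Y * √(L * (n * b)) :=
    mul_le_mul_of_nonneg_left hLs (by positivity)
  linarith

/-- A union of one null event, where the model equations fail, and six deviation events. The
constant M₀ controls suprema of paths, M₁ the fine grid; M exceeds M₁ by the Lipschitz cost of
leaving that grid. -/
theorem VARBound.measure_not_goodPath_le [IsProbabilityMeasure P]
    (hv : VARBound P n d A Sig ε ι C D C₁ ρ) (hm : IsTVVAR P n d A Sig ε X)
    (hK : IsKernel K) {B Lk : ℝ} (hB : ∀ x, K x ≤ B) (hLk0 : 0 ≤ Lk)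
    (hLk : ∀ p ≤ 1, ∀ x y, |kernelPow K p x - kernelPow K p y| ≤ Lk * |x - y|)
    {M₀ M₁ M h b : ℝ} (hM₀ : 0 ≤ M₀) (hM₀1 : 3 ≤ ι / D * M₀ ^ 2)
    (hM₀2 : 3 ≤ ι / (C₁ ^ 2 * D) * (1 - ρ) ^ 2 * M₀ ^ 2)
    (hM₁ : 8 * (Real.exp (ι / D * D) * C) / (ι / D) ^ 2 * (3 * B ^ 2) + 5 ≤ M₁)
    (hM1 : 2 * M₀ ≤ M) (hM2 : (C + 1) / (ι / D) * (3 * B ^ 2 * (2 * M₀) ^ 2) + 4 ≤ M)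
    (hM3 : M₁ + Lk * (M₀ ^ 2 + D) ≤ M)
    (hL : 1 ≤ logMax n d) (hh : 0 < h) (hnh : 1 ≤ n * h)
    (hnhB : (√(n * h))⁻¹ * B ≤ ι / D / 2) (hb : 0 < b) (hnb : 1 ≤ n * b)
    (hLb : logMax n d ≤ n * b) (hnbB : √(logMax n d / (n * b)) * B ≤ ι / D / 2) :
    P {ω | ¬ GoodPath n d K h b M A Sig (fun t => X t ω) (fun t => varError n Sig ε t ω)}
      ≤ ENNReal.ofReal ((4 * C + 24) / ((max n d : ℕ) : ℝ)) := by
  have hn := hv.n_pos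
  have hC : 0 ≤ C := zero_le_one.trans hv.one_le_C
  have hD := hv.D_pos
  have hL0 : 0 < logMax n d := zero_lt_one.trans_le hL
  have hsL : 0 < √(logMax n d) := Real.sqrt_pos.2 hL0
  obtain ⟨hE1, hE2'⟩ := hv.measure_varError_le hm hM₀ hM₀1
  have hE2 := hE2' hM₀2
  set T := 2 * M₀ * √(logMax n d) with hT
  have hT0 : 0 ≤ T := by positivity
  have hE3 := hv.measure_transform_le hm hK hB hh hnh (le_refl (0 : ℤ)) (T := 2 * M₀) (M := M)
    (by positivity)
    (fun t j ω => trunc T (pastPart n A Sig ε (t - 1) ω j + varError n Sig ε (t - 1) ω j))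
    (fun t j => by
      rw [sub_zero]
      exact (measurable_trunc T).comp (((measurable_pastPart n A Sig ε (t - 1) j).mono
        (pastSigma_mono ε (by omega)) le_rfl).add
          (measurable_varError_pastSigma n Sig ε le_rfl j)))
    (fun t j ω => abs_trunc_le hT0 _) hM2 2
  -- At lag one the error multiplying the weight is e_{t-1}, so only the past part of X_{t-1} may
  -- serve as weight.
  have hE4 := hv.measure_transform_le hm hK hB hh hnh zero_le_one (T := 2 * M₀) (M := M)
    (by positivity) (fun t j ω => trunc T (pastPart n A Sig ε (t - 1) ω j))
    (fun t j => (measurable_trunc T).comp (measurable_pastPart n A Sig ε (t - 1) j))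
    (fun t j ω => abs_trunc_le hT0 _) hM2 3
  have hM₁M : M₁ ≤ M := by
    have : 0 ≤ Lk * (M₀ ^ 2 + D) := by positivity
    linarith
  have hE5 := hv.measure_gram_grid_le hm hK hB hh hnh hL hnhB zero_le_one (M := M)
    (by linarith) 3
  have hE6 := hv.measure_cov_grid_le hm hK hB hb hnb hL hnbB hM₁
  have hnull : ∀ᵐ ω ∂P, (∀ t ∈ Finset.Icc (0 : ℤ) n, ∀ j,
      X t ω j = pastPart n A Sig ε t ω j + varError n Sig ε t ω j) ∧
      ∀ t ∈ times n, X t ω = (A (gridPt n t)).mulVec (X (t - 1) ω) + varError n Sig ε t ω := by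
    refine ((Finset.eventually_all _).2 fun t ht => hm.eq_pastPart_add ht).and
      ((Finset.eventually_all _).2 fun t ht => hm.autoregression t ht)
  have hnull0 := ae_iff.1 hnull
  set E0 := {ω | ¬ ((∀ t ∈ Finset.Icc (0 : ℤ) n, ∀ j,
      X t ω j = pastPart n A Sig ε t ω j + varError n Sig ε t ω j) ∧
      ∀ t ∈ times n, X t ω = (A (gridPt n t)).mulVec (X (t - 1) ω) + varError n Sig ε t ω)}
  set E1 := {ω | ∃ u ∈ Finset.Icc (0 : ℤ) n ×ˢ (Finset.univ : Finset (Fin d)),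
      M₀ * √(logMax n d) < |varError n Sig ε u.1 ω u.2|}
  set E2 := {ω | ∃ u ∈ Finset.Icc (0 : ℤ) n ×ˢ (Finset.univ : Finset (Fin d)),
      M₀ * √(logMax n d) < |pastPart n A Sig ε u.1 ω u.2|}
  set E3 := {ω | ∃ u ∈ devIndex n d 2, M * (logMax n d * √(n * h)) ≤
      |∑ t ∈ times n, (kernelPow K u.1 ((gridPt n t - gridPt n u.2.1) / h)
        * trunc T (pastPart n A Sig ε (t - 1) ω u.2.2.2 + varError n Sig ε (t - 1) ω u.2.2.2))
        * varError n Sig ε (t - 0) ω u.2.2.1|}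
  set E4 := {ω | ∃ u ∈ devIndex n d 3, M * (logMax n d * √(n * h)) ≤
      |∑ t ∈ times n, (kernelPow K u.1 ((gridPt n t - gridPt n u.2.1) / h)
        * trunc T (pastPart n A Sig ε (t - 1) ω u.2.2.2))
        * varError n Sig ε (t - 1) ω u.2.2.1|}
  set E5 := {ω | ∃ u ∈ devIndex n d 3, M * (logMax n d * √(n * h)) ≤
      |∑ t ∈ times n, kernelPow K u.1 ((gridPt n t - gridPt n u.2.1) / h)
        * (varError n Sig ε (t - 1) ω u.2.2.1 * varError n Sig ε (t - 1) ω u.2.2.2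
          - Sig (gridPt n (t - 1)) u.2.2.1 u.2.2.2)|}
  set E6 := {ω | ∃ u ∈ fineIndex n d, M₁ * √(logMax n d * (n * b)) ≤
      |∑ t ∈ times n, kernelPow K u.1 ((gridPt n t - (u.2.1 : ℝ) / (n : ℝ) ^ 2) / b)
        * (varError n Sig ε t ω u.2.2.1 * varError n Sig ε t ω u.2.2.2
          - Sig (gridPt n t) u.2.2.1 u.2.2.2)|}
  have hsub : {ω | ¬ GoodPath n d K h b M A Sig (fun t => X t ω)
      (fun t => varError n Sig ε t ω)} ⊆ E0 ∪ (E1 ∪ (E2 ∪ (E3 ∪ (E4 ∪ (E5 ∪ E6))))) := by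
    intro ω hω
    by_contra hcon
    simp only [Set.mem_union, not_or] at hcon
    obtain ⟨h0, h1, h2, h3, h4, h5, h6⟩ := hcon
    refine hω ?_
    obtain ⟨h0a, h0b⟩ := not_not.1 h0
    have he : ∀ t ∈ Finset.Icc (0 : ℤ) n, ∀ j, |varError n Sig ε t ω j| ≤ M₀ * √(logMax n d) :=
      fun t ht j => not_lt.1 fun hlt => h1 ⟨(t, j), by simp [Finset.mem_product, ht], hlt⟩
    have hY : ∀ t ∈ Finset.Icc (0 : ℤ) n, ∀ j, |pastPart n A Sig ε t ω j| ≤ M₀ * √(logMax n d) :=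
      fun t ht j => not_lt.1 fun hlt => h2 ⟨(t, j), by simp [Finset.mem_product, ht], hlt⟩
    have hX : ∀ t ∈ Finset.Icc (0 : ℤ) n, ∀ j, |X t ω j| ≤ T := fun t ht j => by
      rw [h0a t ht j]
      refine (abs_add_le _ _).trans ?_
      have := he t ht j
      have := hY t ht j
      rw [hT]; linarith
    have hlag : ∀ t ∈ times n, t - 1 ∈ Finset.Icc (0 : ℤ) n := fun t ht => by
      have := Finset.mem_Icc.1 ht
      exact Finset.mem_Icc.2 ⟨by omega, by omega⟩
    have hcur : ∀ t ∈ times n, t ∈ Finset.Icc (0 : ℤ) n := fun t ht => by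
      have := Finset.mem_Icc.1 ht
      exact Finset.mem_Icc.2 ⟨by omega, by omega⟩
    have hidx : ∀ q p : ℕ, p < q → ∀ r ∈ times n, ∀ i j : Fin d,
        (p, r, i, j) ∈ devIndex n d q := fun q p hp r hr i j => by
      simp [devIndex, hp, hr]
    refine ⟨h0b, fun t ht j => (hX t ht j).trans ?_, fun t ht j => (he t ht j).trans ?_,
      fun p hp r hr i j => ?_, fun p hp r hr i j => ?_, fun p hp r hr i j => ?_,
      fun p hp τ hτ i j => ?_⟩
    · exact mul_le_mul_of_nonneg_right hM1 hsL.le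
    · exact mul_le_mul_of_nonneg_right (by linarith) hsL.le
    · have hlt := not_le.1 fun hle => h3 ⟨(p, r, i, j), hidx 2 p (by omega) r hr i j, hle⟩
      refine le_trans (le_of_eq ?_) hlt.le
      congr 1
      refine Finset.sum_congr rfl fun t ht => ?_
      simp only [sub_zero]
      rw [trunc_eq (by rw [← h0a _ (hlag t ht) j]; exact hX _ (hlag t ht) j),
        ← h0a _ (hlag t ht) j]
    · have hlt := not_le.1 fun hle => h4 ⟨(p, r, i, j), hidx 3 p (by omega) r hr i j, hle⟩
      refine le_trans (le_of_eq ?_) hlt.le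
      congr 1
      refine Finset.sum_congr rfl fun t ht => ?_
      have hYT : |pastPart n A Sig ε (t - 1) ω j| ≤ T :=
        (hY _ (hlag t ht) j).trans (by rw [hT]; nlinarith)
      simp only []
      rw [trunc_eq hYT, h0a _ (hlag t ht) j, add_sub_cancel_right]
    · exact (not_le.1 fun hle => h5 ⟨(p, r, i, j), hidx 3 p (by omega) r hr i j, hle⟩).le
    · refine (abs_sum_kernelPow_le_of_grid hLk0 hLk hn hb hnb hL hLb
        (y := fun t => varError n Sig ε t ω i * varError n Sig ε t ω j - Sig (gridPt n t) i j)
        (Y := M₀ ^ 2 + D) (by positivity) (fun t ht => ?_) hp (M₁ := M₁) (fun m hmr => ?_) hτ).trans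
        (mul_le_mul_of_nonneg_right hM3 (Real.sqrt_nonneg _))
      · have hσ := hv.abs_Sig_le (gridPt_le_one hn (Finset.mem_Icc.1 ht).2) i j
        have h7 : |varError n Sig ε t ω i * varError n Sig ε t ω j| ≤ M₀ ^ 2 * logMax n d := by
          rw [abs_mul]
          calc _ ≤ (M₀ * √(logMax n d)) * (M₀ * √(logMax n d)) :=
                mul_le_mul (he t (hcur t ht) i) (he t (hcur t ht) j) (abs_nonneg _) (by positivity)
            _ = M₀ ^ 2 * (√(logMax n d) * √(logMax n d)) := by ring
            _ = _ := by rw [Real.mul_self_sqrt hL0.le]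
        have h8 := abs_sub (varError n Sig ε t ω i * varError n Sig ε t ω j) (Sig (gridPt n t) i j)
        refine h8.trans ?_
        nlinarith
      · refine (not_le.1 fun hle => h6 ⟨(p, m, i, j), ?_, hle⟩).le
        simp only [fineIndex, Finset.mem_product, Finset.mem_univ, and_true]
        exact ⟨Finset.mem_range.2 (by omega), hmr⟩
  refine (measure_mono hsub).trans ?_
  have hN : (0 : ℝ) < ((max n d : ℕ) : ℝ) := by
    exact_mod_cast lt_of_lt_of_le hn (le_max_left n d)
  have htot : P (E0 ∪ (E1 ∪ (E2 ∪ (E3 ∪ (E4 ∪ (E5 ∪ E6))))))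
      ≤ 0 + (ENNReal.ofReal (2 * C / ((max n d : ℕ) : ℝ))
        + (ENNReal.ofReal (2 * C / ((max n d : ℕ) : ℝ))
        + (ENNReal.ofReal ((2 : ℕ) * 2 / ((max n d : ℕ) : ℝ))
        + (ENNReal.ofReal ((3 : ℕ) * 2 / ((max n d : ℕ) : ℝ))
        + (ENNReal.ofReal ((3 : ℕ) * 2 / ((max n d : ℕ) : ℝ))
        + ENNReal.ofReal (4 * 2 / ((max n d : ℕ) : ℝ))))))) := by
    refine (measure_union_le _ _).trans (add_le_add hnull0.le ?_)
    refine (measure_union_le _ _).trans (add_le_add hE1 ?_)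
    refine (measure_union_le _ _).trans (add_le_add hE2 ?_)
    refine (measure_union_le _ _).trans (add_le_add hE3 ?_)
    refine (measure_union_le _ _).trans (add_le_add hE4 ?_)
    exact (measure_union_le _ _).trans (add_le_add hE5 hE6)
  refine htot.trans (le_of_eq ?_)
  rw [zero_add]
  repeat rw [← ENNReal.ofReal_add (by positivity) (by positivity)]
  congr 1
  push_cast
  ring

end

/-! ### Constrained `ℓ₁` minimisation -/

section Clime

variable {d : ℕ}

theorem abs_apply_le_maxNorm (W : Mat d) (i j : Fin d) : |W i j| ≤ maxNorm W :=
  (le_ciSup (f := fun j => |W i j|) (Set.finite_range _).bddAbove j).trans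
    (le_ciSup (f := fun i => ⨆ j, |W i j|) (Set.finite_range _).bddAbove i)

theorem maxNorm_le {W : Mat d} {r : ℝ} (hr : 0 ≤ r) (h : ∀ i j, |W i j| ≤ r) : maxNorm W ≤ r :=
  Real.iSup_le (fun i => Real.iSup_le (fun j => h i j) hr) hr

theorem sum_abs_le_colSumNorm (W : Mat d) (j : Fin d) : ∑ i, |W i j| ≤ colSumNorm W :=
  le_ciSup (f := fun j => ∑ i, |W i j|) (Set.finite_range _).bddAbove j

/-- Schur's test. -/
theorem opNorm_le_of_sum_abs_le {W : Mat d} {R : ℝ} (hR : 0 ≤ R) (hrow : ∀ i, ∑ j, |W i j| ≤ R)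
    (hcol : ∀ j, ∑ i, |W i j| ≤ R) : opNorm W ≤ R := by
  refine ContinuousLinearMap.opNorm_le_bound _ hR fun x => ?_
  rw [EuclideanSpace.norm_eq, EuclideanSpace.norm_eq]
  refine Real.sqrt_le_iff.2 ⟨by positivity, ?_⟩
  rw [mul_pow, Real.sq_sqrt (Finset.sum_nonneg fun i _ => sq_nonneg _)]
  simp only [Matrix.ofLp_toEuclideanCLM, Real.norm_eq_abs, sq_abs, Matrix.mulVec, dotProduct]
  -- Cauchy–Schwarz with weights |W i j|: the row sums enter here, the column sums after exchanging
  -- the order of summation.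
  have h1 : ∀ i, (∑ j, W i j * x j) ^ 2 ≤ R * ∑ j, |W i j| * x j ^ 2 := by
    intro i
    have h2 : (∑ j, W i j * x j) ^ 2 ≤ (∑ j, |W i j|) * ∑ j, |W i j| * x j ^ 2 := by
      refine Finset.sum_sq_le_sum_mul_sum_of_sq_le_mul _ (fun j _ => abs_nonneg _)
        (fun j _ => by positivity) fun j _ => le_of_eq ?_
      rw [mul_pow, ← sq_abs (W i j)]; ring
    exact h2.trans (mul_le_mul_of_nonneg_right (hrow i)
      (Finset.sum_nonneg fun j _ => by positivity))
  calc ∑ i, (∑ j, W i j * x j) ^ 2 ≤ ∑ i, R * ∑ j, |W i j| * x j ^ 2 :=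
        Finset.sum_le_sum fun i _ => h1 i
    _ = R * ∑ j, (∑ i, |W i j|) * x j ^ 2 := by
        rw [← Finset.mul_sum, Finset.sum_comm]; simp only [Finset.sum_mul]
    _ ≤ R * ∑ j, R * x j ^ 2 := by
        gcongr with j
        exact hcol j
    _ = _ := by rw [← Finset.mul_sum]; ring

theorem frobNorm_sq (W : Mat d) : frobNorm W ^ 2 = ∑ j, ∑ i, W i j ^ 2 := by
  have e : (W.transpose * W).trace = ∑ j, ∑ i, W i j ^ 2 := by
    simp only [Matrix.trace, Matrix.diag, Matrix.mul_apply, Matrix.transpose_apply, sq]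
  rw [frobNorm, Real.sq_sqrt, e]
  rw [e]
  exact Finset.sum_nonneg fun _ _ => Finset.sum_nonneg fun _ _ => sq_nonneg _

theorem symmetrise_comm (W : Mat d) (i j : Fin d) : symmetrise W i j = symmetrise W j i := by
  simp only [symmetrise, Matrix.of_apply]
  rcases lt_trichotomy i j with h | h | h
  · rw [if_pos h.le, if_neg (not_le.2 h)]
  · rw [h]
  · rw [if_neg (not_le.2 h), if_pos h.le]

theorem abs_symmetrise_le (W : Mat d) (i j : Fin d) : |symmetrise W i j| ≤ |W i j| := by
  simp only [symmetrise, Matrix.of_apply]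
  split_ifs with h1 h2 h2
  · exact le_rfl
  · exact (not_le.1 h2).le
  · exact h2
  · exact le_rfl

theorem symmetrise_eq_or (W : Mat d) (i j : Fin d) :
    symmetrise W i j = W i j ∨ symmetrise W i j = W j i := by
  simp only [symmetrise, Matrix.of_apply]
  split_ifs <;> simp

/-- The CLIME problem separates over the columns. -/
theorem IsClime.sum_abs_col_le {Sh W V : Mat d} {lam : ℝ} (hlam : 0 ≤ lam) (hW : IsClime Sh lam W)
    (hV : ClimeFeasible Sh lam V) (j : Fin d) : ∑ i, |W i j| ≤ ∑ i, |V i j| := by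
  classical
  -- Exchanging one column keeps feasibility, since column k of the constraint involves only column
  -- k of the matrix, and the other columns cancel in the objective.
  let U : Mat d := W.updateCol j fun i => V i j
  have hU : ClimeFeasible Sh lam U := by
    refine maxNorm_le hlam fun i k => ?_
    by_cases hk : k = j
    · have e : (Sh * U - 1) i k = (Sh * V - 1) i k := by
        simp [U, Matrix.sub_apply, Matrix.mul_apply, hk]
      rw [e]
      exact (abs_apply_le_maxNorm _ i k).trans hV
    · have e : (Sh * U - 1) i k = (Sh * W - 1) i k := by
        simp [U, Matrix.sub_apply, Matrix.mul_apply, hk]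
      rw [e]
      exact (abs_apply_le_maxNorm _ i k).trans hW.1
  have h1 := hW.2 U hU
  unfold entrySumNorm at h1
  rw [Finset.sum_comm, Finset.sum_comm (f := fun i k => |U i k|),
    ← Finset.add_sum_erase _ _ (Finset.mem_univ j),
    ← Finset.add_sum_erase Finset.univ (fun k => ∑ i, |U i k|) (Finset.mem_univ j)] at h1
  have e1 : ∑ k ∈ Finset.univ.erase j, ∑ i, |U i k| = ∑ k ∈ Finset.univ.erase j, ∑ i, |W i k| := by
    refine Finset.sum_congr rfl fun k hk => Finset.sum_congr rfl fun i _ => ?_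
    simp [U, Finset.ne_of_mem_erase hk]
  have e2 : ∑ i, |U i j| = ∑ i, |V i j| := by simp [U]
  rw [e1, e2] at h1
  linarith

/-- An approximation in maximum norm with smaller `ℓ₁` norm than a sparse target. -/
theorem sum_abs_sub_le_of_sparse {ι : Type*} (s : Finset ι) {w v : ι → ℝ} {q ξ t : ℝ} (hq : q < 1)
    (ht : 0 < t) (hclose : ∀ i ∈ s, |w i - v i| ≤ t) (hle : ∑ i ∈ s, |w i| ≤ ∑ i ∈ s, |v i|)
    (hq0 : 0 ≤ q) (hsp : ∑ i ∈ s, (if v i = 0 then 0 else |v i| ^ q) ≤ ξ) :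
    ∑ i ∈ s, |w i - v i| ≤ 2 * ξ * t ^ (1 - q) := by
  have h1 : ∀ i ∈ s, |w i - v i| ≤ |w i| - |v i|
      + 2 * (t ^ (1 - q) * (if v i = 0 then 0 else |v i| ^ q)) := by
    intro i hi
    -- Weak sparsity enters here. The companion bound `h2` says |w - v| ≤ |w| - |v| + 2 min(|v|, t):
    -- for small |v| by the triangle inequality, for large |v| because |w - v| ≤ t. Summed up, the
    -- difference of the ℓ₁ norms is nonpositive.
    have hmin : min |v i| t ≤ t ^ (1 - q) * (if v i = 0 then 0 else |v i| ^ q) := by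
      by_cases hv : v i = 0
      · simp [hv, ht.le]
      · rw [if_neg hv]
        have hpos : 0 < |v i| := abs_pos.2 hv
        rcases le_total |v i| t with h | h
        · rw [min_eq_left h]
          calc |v i| = |v i| ^ (1 - q) * |v i| ^ q := by
                rw [← Real.rpow_add hpos]; simp
            _ ≤ _ := by
                gcongr
        · rw [min_eq_right h]
          calc t = t ^ (1 - q) * t ^ q := by rw [← Real.rpow_add ht]; simp
            _ ≤ _ := by gcongr
    have h2 : |w i - v i| ≤ |w i| - |v i| + 2 * min |v i| t := by
      have h3 := hclose i hi
      have h4 : |v i| ≤ |w i| + |w i - v i| := by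
        have := abs_sub_abs_le_abs_sub (v i) (w i)
        rw [abs_sub_comm] at this; linarith
      have h5 := abs_sub (w i) (v i)
      rcases le_total |v i| t with h | h
      · rw [min_eq_left h]; linarith
      · rw [min_eq_right h]; linarith
    linarith
  calc ∑ i ∈ s, |w i - v i| ≤ ∑ i ∈ s, (|w i| - |v i|
      + 2 * (t ^ (1 - q) * (if v i = 0 then 0 else |v i| ^ q))) := Finset.sum_le_sum h1
    _ = ∑ i ∈ s, |w i| - ∑ i ∈ s, |v i|
        + 2 * t ^ (1 - q) * ∑ i ∈ s, (if v i = 0 then 0 else |v i| ^ q) := by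
        rw [Finset.sum_add_distrib, Finset.sum_sub_distrib, Finset.mul_sum]
        congr 1
        exact Finset.sum_congr rfl fun i _ => by ring
    _ ≤ 0 + 2 * t ^ (1 - q) * ξ := by
        refine add_le_add (by linarith) (mul_le_mul_of_nonneg_left hsp (by positivity))
    _ = _ := by ring

theorem abs_mul_apply_le {V W : Mat d} {r c : ℝ} (hV : ∀ i j, |V i j| ≤ r) (hr : 0 ≤ r)
    (hW : ∀ j, ∑ i, |W i j| ≤ c) (i j : Fin d) : |(V * W) i j| ≤ r * c := by
  rw [Matrix.mul_apply]
  calc |∑ k, V i k * W k j| ≤ ∑ k, |V i k * W k j| := Finset.abs_sum_le_sum_abs _ _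
    _ ≤ ∑ k, r * |W k j| := Finset.sum_le_sum fun k _ => by
        rw [abs_mul]; exact mul_le_mul_of_nonneg_right (hV i k) (abs_nonneg _)
    _ = r * ∑ k, |W k j| := by rw [Finset.mul_sum]
    _ ≤ r * c := mul_le_mul_of_nonneg_left (hW j) hr

/-- Error of the symmetrised CLIME estimate of a sparse precision matrix `Om`, in terms of the
error of the covariance estimate. -/
theorem clime_error {Sg Sh Om W : Mat d} {lam v q ξ C₂ t : ℝ} (hd : 1 ≤ d)
    (hinv : Sg * Om = 1) (hsymm : Om.transpose = Om) (hcol : ∀ j, ∑ i, |Om i j| ≤ C₂)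
    (hC₂ : 0 ≤ C₂) (hv : 0 ≤ v) (hSh : ∀ i j, |Sh i j - Sg i j| ≤ v) (hlam : v * C₂ ≤ lam)
    (hW : (∃ V, ClimeFeasible Sh lam V) → IsClime Sh lam W) (hq0 : 0 ≤ q) (hq : q < 1)
    (hsp : ∀ i, ∑ j, (if Om i j = 0 then 0 else |Om i j| ^ q) ≤ ξ)
    (ht : t = (lam + v * C₂) * C₂) (ht0 : 0 < t) :
    maxNorm (symmetrise W - Om) ≤ t ∧ opNorm (symmetrise W - Om) ≤ 2 * ξ * t ^ (1 - q) ∧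
      1 / (d : ℝ) * frobNorm (symmetrise W - Om) ^ 2 ≤ 2 * ξ * t ^ (2 - q) := by
  have hlam0 : 0 ≤ lam := (mul_nonneg hv hC₂).trans hlam
  have hs : ∀ i j, Om i j = Om j i := fun i j => congrFun (congrFun hsymm.symm i) j
  -- Since ΣΩ = 1, the defect of Ω in the constraint is (Σ̂ - Σ)Ω. Feasibility of the true precision
  -- matrix is also what guarantees that W is a solution at all.
  have hfeas : ClimeFeasible Sh lam Om := by
    refine maxNorm_le hlam0 fun i j => ?_
    have e : Sh * Om - 1 = (Sh - Sg) * Om := by rw [Matrix.sub_mul, hinv]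
    rw [e]
    exact (abs_mul_apply_le (fun i j => hSh i j) hv hcol i j).trans hlam
  have hcl := hW ⟨Om, hfeas⟩
  have hWcol : ∀ j, ∑ i, |W i j| ≤ ∑ i, |Om i j| := fun j => hcl.sum_abs_col_le hlam0 hfeas j
  -- W - Ω = Ω(ΣW - 1), and ΣW - 1 splits into the constraint defect and (Σ̂ - Σ)W. Transposition
  -- and the symmetry of Ω bring the factor with bounded column sums to the right.
  have herr : ∀ i j, |W i j - Om i j| ≤ t := by
    intro i j
    have e : (W - Om).transpose = (Sg * W - 1).transpose * Om := by
      have hinv' : Om * Sg = 1 := mul_eq_one_comm.1 hinv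
      have h1 : W - Om = Om * (Sg * W - 1) := by
        rw [Matrix.mul_sub, ← Matrix.mul_assoc, hinv', Matrix.one_mul, Matrix.mul_one]
      rw [h1, Matrix.transpose_mul, hsymm]
    have h2 : ∀ i j, |(Sg * W - 1).transpose i j| ≤ lam + v * C₂ := by
      intro i j
      have e2 : Sg * W - 1 = (Sh * W - 1) - (Sh - Sg) * W := by
        rw [Matrix.sub_mul]; abel
      rw [Matrix.transpose_apply, e2, Matrix.sub_apply]
      refine (abs_sub _ _).trans (add_le_add ((abs_apply_le_maxNorm _ _ _).trans hcl.1) ?_)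
      exact abs_mul_apply_le (fun i j => hSh i j) hv (fun j => (hWcol j).trans (hcol j)) _ _
    have h3 := abs_mul_apply_le h2 (by positivity) hcol j i
    rw [← e, Matrix.transpose_apply, Matrix.sub_apply] at h3
    rw [ht]; exact h3
  have hserr : ∀ i j, |symmetrise W i j - Om i j| ≤ t := by
    intro i j
    rcases symmetrise_eq_or W i j with h | h
    · rw [h]; exact herr i j
    · rw [h, hs i j]; exact herr j i
  -- Symmetrisation never enlarges the modulus of an entry, so the columns keep ℓ₁ norms no larger
  -- than those of Ω.
  have hl1 : ∀ j, ∑ i, |symmetrise W i j - Om i j| ≤ 2 * ξ * t ^ (1 - q) := by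
    intro j
    refine sum_abs_sub_le_of_sparse _ hq ht0 (fun i _ => hserr i j)
      ((Finset.sum_le_sum fun i _ => abs_symmetrise_le W i j).trans (hWcol j)) hq0 ?_
    have := hsp j
    simp_rw [hs j] at this
    exact this
  have hR : 0 ≤ 2 * ξ * t ^ (1 - q) :=
    (Finset.sum_nonneg fun i _ => abs_nonneg _).trans (hl1 ⟨0, hd⟩)
  refine ⟨maxNorm_le ht0.le hserr, opNorm_le_of_sum_abs_le hR (fun i => ?_) hl1, ?_⟩
  · refine le_trans (le_of_eq (Finset.sum_congr rfl fun j _ => ?_)) (hl1 i)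
    rw [Matrix.sub_apply, symmetrise_comm, hs i j]
  · have hd' : (0 : ℝ) < d := by exact_mod_cast hd
    have h1 : frobNorm (symmetrise W - Om) ^ 2 ≤ ∑ _j : Fin d, t * (2 * ξ * t ^ (1 - q)) := by
      rw [frobNorm_sq]
      refine Finset.sum_le_sum fun j _ => ?_
      refine le_trans (Finset.sum_le_sum (g := fun i => t * |symmetrise W i j - Om i j|)
        fun i _ => ?_) ?_
      · rw [Matrix.sub_apply, ← sq_abs, sq]
        exact mul_le_mul_of_nonneg_right (hserr i j) (abs_nonneg _)
      · rw [← Finset.mul_sum]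
        exact mul_le_mul_of_nonneg_left (hl1 j) ht0.le
    have e : t * (2 * ξ * t ^ (1 - q)) = 2 * ξ * t ^ (2 - q) := by
      have : t ^ (2 - q) = t * t ^ (1 - q) := by
        rw [show 2 - q = 1 + (1 - q) by ring, Real.rpow_add ht0, Real.rpow_one]
      rw [this]; ring
    rw [Finset.sum_const, Finset.card_univ, Fintype.card_fin, nsmul_eq_mul, e] at h1
    rw [one_div, inv_mul_le_iff₀ hd']
    exact h1

end Clime

/-! ### Penalised weighted least squares -/

section Regression

variable {σ κ : Type*} [Fintype κ]

/-- Weighted residual sum of squares. -/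
def wrss (T : Finset σ) (w : σ → ℝ) (z : σ → κ → ℝ) (y : σ → ℝ) (θ : κ → ℝ) : ℝ :=
  ∑ t ∈ T, w t * (y t - θ ⬝ᵥ z t) ^ 2

/-- The quadratic form of the weighted Gram matrix. -/
def gramForm (T : Finset σ) (w : σ → ℝ) (z : σ → κ → ℝ) (δ : κ → ℝ) : ℝ :=
  ∑ t ∈ T, w t * (δ ⬝ᵥ z t) ^ 2

/-- The negative half gradient of the weighted residual sum of squares. -/
def wscore (T : Finset σ) (w : σ → ℝ) (z : σ → κ → ℝ) (y : σ → ℝ) (θ : κ → ℝ) (k : κ) : ℝ :=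
  ∑ t ∈ T, w t * z t k * (y t - θ ⬝ᵥ z t)

variable {T : Finset σ} {w : σ → ℝ} {z : σ → κ → ℝ} {y : σ → ℝ}

theorem gramForm_nonneg (hw : ∀ t ∈ T, 0 ≤ w t) (δ : κ → ℝ) : 0 ≤ gramForm T w z δ :=
  Finset.sum_nonneg fun t ht => mul_nonneg (hw t ht) (sq_nonneg _)

theorem sum_mul_wscore (θ δ : κ → ℝ) :
    ∑ k, δ k * wscore T w z y θ k = ∑ t ∈ T, w t * (δ ⬝ᵥ z t) * (y t - θ ⬝ᵥ z t) := by
  simp only [wscore, Finset.mul_sum]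
  rw [Finset.sum_comm]
  refine Finset.sum_congr rfl fun t _ => ?_
  have e : δ ⬝ᵥ z t = ∑ k, δ k * z t k := rfl
  rw [e, Finset.mul_sum, Finset.sum_mul]
  exact Finset.sum_congr rfl fun k _ => by ring

theorem wrss_eq (θ θ' : κ → ℝ) :
    wrss T w z y θ' = wrss T w z y θ - 2 * ∑ k, (θ' - θ) k * wscore T w z y θ k
      + gramForm T w z (θ' - θ) := by
  rw [sum_mul_wscore, wrss, wrss, gramForm, Finset.mul_sum, ← Finset.sum_sub_distrib,
    ← Finset.sum_add_distrib]
  refine Finset.sum_congr rfl fun t _ => ?_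
  rw [sub_dotProduct]
  ring

theorem wscore_sub (θ θ' : κ → ℝ) (k : κ) :
    wscore T w z y θ k - wscore T w z y θ' k = ∑ t ∈ T, w t * z t k * ((θ' - θ) ⬝ᵥ z t) := by
  rw [wscore, wscore, ← Finset.sum_sub_distrib]
  refine Finset.sum_congr rfl fun t _ => ?_
  rw [sub_dotProduct]
  ring

theorem sum_mul_wscore_sub (θ θ' : κ → ℝ) :
    ∑ k, (θ' - θ) k * (wscore T w z y θ k - wscore T w z y θ' k)
      = gramForm T w z (θ' - θ) := by
  simp only [mul_sub, Finset.sum_sub_distrib]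
  rw [sum_mul_wscore, sum_mul_wscore]
  rw [← Finset.sum_sub_distrib, gramForm]
  refine Finset.sum_congr rfl fun t _ => ?_
  simp only [sub_dotProduct]
  ring

theorem sq_sum_abs_le (s : Finset κ) (δ : κ → ℝ) :
    (∑ k ∈ s, |δ k|) ^ 2 ≤ s.card * ∑ k, δ k ^ 2 := by
  refine (sq_sum_le_card_mul_sum_sq (s := s) (f := fun k => |δ k|)).trans ?_
  simp only [sq_abs]
  exact mul_le_mul_of_nonneg_left (Finset.sum_le_univ_sum_of_nonneg fun k => sq_nonneg _)
    (Nat.cast_nonneg _)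

theorem sum_abs_eq_of_support {s : Finset κ} {δ : κ → ℝ} (h : ∀ k, k ∉ s → δ k = 0) :
    ∑ k, |δ k| = ∑ k ∈ s, |δ k| :=
  (Finset.sum_subset (Finset.subset_univ s) fun k _ hk => by simp [h k hk]).symm

/-- On vectors supported in a small set the restricted eigenvalue inequality is an eigenvalue
bound. -/
theorem gramForm_ge_of_support {c Dv m : ℝ} (hDv : 0 ≤ Dv)
    (hRE : ∀ δ : κ → ℝ, c * ∑ k, δ k ^ 2 - Dv * (∑ k, |δ k|) ^ 2 ≤ gramForm T w z δ)
    {s : Finset κ} (hs : (s.card : ℝ) ≤ m) (hm : Dv * m ≤ c / 2) {δ : κ → ℝ}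
    (h : ∀ k, k ∉ s → δ k = 0) : c / 2 * ∑ k, δ k ^ 2 ≤ gramForm T w z δ := by
  have h1 := hRE δ
  rw [sum_abs_eq_of_support h] at h1
  have h2 := sq_sum_abs_le s δ
  have h0 : 0 ≤ ∑ k, δ k ^ 2 := Finset.sum_nonneg fun k _ => sq_nonneg _
  have h3 : Dv * (∑ k ∈ s, |δ k|) ^ 2 ≤ c / 2 * ∑ k, δ k ^ 2 := by
    calc Dv * (∑ k ∈ s, |δ k|) ^ 2 ≤ Dv * (m * ∑ k, δ k ^ 2) :=
          mul_le_mul_of_nonneg_left (h2.trans (mul_le_mul_of_nonneg_right hs h0)) hDv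
      _ = (Dv * m) * ∑ k, δ k ^ 2 := by ring
      _ ≤ _ := mul_le_mul_of_nonneg_right hm h0
  linarith

/-- Error bound for the LASSO. -/
theorem lasso_error {c Dv m lam : ℝ} (hc : 0 < c) (hDv : 0 ≤ Dv) (hlam : 0 < lam)
    (hw : ∀ t ∈ T, 0 ≤ w t)
    (hRE : ∀ δ : κ → ℝ, c * ∑ k, δ k ^ 2 - Dv * (∑ k, |δ k|) ^ 2 ≤ gramForm T w z δ)
    {s : Finset κ} (hs : (s.card : ℝ) ≤ m) (hm : 16 * (Dv * m) ≤ c / 2) {θ θ' : κ → ℝ}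
    (hsupp : ∀ k, k ∉ s → θ k = 0) (hscore : ∀ k, |wscore T w z y θ k| ≤ lam / 4)
    (hmin : wrss T w z y θ' + lam * ∑ k, |θ' k| ≤ wrss T w z y θ + lam * ∑ k, |θ k|) :
    ∑ k, (θ' - θ) k ^ 2 ≤ 9 * lam ^ 2 * m / c ^ 2 := by
  classical
  set δ := θ' - θ with hδ
  rw [wrss_eq θ θ', ← hδ] at hmin
  have h1 : ∑ k, δ k * wscore T w z y θ k ≤ lam / 4 * ∑ k, |δ k| := by
    rw [Finset.mul_sum]
    refine Finset.sum_le_sum fun k _ => ?_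
    refine (le_abs_self _).trans ?_
    rw [abs_mul, mul_comm]
    exact mul_le_mul_of_nonneg_right (hscore k) (abs_nonneg _)
  have h2 : ∑ k, |θ k| - ∑ k, |θ' k| ≤ ∑ k ∈ s, |δ k| - ∑ k ∈ sᶜ, |δ k| := by
    rw [← Finset.sum_sub_distrib, ← Finset.sum_add_sum_compl s (fun k => |θ k| - |θ' k|),
      sub_eq_add_neg, ← Finset.sum_neg_distrib]
    refine add_le_add (Finset.sum_le_sum fun k _ => ?_) (Finset.sum_le_sum fun k hk => ?_)
    · have := abs_sub_abs_le_abs_sub (θ k) (θ' k)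
      rw [abs_sub_comm] at this
      exact this
    · have hk0 := hsupp k (Finset.mem_compl.1 hk)
      simp [hδ, hk0]
  have h3 : ∑ k, |δ k| = ∑ k ∈ s, |δ k| + ∑ k ∈ sᶜ, |δ k| :=
    (Finset.sum_add_sum_compl s _).symm
  set a := ∑ k ∈ s, |δ k|
  set b := ∑ k ∈ sᶜ, |δ k|
  have ha : 0 ≤ a := Finset.sum_nonneg fun k _ => abs_nonneg _
  have hb : 0 ≤ b := Finset.sum_nonneg fun k _ => abs_nonneg _
  have hq0 := gramForm_nonneg (z := z) hw δ
  have h4 : gramForm T w z δ ≤ lam * (3 / 2 * a - 1 / 2 * b) := by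
    rw [h3] at h1
    have := mul_le_mul_of_nonneg_left h2 hlam.le
    linarith
  -- The score bound lam/4 costs (lam/2)(a + b) against the gain lam(b - a) of the penalty, whence
  -- the cone condition. It yields (a + b)² ≤ 16a², the source of the 16 in `hm`.
  have h5 : b ≤ 3 * a := by
    have : 0 ≤ lam * (3 / 2 * a - 1 / 2 * b) := hq0.trans h4
    have := nonneg_of_mul_nonneg_right this hlam
    linarith
  have h6 := hRE δ
  rw [h3] at h6
  set Z := ∑ k, δ k ^ 2
  have hZ : 0 ≤ Z := Finset.sum_nonneg fun k _ => sq_nonneg _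
  have h7 : a ^ 2 ≤ m * Z := (sq_sum_abs_le s δ).trans (mul_le_mul_of_nonneg_right hs hZ)
  have h8 : Dv * (a + b) ^ 2 ≤ c / 2 * Z := by
    calc Dv * (a + b) ^ 2 ≤ Dv * (16 * (m * Z)) := by
          refine mul_le_mul_of_nonneg_left ?_ hDv
          nlinarith
      _ = 16 * (Dv * m) * Z := by ring
      _ ≤ _ := mul_le_mul_of_nonneg_right hm hZ
  have h9 : c * Z ≤ 3 * lam * a := by nlinarith
  rw [le_div_iff₀ (by positivity)]
  rcases hZ.eq_or_lt with h0 | h0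
  · rw [← h0, zero_mul]
    have hm0 : 0 ≤ m := (Nat.cast_nonneg _).trans hs
    positivity
  · have h10 : (c * Z) ^ 2 ≤ (3 * lam * a) ^ 2 := pow_le_pow_left₀ (by positivity) h9 2
    have h11 : (3 * lam * a) ^ 2 ≤ 9 * lam ^ 2 * (m * Z) := by
      have := mul_le_mul_of_nonneg_left h7 (by positivity : 0 ≤ 9 * lam ^ 2)
      nlinarith
    refine le_of_mul_le_mul_right ?_ h0
    calc Z * c ^ 2 * Z = (c * Z) ^ 2 := by ring
      _ ≤ 9 * lam ^ 2 * (m * Z) := h10.trans h11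
      _ = _ := by ring

/-- The least squares problem restricted to the coordinates in `s` has a solution. -/
theorem exists_wscore_eq_zero {c : ℝ} (hc : 0 < c) {s : Finset κ}
    (hpos : ∀ δ : κ → ℝ, (∀ k, k ∉ s → δ k = 0) → c * ∑ k, δ k ^ 2 ≤ gramForm T w z δ)
    {θ : κ → ℝ} (hsupp : ∀ k, k ∉ s → θ k = 0) :
    ∃ θ₀ : κ → ℝ, (∀ k, k ∉ s → θ₀ k = 0) ∧ ∀ k ∈ s, wscore T w z y θ₀ k = 0 := by
  classical
  -- The normal equations on s, completed by the identity off s. Definiteness makes this map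
  -- injective, hence surjective in finite dimension, and one Newton step from θ solves the
  -- quadratic problem.
  let F : (κ → ℝ) →ₗ[ℝ] (κ → ℝ) :=
    { toFun := fun δ k => if k ∈ s then ∑ t ∈ T, w t * z t k * (δ ⬝ᵥ z t) else δ k
      map_add' := fun δ δ' => by
        funext k
        by_cases hk : k ∈ s
        · simp only [hk, if_true, Pi.add_apply, add_dotProduct, mul_add, Finset.sum_add_distrib]
        · simp [hk]
      map_smul' := fun r δ => by
        funext k
        by_cases hk : k ∈ s
        · simp only [hk, if_true, Pi.smul_apply, smul_dotProduct, smul_eq_mul, RingHom.id_apply,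
            Finset.mul_sum]
          exact Finset.sum_congr rfl fun t _ => by ring
        · simp [hk] }
  have hinj : Function.Injective F := by
    rw [injective_iff_map_eq_zero]
    intro δ hδ
    have h1 : ∀ k, k ∉ s → δ k = 0 := fun k hk => by
      have := congrFun hδ k
      simpa [F, hk] using this
    have h2 : ∀ k ∈ s, ∑ t ∈ T, w t * z t k * (δ ⬝ᵥ z t) = 0 := fun k hk => by
      have := congrFun hδ k
      simpa only [F, LinearMap.coe_mk, AddHom.coe_mk, hk, if_true, Pi.zero_apply] using this
    have h3 : gramForm T w z δ = 0 := by
      have e : gramForm T w z δ = ∑ k, δ k * ∑ t ∈ T, w t * z t k * (δ ⬝ᵥ z t) := by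
        simp only [gramForm, Finset.mul_sum]
        rw [Finset.sum_comm]
        refine Finset.sum_congr rfl fun t _ => ?_
        rw [sq]
        nth_rw 1 [dotProduct]
        rw [Finset.sum_mul, Finset.mul_sum]
        exact Finset.sum_congr rfl fun k _ => by ring
      rw [e]
      refine Finset.sum_eq_zero fun k _ => ?_
      by_cases hk : k ∈ s
      · rw [h2 k hk, mul_zero]
      · rw [h1 k hk, zero_mul]
    have h4 := hpos δ h1
    rw [h3] at h4
    have h5 : ∑ k, δ k ^ 2 = 0 := by
      refine le_antisymm ?_ (Finset.sum_nonneg fun k _ => sq_nonneg _)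
      nlinarith
    funext k
    have := (Finset.sum_eq_zero_iff_of_nonneg (fun k _ => sq_nonneg (δ k))).1 h5 k
      (Finset.mem_univ k)
    simpa using this
  have hsurj := LinearMap.surjective_of_injective hinj
  obtain ⟨δ, hδ⟩ := hsurj fun k => if k ∈ s then wscore T w z y θ k else 0
  have h1 : ∀ k, k ∉ s → δ k = 0 := fun k hk => by
    have := congrFun hδ k
    simpa [F, hk] using this
  refine ⟨θ + δ, fun k hk => by simp [hsupp k hk, h1 k hk], fun k hk => ?_⟩
  have h2 := congrFun hδ k
  simp only [F, LinearMap.coe_mk, AddHom.coe_mk, hk, if_true] at h2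
  have h3 := wscore_sub (T := T) (w := w) (z := z) (y := y) θ (θ + δ) k
  rw [add_sub_cancel_left, h2] at h3
  linarith

/-- Error bound for restricted least squares. -/
theorem restricted_error {c m g : ℝ} (hc : 0 < c) (hg0 : 0 ≤ g) {s : Finset κ} (hs : (s.card : ℝ) ≤ m)
    (hpos : ∀ δ : κ → ℝ, (∀ k, k ∉ s → δ k = 0) → c * ∑ k, δ k ^ 2 ≤ gramForm T w z δ)
    {θ θ₀ : κ → ℝ} (hsupp : ∀ k, k ∉ s → θ k = 0) (hsupp₀ : ∀ k, k ∉ s → θ₀ k = 0)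
    (h0 : ∀ k ∈ s, wscore T w z y θ₀ k = 0) (hg : ∀ k, |wscore T w z y θ k| ≤ g) :
    ∑ k, |(θ₀ - θ) k| ≤ m * g / c := by
  set δ := θ₀ - θ with hδ
  have hδs : ∀ k, k ∉ s → δ k = 0 := fun k hk => by simp [hδ, hsupp k hk, hsupp₀ k hk]
  have h1 := sum_mul_wscore_sub (T := T) (w := w) (z := z) (y := y) θ θ₀
  rw [← hδ] at h1
  have h2 : ∑ k, δ k * (wscore T w z y θ k - wscore T w z y θ₀ k) ≤ g * ∑ k, |δ k| := by
    rw [Finset.mul_sum]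
    refine Finset.sum_le_sum fun k _ => ?_
    by_cases hk : k ∈ s
    · rw [h0 k hk, sub_zero]
      refine (le_abs_self _).trans ?_
      rw [abs_mul, mul_comm]
      exact mul_le_mul_of_nonneg_right (hg k) (abs_nonneg _)
    · rw [hδs k hk]; simp
  have h3 := hpos δ hδs
  have h4 := sq_sum_abs_le s δ
  rw [← sum_abs_eq_of_support hδs] at h4
  set a := ∑ k, |δ k|
  set Z := ∑ k, δ k ^ 2
  have hZ : 0 ≤ Z := Finset.sum_nonneg fun k _ => sq_nonneg _
  have ha : 0 ≤ a := Finset.sum_nonneg fun k _ => abs_nonneg _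
  have hm : 0 ≤ m := (Nat.cast_nonneg _).trans hs
  rw [le_div_iff₀ hc]
  rcases ha.eq_or_lt with ha0 | ha0
  · rw [← ha0, zero_mul]
    exact mul_nonneg hm hg0
  · have h5 : a ^ 2 ≤ m * Z := h4.trans (mul_le_mul_of_nonneg_right hs hZ)
    have h6 : c * Z ≤ g * a := by linarith
    refine le_of_mul_le_mul_right ?_ ha0
    calc a * c * a = c * a ^ 2 := by ring
      _ ≤ c * (m * Z) := mul_le_mul_of_nonneg_left h5 hc.le
      _ = m * (c * Z) := by ring
      _ ≤ m * (g * a) := mul_le_mul_of_nonneg_left h6 hm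
      _ = _ := by ring

/-- The score is affine with the Gram matrix as slope. This carries the score bound from the truth
to the restricted estimator, also at coordinates outside the support. -/
theorem abs_wscore_le {g G : ℝ} {θ θ₀ : κ → ℝ} (hg : ∀ k, |wscore T w z y θ k| ≤ g)
    (hG : ∀ k l, |∑ t ∈ T, w t * z t k * z t l| ≤ G) (k : κ) :
    |wscore T w z y θ₀ k| ≤ g + G * ∑ l, |(θ₀ - θ) l| := by
  have h1 := wscore_sub (T := T) (w := w) (z := z) (y := y) θ θ₀ k
  have e : ∑ t ∈ T, w t * z t k * ((θ₀ - θ) ⬝ᵥ z t)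
      = ∑ l, (θ₀ - θ) l * ∑ t ∈ T, w t * z t k * z t l := by
    simp only [Finset.mul_sum, dotProduct]
    rw [Finset.sum_comm]
    exact Finset.sum_congr rfl fun l _ => Finset.sum_congr rfl fun t _ => by ring
  rw [e] at h1
  have h2 : |∑ l, (θ₀ - θ) l * ∑ t ∈ T, w t * z t k * z t l| ≤ G * ∑ l, |(θ₀ - θ) l| := by
    refine (Finset.abs_sum_le_sum_abs _ _).trans ?_
    rw [Finset.mul_sum]
    refine Finset.sum_le_sum fun l _ => ?_
    rw [abs_mul, mul_comm]
    exact mul_le_mul_of_nonneg_right (hG k l) (abs_nonneg _)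
  have h3 : wscore T w z y θ₀ k = wscore T w z y θ k
      - ∑ l, (θ₀ - θ) l * ∑ t ∈ T, w t * z t k * z t l := by linarith
  rw [h3]
  exact (abs_sub _ _).trans (add_le_add (hg k) h2)

theorem pathNorm_nonneg (n : ℕ) (f : ℤ → ℝ) : 0 ≤ pathNorm n f := Real.sqrt_nonneg _

theorem pathNorm_eq_zero_iff {n : ℕ} {f : ℤ → ℝ} :
    pathNorm n f = 0 ↔ ∀ t ∈ times n, f t = 0 := by
  have h0 : 0 ≤ ∑ t ∈ times n, f t ^ 2 := Finset.sum_nonneg fun t _ => sq_nonneg _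
  rw [pathNorm, Real.sqrt_eq_zero h0, Finset.sum_eq_zero_iff_of_nonneg fun t _ => sq_nonneg _]
  simp

theorem abs_sum_mul_le_pathNorm (n : ℕ) (f g : ℤ → ℝ) :
    |∑ t ∈ times n, f t * g t| ≤ pathNorm n f * pathNorm n g := by
  rw [pathNorm, pathNorm, ← Real.sqrt_mul (Finset.sum_nonneg fun t _ => sq_nonneg _)]
  exact Real.abs_le_sqrt (Finset.sum_mul_sq_le_sq_mul_sq _ _ _)

/-- A group-penalised estimator coincides with restricted least squares when the penalty vanishes
on the restricted set and dominates the score outside of it. -/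
theorem group_lasso_eq {n : ℕ} {w : ℤ → ℤ → ℝ} {z : ℤ → ℤ → κ → ℝ} {y : ℤ → ℝ}
    (hw : ∀ r, ∀ t ∈ times n, 0 ≤ w r t) {c : ℝ} (hc : 0 < c) {s : Finset κ}
    (hpos : ∀ r ∈ times n, ∀ δ : κ → ℝ, (∀ k, k ∉ s → δ k = 0) →
      c * ∑ k, δ k ^ 2 ≤ gramForm (times n) (w r) (z r) δ)
    {pen : κ → ℝ} {θ θ₀ : ℤ → κ → ℝ} (hsupp₀ : ∀ r ∈ times n, ∀ k, k ∉ s → θ₀ r k = 0)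
    (h0 : ∀ r ∈ times n, ∀ k ∈ s, wscore (times n) (w r) (z r) y (θ₀ r) k = 0)
    (hpen0 : ∀ k ∈ s, pen k = 0)
    (hpen : ∀ k, k ∉ s →
      2 * pathNorm n (fun r => wscore (times n) (w r) (z r) y (θ₀ r) k) < pen k)
    (hmin : ∑ r ∈ times n, wrss (times n) (w r) (z r) y (θ r)
        + ∑ k, pen k * pathNorm n (fun r => θ r k)
      ≤ ∑ r ∈ times n, wrss (times n) (w r) (z r) y (θ₀ r)
        + ∑ k, pen k * pathNorm n (fun r => θ₀ r k)) :
    ∀ r ∈ times n, θ r = θ₀ r := by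
  classical
  have hz0 : ∑ k, pen k * pathNorm n (fun r => θ₀ r k) = 0 := by
    refine Finset.sum_eq_zero fun k _ => ?_
    by_cases hk : k ∈ s
    · rw [hpen0 k hk, zero_mul]
    · rw [pathNorm_eq_zero_iff.2 fun r hr => hsupp₀ r hr k hk, mul_zero]
  have hexp : ∑ r ∈ times n, wrss (times n) (w r) (z r) y (θ r)
      = ∑ r ∈ times n, wrss (times n) (w r) (z r) y (θ₀ r)
        - 2 * ∑ k, ∑ r ∈ times n, (θ r - θ₀ r) k * wscore (times n) (w r) (z r) y (θ₀ r) k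
        + ∑ r ∈ times n, gramForm (times n) (w r) (z r) (θ r - θ₀ r) := by
    rw [Finset.sum_comm, Finset.mul_sum, ← Finset.sum_sub_distrib, ← Finset.sum_add_distrib]
    exact Finset.sum_congr rfl fun r _ => wrss_eq (θ₀ r) (θ r)
  rw [hz0, hexp] at hmin
  -- The excess of the objective over its value at θ₀ is the sum of these terms and of Gram forms,
  -- all nonnegative. At a minimiser all vanish: strict domination then kills the coordinates
  -- outside s, and definiteness gives equality inside.
  have hle : ∀ k, 0 ≤ pen k * pathNorm n (fun r => θ r k)
      - 2 * ∑ r ∈ times n, (θ r - θ₀ r) k * wscore (times n) (w r) (z r) y (θ₀ r) k ∧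
      (k ∉ s → pen k * pathNorm n (fun r => θ r k)
      - 2 * ∑ r ∈ times n, (θ r - θ₀ r) k * wscore (times n) (w r) (z r) y (θ₀ r) k = 0 →
        pathNorm n (fun r => θ r k) = 0) := by
    intro k
    by_cases hk : k ∈ s
    · refine ⟨?_, fun h => absurd hk h⟩
      rw [hpen0 k hk, Finset.sum_eq_zero fun r hr => by rw [h0 r hr k hk, mul_zero]]
      simp
    · have e : ∑ r ∈ times n, (θ r - θ₀ r) k * wscore (times n) (w r) (z r) y (θ₀ r) k
          = ∑ r ∈ times n, θ r k * wscore (times n) (w r) (z r) y (θ₀ r) k :=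
        Finset.sum_congr rfl fun r hr => by rw [Pi.sub_apply, hsupp₀ r hr k hk, sub_zero]
      have h1 := (le_abs_self _).trans (abs_sum_mul_le_pathNorm n (fun r => θ r k)
        (fun r => wscore (times n) (w r) (z r) y (θ₀ r) k))
      have h2 := hpen k hk
      have h3 := pathNorm_nonneg n fun r => θ r k
      rw [e]
      refine ⟨by nlinarith, fun _ h4 => ?_⟩
      by_contra hne
      have h5 : 0 < pathNorm n fun r => θ r k := lt_of_le_of_ne h3 (Ne.symm hne)
      nlinarith
  have hq : ∀ r ∈ times n, 0 ≤ gramForm (times n) (w r) (z r) (θ r - θ₀ r) := fun r _ =>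
    gramForm_nonneg (hw r) _
  have hsumle : ∑ k, (pen k * pathNorm n (fun r => θ r k)
      - 2 * ∑ r ∈ times n, (θ r - θ₀ r) k * wscore (times n) (w r) (z r) y (θ₀ r) k)
      + ∑ r ∈ times n, gramForm (times n) (w r) (z r) (θ r - θ₀ r) ≤ 0 := by
    rw [Finset.sum_sub_distrib, ← Finset.mul_sum]
    linarith
  have hA := Finset.sum_nonneg fun k (_ : k ∈ Finset.univ) => (hle k).1
  have hB := Finset.sum_nonneg hq
  have hA0 := (Finset.sum_eq_zero_iff_of_nonneg fun k _ => (hle k).1).1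
    (le_antisymm (by linarith) hA)
  have hB0 := (Finset.sum_eq_zero_iff_of_nonneg hq).1 (le_antisymm (by linarith) hB)
  intro r hr
  have hδs : ∀ k, k ∉ s → (θ r - θ₀ r) k = 0 := fun k hk => by
    have := pathNorm_eq_zero_iff.1 ((hle k).2 hk (hA0 k (Finset.mem_univ k))) r hr
    rw [Pi.sub_apply, this, hsupp₀ r hr k hk, sub_zero]
  have h1 := hpos r hr _ hδs
  rw [hB0 r hr] at h1
  have h2 : ∑ k, (θ r - θ₀ r) k ^ 2 = 0 :=
    le_antisymm (by nlinarith) (Finset.sum_nonneg fun k _ => sq_nonneg _)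
  funext k
  have h3 := (Finset.sum_eq_zero_iff_of_nonneg fun k _ => sq_nonneg _).1 h2 k (Finset.mem_univ k)
  have h4 : (θ r - θ₀ r) k = 0 := by simpa using h3
  exact sub_eq_zero.1 h4

end Regression

/-! ### Smoothness on the unit interval -/

theorem abs_derivWithin_sub_le {f : ℝ → ℝ} {L : ℝ} (hf : ContDiffOn ℝ 2 f (Set.Icc 0 1))
    (hL : ∀ τ ∈ Set.Icc (0 : ℝ) 1, |iteratedDerivWithin 2 f (Set.Icc 0 1) τ| ≤ L) {x y : ℝ}
    (hx : x ∈ Set.Icc (0 : ℝ) 1) (hy : y ∈ Set.Icc (0 : ℝ) 1) :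
    |derivWithin f (Set.Icc 0 1) y - derivWithin f (Set.Icc 0 1) x| ≤ L * |y - x| := by
  have hu : UniqueDiffOn ℝ (Set.Icc (0 : ℝ) 1) := uniqueDiffOn_Icc zero_lt_one
  have h1 : ContDiffOn ℝ 1 (derivWithin f (Set.Icc 0 1)) (Set.Icc 0 1) :=
    hf.derivWithin hu (by norm_num)
  have h2 : DifferentiableOn ℝ (derivWithin f (Set.Icc 0 1)) (Set.Icc 0 1) :=
    h1.differentiableOn (by norm_num)
  have h3 : ∀ τ ∈ Set.Icc (0 : ℝ) 1,
      ‖derivWithin (derivWithin f (Set.Icc 0 1)) (Set.Icc 0 1) τ‖ ≤ L := by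
    intro τ hτ
    have := hL τ hτ
    rwa [iteratedDerivWithin_succ, iteratedDerivWithin_one] at this
  exact (convex_Icc (0 : ℝ) 1).norm_image_sub_le_of_norm_derivWithin_le h2 h3 hx hy

theorem abs_sub_taylor_le {f : ℝ → ℝ} {L : ℝ} (hf : ContDiffOn ℝ 2 f (Set.Icc 0 1))
    (hL : ∀ τ ∈ Set.Icc (0 : ℝ) 1, |iteratedDerivWithin 2 f (Set.Icc 0 1) τ| ≤ L) {x y : ℝ}
    (hx : x ∈ Set.Icc (0 : ℝ) 1) (hy : y ∈ Set.Icc (0 : ℝ) 1) :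
    |f y - f x - derivWithin f (Set.Icc 0 1) x * (y - x)| ≤ L * (y - x) ^ 2 := by
  have hL0 : 0 ≤ L := (abs_nonneg _).trans (hL x hx)
  have hd : DifferentiableOn ℝ f (Set.Icc 0 1) := hf.differentiableOn (by norm_num)
  have hsub : Set.uIcc x y ⊆ Set.Icc (0 : ℝ) 1 := (convex_Icc (0 : ℝ) 1).ordConnected.uIcc_subset hx hy
  let g : ℝ → ℝ := fun z => f z - derivWithin f (Set.Icc 0 1) x * z
  have hg : ∀ z ∈ Set.uIcc x y, HasDerivWithinAt g
      (derivWithin f (Set.Icc 0 1) z - derivWithin f (Set.Icc 0 1) x) (Set.uIcc x y) z := by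
    intro z hz
    have h1 := ((hd z (hsub hz)).hasDerivWithinAt.mono hsub)
    have h2 := ((hasDerivWithinAt_id z (Set.uIcc x y)).const_mul (derivWithin f (Set.Icc 0 1) x))
    rw [mul_one] at h2
    exact h1.sub h2
  have hb : ∀ z ∈ Set.uIcc x y,
      ‖derivWithin f (Set.Icc 0 1) z - derivWithin f (Set.Icc 0 1) x‖ ≤ L * |y - x| := by
    intro z hz
    refine (abs_derivWithin_sub_le hf hL hx (hsub hz)).trans ?_
    exact mul_le_mul_of_nonneg_left (Set.abs_sub_left_of_mem_uIcc hz) hL0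
  have h := (convex_uIcc x y).norm_image_sub_le_of_norm_hasDerivWithin_le hg hb
    Set.left_mem_uIcc Set.right_mem_uIcc
  have e : g y - g x = f y - f x - derivWithin f (Set.Icc 0 1) x * (y - x) := by
    simp only [g]; ring
  rw [e, Real.norm_eq_abs, Real.norm_eq_abs, mul_assoc, abs_mul_abs_self] at h
  rw [sq]
  exact h

/-! ### Norms of paths -/

section Paths

variable {n : ℕ}

theorem pathNorm_add_le (n : ℕ) (f g : ℤ → ℝ) :
    pathNorm n (fun t => f t + g t) ≤ pathNorm n f + pathNorm n g := by
  refine Real.sqrt_le_iff.2 ⟨add_nonneg (pathNorm_nonneg n f) (pathNorm_nonneg n g), ?_⟩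
  have h0 : ∀ u : ℤ → ℝ, pathNorm n u ^ 2 = ∑ t ∈ times n, u t ^ 2 := fun u =>
    Real.sq_sqrt (Finset.sum_nonneg fun t _ => sq_nonneg _)
  have h1 := (le_abs_self _).trans (abs_sum_mul_le_pathNorm n f g)
  have e : ∑ t ∈ times n, (f t + g t) ^ 2
      = ∑ t ∈ times n, f t ^ 2 + 2 * ∑ t ∈ times n, f t * g t + ∑ t ∈ times n, g t ^ 2 := by
    rw [Finset.mul_sum, ← Finset.sum_add_distrib, ← Finset.sum_add_distrib]
    exact Finset.sum_congr rfl fun t _ => by ring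
  rw [e, ← h0, ← h0]
  nlinarith

theorem pathNorm_le_of_sub_le {f g : ℤ → ℝ} {E : ℝ} (h : pathNorm n (fun t => f t - g t) ≤ E) :
    pathNorm n f ≤ pathNorm n g + E ∧ pathNorm n g ≤ pathNorm n f + E := by
  have h1 := pathNorm_add_le n g (fun t => f t - g t)
  have h2 := pathNorm_add_le n f (fun t => g t - f t)
  have e : pathNorm n (fun t => g t - f t) = pathNorm n (fun t => f t - g t) := by
    unfold pathNorm
    congr 1
    exact Finset.sum_congr rfl fun t _ => by ring
  simp only [add_sub_cancel] at h1 h2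
  rw [e] at h2
  exact ⟨h1.trans (by linarith), h2.trans (by linarith)⟩

theorem pathDev_le_pathNorm (hn : 1 ≤ n) (f : ℤ → ℝ) : pathDev n f ≤ pathNorm n f := by
  have hn' : (0 : ℝ) < n := by exact_mod_cast hn
  refine Real.sqrt_le_sqrt ?_
  set m := (1 / (n : ℝ)) * ∑ s ∈ times n, f s with hm
  have e : ∑ t ∈ times n, (f t - m) ^ 2
      = ∑ t ∈ times n, f t ^ 2 - 2 * m * ∑ t ∈ times n, f t + n * m ^ 2 := by
    have : (n : ℝ) * m ^ 2 = ∑ _t ∈ times n, m ^ 2 := by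
      rw [Finset.sum_const, card_times, nsmul_eq_mul]
    rw [this, Finset.mul_sum, ← Finset.sum_sub_distrib, ← Finset.sum_add_distrib]
    exact Finset.sum_congr rfl fun t _ => by ring
  have e2 : ∑ t ∈ times n, f t = n * m := by rw [hm]; field_simp
  rw [e, e2]
  nlinarith [mul_nonneg hn'.le (sq_nonneg m)]

theorem pathDev_le_of_sub_le (hn : 1 ≤ n) {f g : ℤ → ℝ} {E : ℝ}
    (h : pathNorm n (fun t => f t - g t) ≤ E) :
    pathDev n f ≤ pathDev n g + E ∧ pathDev n g ≤ pathDev n f + E := by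
  refine pathNorm_le_of_sub_le (le_trans (le_of_eq ?_) ((pathDev_le_pathNorm hn _).trans h))
  unfold pathDev
  congr 1
  funext t
  rw [Finset.sum_sub_distrib]
  ring

theorem pathNorm_le_of_abs_le {f : ℤ → ℝ} {E : ℝ} (hE : 0 ≤ E) (h : ∀ t ∈ times n, |f t| ≤ E) :
    pathNorm n f ≤ √n * E := by
  refine Real.sqrt_le_iff.2 ⟨by positivity, ?_⟩
  rw [mul_pow, Real.sq_sqrt (Nat.cast_nonneg n)]
  have := Finset.sum_le_card_nsmul (times n) (fun t => f t ^ 2) (E ^ 2) fun t ht => by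
    rw [← sq_abs]; exact pow_le_pow_left₀ (abs_nonneg _) (h t ht) 2
  rwa [card_times, nsmul_eq_mul] at this

/-- A smooth function whose derivative vanishes on the grid is almost constant on the grid. -/
theorem pathDev_le_of_deriv_eq_zero (hn : 1 ≤ n) {f : ℝ → ℝ} {L : ℝ}
    (hf : ContDiffOn ℝ 2 f (Set.Icc 0 1))
    (hL : ∀ τ ∈ Set.Icc (0 : ℝ) 1, |iteratedDerivWithin 2 f (Set.Icc 0 1) τ| ≤ L)
    (h0 : ∀ t ∈ times n, derivWithin f (Set.Icc 0 1) (gridPt n t) = 0) :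
    pathDev n (fun t => f (gridPt n t)) ≤ 2 * L := by
  have hn' : (0 : ℝ) < n := by exact_mod_cast hn
  have hL0 : 0 ≤ L := (abs_nonneg _).trans (hL 0 (by simp))
  have hmem : ∀ t ∈ times n, gridPt n t ∈ Set.Icc (0 : ℝ) 1 := fun t ht => by
    have := Finset.mem_Icc.1 ht
    exact ⟨gridPt_nonneg (by omega), gridPt_le_one hn this.2⟩
  -- The derivative vanishes at the left end of each cell, so a step of length 1/n changes f by at
  -- most L/n². Over n cells this is L/n, and the path deviation stays bounded.
  have hchain : ∀ m : ℕ, m < n →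
      |f (gridPt n ((m : ℤ) + 1)) - f (gridPt n 1)| ≤ m * (L / (n : ℝ) ^ 2) := by
    intro m
    induction m with
    | zero => intro _; simp
    | succ m ih =>
      intro hm
      have ih' := ih (by omega)
      have ht : ((m : ℤ) + 1) ∈ times n := Finset.mem_Icc.2 ⟨by omega, by omega⟩
      have ht' : (((m + 1 : ℕ) : ℤ) + 1) ∈ times n := Finset.mem_Icc.2 ⟨by omega, by omega⟩
      have h1 := abs_sub_taylor_le hf hL (hmem _ ht) (hmem _ ht')
      rw [h0 _ ht, zero_mul, sub_zero] at h1
      have e : gridPt n (((m + 1 : ℕ) : ℤ) + 1) - gridPt n ((m : ℤ) + 1) = 1 / n := by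
        unfold gridPt; push_cast; ring
      rw [e] at h1
      have h2 := abs_sub_le (f (gridPt n (((m + 1 : ℕ) : ℤ) + 1))) (f (gridPt n ((m : ℤ) + 1)))
        (f (gridPt n 1))
      have e2 : L * (1 / (n : ℝ)) ^ 2 = L / (n : ℝ) ^ 2 := by ring
      rw [e2] at h1
      push_cast at *
      linarith
  have hall : ∀ t ∈ times n, |f (gridPt n t) - f (gridPt n 1)| ≤ L / n := by
    intro t ht
    obtain ⟨h1, h2⟩ := Finset.mem_Icc.1 ht
    obtain ⟨m, hm⟩ := Int.eq_ofNat_of_zero_le (by omega : 0 ≤ t - 1)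
    have e : t = (m : ℤ) + 1 := by omega
    rw [e]
    refine (hchain m (by omega)).trans ?_
    have hmn : (m : ℝ) ≤ n := by exact_mod_cast (by omega : m ≤ n)
    calc (m : ℝ) * (L / (n : ℝ) ^ 2) ≤ n * (L / (n : ℝ) ^ 2) :=
          mul_le_mul_of_nonneg_right hmn (by positivity)
      _ = L / n := by field_simp
  have hmean : |(1 / (n : ℝ)) * ∑ s ∈ times n, f (gridPt n s) - f (gridPt n 1)| ≤ L / n := by
    have e : (1 / (n : ℝ)) * ∑ s ∈ times n, f (gridPt n s) - f (gridPt n 1)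
        = (1 / (n : ℝ)) * ∑ s ∈ times n, (f (gridPt n s) - f (gridPt n 1)) := by
      rw [Finset.sum_sub_distrib, Finset.sum_const, card_times, nsmul_eq_mul]
      field_simp
    rw [e, abs_mul, abs_of_pos (by positivity)]
    have := (Finset.abs_sum_le_sum_abs (fun s => f (gridPt n s) - f (gridPt n 1)) (times n)).trans
      (Finset.sum_le_card_nsmul _ _ _ hall)
    rw [card_times, nsmul_eq_mul] at this
    calc _ ≤ 1 / (n : ℝ) * (n * (L / n)) := mul_le_mul_of_nonneg_left this (by positivity)
      _ = _ := by field_simp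
  have hdev : pathDev n (fun t => f (gridPt n t)) ≤ √n * (2 * L / n) := by
    refine pathNorm_le_of_abs_le (by positivity) fun t ht => ?_
    have := abs_sub_le (f (gridPt n t)) (f (gridPt n 1))
      ((1 / (n : ℝ)) * ∑ s ∈ times n, f (gridPt n s))
    rw [abs_sub_comm (f (gridPt n 1))] at this
    have := hall t ht
    have e : 2 * L / n = L / n + L / n := by ring
    rw [e]
    linarith
  refine hdev.trans ?_
  have h1 : √(n : ℝ) ≤ n := by
    refine Real.sqrt_le_iff.2 ⟨hn'.le, ?_⟩
    have : (1 : ℝ) ≤ n := by exact_mod_cast hn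
    nlinarith
  calc √(n : ℝ) * (2 * L / n) ≤ n * (2 * L / n) := mul_le_mul_of_nonneg_right h1 (by positivity)
    _ = 2 * L := by field_simp

end Paths

/-! ### Penalty weights and the least eigenvalue of the error covariance. -/

theorem scadDeriv_of_le {lam z : ℝ} (h : z ≤ lam) : scadDeriv lam z = lam := by
  simp [scadDeriv, h, not_lt.2 h]

theorem scadDeriv_of_ge {lam z : ℝ} (hlam : 0 < lam) (h : scadConst * lam ≤ z) :
    scadDeriv lam z = 0 := by
  have h1 : lam < z := by unfold scadConst at h; linarith
  have h2 : max (scadConst * lam - z) 0 = 0 := max_eq_right (by linarith)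
  simp [scadDeriv, not_le.2 h1, h2]

/-- A bound on the column sums of the inverse gives a lower bound on the quadratic form. -/
theorem sum_sq_le_of_inv_colSum {d : ℕ} {Sg : Mat d} (hS : Sg.PosSemidef) (hinv : (Sg⁻¹).PosDef)
    {C : ℝ} (hC : 0 < C) (hcol : ∀ j, ∑ i, |Sg⁻¹ i j| ≤ C) (u : Fin d → ℝ) :
    Sg * Sg⁻¹ = 1 ∧ (Sg⁻¹).transpose = Sg⁻¹ ∧ ∑ i, u i ^ 2 ≤ C * (u ⬝ᵥ Sg.mulVec u) := by
  have hunit : IsUnit Sg.det := by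
    have := hinv.isUnit
    rw [Matrix.isUnit_iff_isUnit_det] at this
    exact (Matrix.isUnit_nonsing_inv_det_iff).1 this
  have h1 : Sg * Sg⁻¹ = 1 := Matrix.mul_nonsing_inv _ hunit
  have h2 : (Sg⁻¹).transpose = Sg⁻¹ := by
    have := hinv.isHermitian
    rwa [Matrix.IsHermitian, Matrix.conjTranspose_eq_transpose_of_trivial] at this
  refine ⟨h1, h2, ?_⟩
  set Om := Sg⁻¹ with hOm
  -- Schur's test in quadratic form, using that Ω is symmetric so that its row sums are bounded as
  -- well.
  have hquad : u ⬝ᵥ Om.mulVec u ≤ C * ∑ i, u i ^ 2 := by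
    have hs : ∀ i j, Om i j = Om j i := fun i j => congrFun (congrFun h2.symm i) j
    have e : u ⬝ᵥ Om.mulVec u = ∑ i, ∑ j, u i * (Om i j * u j) := by
      simp only [dotProduct, Matrix.mulVec, Finset.mul_sum]
    rw [e]
    have hle : ∀ i j, u i * (Om i j * u j) ≤ |Om i j| * u i ^ 2 / 2 + |Om i j| * u j ^ 2 / 2 := by
      intro i j
      have h3 : u i * (Om i j * u j) ≤ |Om i j| * (|u i| * |u j|) := by
        refine (le_abs_self _).trans (le_of_eq ?_)
        rw [abs_mul, abs_mul]; ring
      have h4 : |u i| * |u j| ≤ (u i ^ 2 + u j ^ 2) / 2 := by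
        nlinarith [sq_nonneg (|u i| - |u j|), sq_abs (u i), sq_abs (u j)]
      have := mul_le_mul_of_nonneg_left h4 (abs_nonneg (Om i j))
      linarith
    refine (Finset.sum_le_sum fun i _ => Finset.sum_le_sum fun j _ => hle i j).trans ?_
    simp only [Finset.sum_add_distrib]
    have hA : ∑ i, ∑ j, |Om i j| * u i ^ 2 / 2 ≤ ∑ i, C * u i ^ 2 / 2 := by
      refine Finset.sum_le_sum fun i _ => ?_
      rw [← Finset.sum_div, ← Finset.sum_mul]
      have : ∑ j, |Om i j| ≤ C := by simp_rw [hs i]; exact hcol i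
      nlinarith [sq_nonneg (u i)]
    have hB : ∑ i, ∑ j, |Om i j| * u j ^ 2 / 2 ≤ ∑ j, C * u j ^ 2 / 2 := by
      rw [Finset.sum_comm]
      refine Finset.sum_le_sum fun j _ => ?_
      rw [← Finset.sum_div, ← Finset.sum_mul]
      nlinarith [sq_nonneg (u j), hcol j]
    rw [← Finset.sum_div, ← Finset.mul_sum] at hA hB
    linarith
  -- Positivity of Σ at Cu - Ωu reads C² uᵀΣu - 2C|u|² + uᵀΩu ≥ 0; inserting uᵀΩu ≤ C|u|² gives the
  -- lower bound without spectral theory.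
  have hpsd := hS.dotProduct_mulVec_nonneg (C • u - Om.mulVec u)
  rw [star_trivial] at hpsd
  have h3 : Sg.mulVec (Om.mulVec u) = u := by rw [Matrix.mulVec_mulVec, h1, Matrix.one_mulVec]
  have h4 : Om.mulVec u ⬝ᵥ Sg.mulVec u = u ⬝ᵥ u := by
    have hSsymm : Sg.transpose = Sg := by
      have := hS.isHermitian
      rwa [Matrix.IsHermitian, Matrix.conjTranspose_eq_transpose_of_trivial] at this
    rw [Matrix.dotProduct_mulVec, ← Matrix.mulVec_transpose, hSsymm, h3]
  have h5 : u ⬝ᵥ u = ∑ i, u i ^ 2 := by simp [dotProduct, sq]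
  rw [Matrix.mulVec_sub, Matrix.mulVec_smul, h3, sub_dotProduct, dotProduct_sub, dotProduct_sub,
    smul_dotProduct, smul_dotProduct, dotProduct_smul, dotProduct_smul, h4,
    dotProduct_comm (Om.mulVec u) u, h5] at hpsd
  simp only [smul_eq_mul] at hpsd
  refine le_of_mul_le_mul_left ?_ hC
  nlinarith

/-! ### The local linear regression along a good path -/

/-- The power of the scaled time lag that multiplies a local linear regressor. -/
def degIdx {d : ℕ} : Fin d ⊕ Fin d → ℕ := Sum.elim (fun _ => 0) fun _ => 1

/-- The coordinate of the process in a local linear regressor. -/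
def coordIdx {d : ℕ} : Fin d ⊕ Fin d → Fin d := Sum.elim id id

/-- The local linear regressors at the point `τ`. -/
def locReg {d : ℕ} (n : ℕ) (h τ : ℝ) (x : ℤ → Fin d → ℝ) (t : ℤ) (k : Fin d ⊕ Fin d) : ℝ :=
  ((gridPt n t - τ) / h) ^ degIdx k * x (t - 1) (coordIdx k)

/-- The kernel weights of the local least squares objective. -/
def locW (n : ℕ) (K : ℝ → ℝ) (h τ : ℝ) (t : ℤ) : ℝ :=
  (1 / (n : ℝ)) * scaledKernel K h (gridPt n t - τ)

section

variable {n d : ℕ} {K : ℝ → ℝ} {h b M : ℝ} {A Sig : ℝ → Mat d} {x e : ℤ → Fin d → ℝ}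

theorem degIdx_le (k : Fin d ⊕ Fin d) : degIdx k ≤ 1 := by
  rcases k with j | j <;> simp [degIdx]

theorem locW_eq (n : ℕ) (K : ℝ → ℝ) (h τ : ℝ) (t : ℤ) :
    locW n K h τ t = 1 / (n * h) * K ((gridPt n t - τ) / h) := by
  rw [locW, scaledKernel, div_mul_div_comm, one_mul]
  ring

theorem dot_locReg (θ : Fin d ⊕ Fin d → ℝ) (τ : ℝ) (t : ℤ) :
    θ ⬝ᵥ locReg n h τ x t = ∑ j, (θ (Sum.inl j) + θ (Sum.inr j) * ((gridPt n t - τ) / h))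
      * x (t - 1) j := by
  simp only [dotProduct, Fintype.sum_sum_type, locReg, degIdx, coordIdx, Sum.elim_inl,
    Sum.elim_inr, pow_zero, one_mul, pow_one, id]
  rw [← Finset.sum_add_distrib]
  exact Finset.sum_congr rfl fun j _ => by ring

/-- With the slope rescaled to hβ and the lag to (τ_t - τ)/h, the local objective is an ordinary
weighted least squares problem with regressors of comparable size. -/
theorem locLoss_eq_wrss (hh : 0 < h) (i : Fin d) (α β : Fin d → ℝ) (τ : ℝ) :
    locLoss n K h x i α β τ = wrss (times n) (locW n K h τ) (locReg n h τ x) (fun t => x t i)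
      (Sum.elim α (h • β)) := by
  rw [locLoss, wrss, Finset.mul_sum]
  refine Finset.sum_congr rfl fun t _ => ?_
  have e : (α + (gridPt n t - τ) • β) ⬝ᵥ x (t - 1)
      = Sum.elim α (h • β) ⬝ᵥ locReg n h τ x t := by
    rw [dot_locReg]
    simp only [dotProduct, Pi.add_apply, Pi.smul_apply, smul_eq_mul, Sum.elim_inl, Sum.elim_inr]
    refine Finset.sum_congr rfl fun j _ => ?_
    field_simp
  rw [e, locW]
  ring

theorem sum_mul_dot_mul_dot {σ κ : Type*} [Fintype κ] (T : Finset σ) (w : σ → ℝ)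
    (a c : σ → κ → ℝ) (δ : κ → ℝ) :
    ∑ t ∈ T, w t * ((δ ⬝ᵥ a t) * (δ ⬝ᵥ c t))
      = ∑ k, ∑ l, δ k * δ l * ∑ t ∈ T, w t * (a t k * c t l) := by
  have h1 : ∀ t, w t * ((δ ⬝ᵥ a t) * (δ ⬝ᵥ c t))
      = ∑ k, ∑ l, δ k * δ l * (w t * (a t k * c t l)) := by
    intro t
    rw [dotProduct, dotProduct, Finset.sum_mul_sum, Finset.mul_sum]
    refine Finset.sum_congr rfl fun k _ => ?_
    rw [Finset.mul_sum]
    exact Finset.sum_congr rfl fun l _ => by ring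
  simp only [h1, Finset.mul_sum]
  rw [Finset.sum_comm]
  refine Finset.sum_congr rfl fun k _ => ?_
  rw [Finset.sum_comm]

theorem abs_bilin_le {κ : Type*} [Fintype κ] {m : κ → κ → ℝ} {G : ℝ} (hm : ∀ k l, |m k l| ≤ G)
    (δ : κ → ℝ) : |∑ k, ∑ l, δ k * δ l * m k l| ≤ G * (∑ k, |δ k|) ^ 2 := by
  refine (Finset.abs_sum_le_sum_abs _ _).trans ?_
  rw [sq, Finset.sum_mul_sum, Finset.mul_sum]
  refine Finset.sum_le_sum fun k _ => (Finset.abs_sum_le_sum_abs _ _).trans ?_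
  rw [Finset.mul_sum]
  refine Finset.sum_le_sum fun l _ => ?_
  rw [abs_mul, abs_mul, mul_comm]
  exact mul_le_mul_of_nonneg_right (hm k l) (by positivity)

theorem lag_mem {t : ℤ} (ht : t ∈ times n) : t - 1 ∈ Finset.Icc (0 : ℤ) n := by
  have := Finset.mem_Icc.1 ht
  exact Finset.mem_Icc.2 ⟨by omega, by omega⟩

theorem gridPt_mem_Icc (hn : 1 ≤ n) {t : ℤ} (ht : t ∈ Finset.Icc (0 : ℤ) n) :
    gridPt n t ∈ Set.Icc (0 : ℝ) 1 :=
  ⟨gridPt_nonneg (Finset.mem_Icc.1 ht).1, gridPt_le_one hn (Finset.mem_Icc.1 ht).2⟩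

theorem times_subset {t : ℤ} (ht : t ∈ times n) : t ∈ Finset.Icc (0 : ℤ) n := by
  have := Finset.mem_Icc.1 ht
  exact Finset.mem_Icc.2 ⟨by omega, by omega⟩

/-- Restricted eigenvalue inequality along a good path. -/
theorem GoodPath.gramForm_ge (hg : GoodPath n d K h b M A Sig x e) (hK : IsKernel K) (hn : 1 ≤ n)
    (hh : 0 < h) {c C₂ : ℝ} (hC₂ : 0 < C₂)
    (hdes : ∀ τ ∈ Set.Icc (0 : ℝ) 1, ∀ a b : ℝ, c * (n * h) * (a ^ 2 + b ^ 2) ≤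
        ∑ t ∈ times n, K ((gridPt n t - τ) / h) * (a + b * ((gridPt n t - τ) / h)) ^ 2)
    (hSig : ∀ τ ∈ Set.Icc (0 : ℝ) 1, ∀ u : Fin d → ℝ,
      ∑ i, u i ^ 2 ≤ C₂ * (u ⬝ᵥ (Sig τ).mulVec u))
    {r : ℤ} (hr : r ∈ times n) (δ : Fin d ⊕ Fin d → ℝ) :
    c / C₂ * ∑ k, δ k ^ 2 - 3 * (M * (logMax n d * √(n * h)) / (n * h)) * (∑ k, |δ k|) ^ 2
      ≤ gramForm (times n) (locW n K h (gridPt n r)) (locReg n h (gridPt n r) x) δ := by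
  have hn' : (0 : ℝ) < n := by exact_mod_cast hn
  have hnh : 0 < n * h := mul_pos hn' hh
  set τ := gridPt n r with hτ
  have hτI : τ ∈ Set.Icc (0 : ℝ) 1 := gridPt_mem_Icc hn (times_subset hr)
  set w := locW n K h τ with hw
  set G := M * (logMax n d * √(n * h)) / (n * h) with hG
  -- The part of the process determined by earlier errors. Its square is dropped below, so only the
  -- cross term and the error Gram matrix need to be controlled.
  let y : ℤ → Fin d → ℝ := fun t => x t - e t
  set ze := locReg n h τ e with hze
  set zy := locReg n h τ y with hzy
  have hw0 : ∀ t, 0 ≤ w t := fun t => by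
    rw [hw, locW_eq]; exact mul_nonneg (by positivity) (hK.nonneg _)
  have hsplit : ∀ t, δ ⬝ᵥ locReg n h τ x t = δ ⬝ᵥ zy t + δ ⬝ᵥ ze t := by
    intro t
    rw [hzy, hze, dot_locReg, dot_locReg, dot_locReg, ← Finset.sum_add_distrib]
    refine Finset.sum_congr rfl fun j _ => ?_
    simp only [y, Pi.sub_apply]
    ring
  have hcross : |∑ t ∈ times n, w t * ((δ ⬝ᵥ zy t) * (δ ⬝ᵥ ze t))| ≤ G * (∑ k, |δ k|) ^ 2 := by
    rw [sum_mul_dot_mul_dot]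
    refine abs_bilin_le (fun k l => ?_) δ
    have e1 : ∑ t ∈ times n, w t * (zy t k * ze t l) = 1 / (n * h) *
        ∑ t ∈ times n, kernelPow K (degIdx k + degIdx l) ((gridPt n t - gridPt n r) / h)
          * (x (t - 1) (coordIdx k) - e (t - 1) (coordIdx k)) * e (t - 1) (coordIdx l) := by
      rw [Finset.mul_sum]
      refine Finset.sum_congr rfl fun t _ => ?_
      rw [hw, locW_eq, hzy, hze]
      simp only [locReg, kernelPow, pow_add, y, Pi.sub_apply, ← hτ]
      ring
    rw [e1, abs_mul, abs_of_pos (by positivity), hG, one_div, ← div_eq_inv_mul]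
    refine div_le_div_of_nonneg_right (hg.cross _ ?_ r hr _ _) hnh.le
    have := degIdx_le k
    have := degIdx_le l
    omega
  let Q : ℤ → ℝ := fun t => ∑ k, ∑ l, δ k * δ l * (((gridPt n t - τ) / h) ^ (degIdx k + degIdx l)
    * Sig (gridPt n (t - 1)) (coordIdx k) (coordIdx l))
  have hgram : |∑ t ∈ times n, w t * ((δ ⬝ᵥ ze t) * (δ ⬝ᵥ ze t)) - ∑ t ∈ times n, w t * Q t|
      ≤ G * (∑ k, |δ k|) ^ 2 := by
    have e0 : ∑ t ∈ times n, w t * Q t = ∑ k, ∑ l, δ k * δ l * ∑ t ∈ times n, w t *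
        (((gridPt n t - τ) / h) ^ (degIdx k + degIdx l)
          * Sig (gridPt n (t - 1)) (coordIdx k) (coordIdx l)) := by
      simp only [Q, Finset.mul_sum]
      rw [Finset.sum_comm]
      refine Finset.sum_congr rfl fun k _ => ?_
      rw [Finset.sum_comm]
      exact Finset.sum_congr rfl fun l _ => Finset.sum_congr rfl fun t _ => by ring
    rw [sum_mul_dot_mul_dot, e0]
    simp only [← Finset.sum_sub_distrib, ← mul_sub]
    refine abs_bilin_le (fun k l => ?_) δ
    have e1 : ∑ t ∈ times n, w t * (ze t k * ze t l - ((gridPt n t - τ) / h) ^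
          (degIdx k + degIdx l) * Sig (gridPt n (t - 1)) (coordIdx k) (coordIdx l))
        = 1 / (n * h) *
        ∑ t ∈ times n, kernelPow K (degIdx k + degIdx l) ((gridPt n t - gridPt n r) / h)
          * (e (t - 1) (coordIdx k) * e (t - 1) (coordIdx l)
            - Sig (gridPt n (t - 1)) (coordIdx k) (coordIdx l)) := by
      rw [Finset.mul_sum]
      refine Finset.sum_congr rfl fun t _ => ?_
      rw [hw, locW_eq, hze]
      simp only [locReg, kernelPow, pow_add, ← hτ]
      ring
    rw [e1, abs_mul, abs_of_pos (by positivity), hG, one_div, ← div_eq_inv_mul]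
    refine div_le_div_of_nonneg_right (hg.gram _ ?_ r hr _ _) hnh.le
    have := degIdx_le k
    have := degIdx_le l
    omega
  -- For fixed t the mean form is that of Σ at the vector of local linear values δ₁ + δ₂(τ_t - τ)/h.
  -- After its eigenvalue bound, the coordinates decouple and the scalar design bound applies to
  -- each.
  have hQ : ∀ t ∈ times n, (∑ j, (δ (Sum.inl j) + δ (Sum.inr j) * ((gridPt n t - τ) / h)) ^ 2) / C₂
      ≤ Q t := by
    intro t ht
    rw [div_le_iff₀ hC₂, mul_comm]
    refine (hSig _ (gridPt_mem_Icc hn (lag_mem ht))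
      fun j => δ (Sum.inl j) + δ (Sum.inr j) * ((gridPt n t - τ) / h)).trans (le_of_eq ?_)
    congr 1
    simp only [Q, dotProduct, Matrix.mulVec, Fintype.sum_sum_type, degIdx, coordIdx, Sum.elim_inl,
      Sum.elim_inr, id, Finset.mul_sum]
    rw [← Finset.sum_add_distrib]
    refine Finset.sum_congr rfl fun i _ => ?_
    rw [← Finset.sum_add_distrib, ← Finset.sum_add_distrib, ← Finset.sum_add_distrib]
    exact Finset.sum_congr rfl fun j _ => by ring
  have hmain : c / C₂ * ∑ k, δ k ^ 2 ≤ ∑ t ∈ times n, w t * Q t := by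
    have h1 : ∑ t ∈ times n, w t *
        ((∑ j, (δ (Sum.inl j) + δ (Sum.inr j) * ((gridPt n t - τ) / h)) ^ 2) / C₂)
        ≤ ∑ t ∈ times n, w t * Q t :=
      Finset.sum_le_sum fun t ht => mul_le_mul_of_nonneg_left (hQ t ht) (hw0 t)
    refine le_trans ?_ h1
    have e1 : ∑ t ∈ times n, w t *
        ((∑ j, (δ (Sum.inl j) + δ (Sum.inr j) * ((gridPt n t - τ) / h)) ^ 2) / C₂)
        = 1 / (n * h) / C₂ * ∑ j, ∑ t ∈ times n, K ((gridPt n t - τ) / h)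
          * (δ (Sum.inl j) + δ (Sum.inr j) * ((gridPt n t - τ) / h)) ^ 2 := by
      rw [Finset.sum_comm, Finset.mul_sum]
      refine Finset.sum_congr rfl fun t _ => ?_
      rw [hw, locW_eq, ← Finset.mul_sum]
      ring
    rw [e1]
    have h2 : ∑ j, c * (n * h) * (δ (Sum.inl j) ^ 2 + δ (Sum.inr j) ^ 2)
        ≤ ∑ j, ∑ t ∈ times n, K ((gridPt n t - τ) / h)
          * (δ (Sum.inl j) + δ (Sum.inr j) * ((gridPt n t - τ) / h)) ^ 2 :=
      Finset.sum_le_sum fun j _ => hdes τ hτI _ _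
    have h3 := mul_le_mul_of_nonneg_left h2 (by positivity : 0 ≤ 1 / (n * h) / C₂)
    refine le_trans (le_of_eq ?_) h3
    rw [← Finset.mul_sum, Finset.sum_add_distrib, Fintype.sum_sum_type]
    field_simp
  have hfin : ∑ t ∈ times n, w t * ((δ ⬝ᵥ ze t) * (δ ⬝ᵥ ze t))
      + 2 * ∑ t ∈ times n, w t * ((δ ⬝ᵥ zy t) * (δ ⬝ᵥ ze t))
      ≤ gramForm (times n) w (locReg n h τ x) δ := by
    rw [gramForm, Finset.mul_sum, ← Finset.sum_add_distrib]
    refine Finset.sum_le_sum fun t _ => ?_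
    rw [hsplit]
    nlinarith [mul_nonneg (hw0 t) (sq_nonneg (δ ⬝ᵥ zy t))]
  have h1 := (abs_le.1 hcross).1
  have h2 := (abs_le.1 hgram).1
  linarith

/-- The true coefficients in the local linear model at the point `τ`. -/
def locCoef (h : ℝ) (A : ℝ → Mat d) (i : Fin d) (τ : ℝ) : Fin d ⊕ Fin d → ℝ :=
  Sum.elim (fun j => A τ i j) (h • fun j => entryDeriv A i j τ)

theorem sum_locW_le (hK : IsKernel K) {B : ℝ} (hB : ∀ x, K x ≤ B) (hn : 1 ≤ n) (hh : 0 < h)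
    (hnh : 1 ≤ n * h) (τ : ℝ) : ∑ t ∈ times n, locW n K h τ t ≤ 3 * B := by
  simp only [locW_eq]
  rw [← Finset.mul_sum]
  have h1 := hK.sum_le hB hn hh hnh τ
  have h0 : 0 < n * h := zero_lt_one.trans_le hnh
  rw [one_div, inv_mul_le_iff₀ h0]
  linarith

theorem GoodPath.abs_locReg_mul_le (hg : GoodPath n d K h b M A Sig x e) (hK : IsKernel K)
    (hn : 1 ≤ n) (hh : 0 < h) (τ : ℝ) {t : ℤ} (ht : t ∈ times n) (k : Fin d ⊕ Fin d) :
    |locW n K h τ t * locReg n h τ x t k| ≤ locW n K h τ t * (M * √(logMax n d)) := by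
  have hn' : (0 : ℝ) < n := by exact_mod_cast hn
  have hw0 : 0 ≤ locW n K h τ t := by
    rw [locW_eq]; exact mul_nonneg (by positivity) (hK.nonneg _)
  rw [abs_mul, abs_of_nonneg hw0]
  by_cases hX : |(gridPt n t - τ) / h| ≤ 1
  · refine mul_le_mul_of_nonneg_left ?_ hw0
    rw [locReg, abs_mul, abs_pow]
    exact (mul_le_of_le_one_left (abs_nonneg _) (pow_le_one₀ (abs_nonneg _) hX)).trans
      (hg.abs_x _ (lag_mem ht) _)
  · rw [locW_eq, hK.support _ (not_le.1 hX)]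
    simp

/-- The score of the local linear model at the true coefficients. -/
theorem GoodPath.abs_wscore_le (hg : GoodPath n d K h b M A Sig x e) (hK : IsKernel K) {B : ℝ}
    (hB : ∀ x, K x ≤ B) (hn : 1 ≤ n) (hh : 0 < h) (hnh : 1 ≤ n * h) {L₂ : ℝ} (i : Fin d)
    (hsm : ∀ j, ContDiffOn ℝ 2 (fun τ => A τ i j) (Set.Icc 0 1))
    (hL₂ : ∀ j, ∀ τ ∈ Set.Icc (0 : ℝ) 1,
      |iteratedDerivWithin 2 (fun τ => A τ i j) (Set.Icc 0 1) τ| ≤ L₂)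
    {J : Finset (Fin d)} (hJ : ∀ j, j ∉ J → ∀ t ∈ times n, A (gridPt n t) i j = 0 ∧
      entryDeriv A i j (gridPt n t) = 0) (hM : 0 ≤ M) {r : ℤ} (hr : r ∈ times n)
    (k : Fin d ⊕ Fin d) :
    |wscore (times n) (locW n K h (gridPt n r)) (locReg n h (gridPt n r) x) (fun t => x t i)
        (locCoef h A i (gridPt n r)) k|
      ≤ M * (logMax n d * √(n * h)) / (n * h)
        + 3 * B * (M ^ 2 * logMax n d * (J.card * (L₂ * h ^ 2))) := by
  have hn' : (0 : ℝ) < n := by exact_mod_cast hn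
  have hnh0 : 0 < n * h := mul_pos hn' hh
  have hL0 : 0 ≤ logMax n d := Real.log_natCast_nonneg _
  set τ := gridPt n r with hτ
  have hτI : τ ∈ Set.Icc (0 : ℝ) 1 := gridPt_mem_Icc hn (times_subset hr)
  have hL₂0 : 0 ≤ L₂ := (abs_nonneg _).trans (hL₂ i τ hτI)
  set w := locW n K h τ with hw
  have hw0 : ∀ t, 0 ≤ w t := fun t => by
    rw [hw, locW_eq]; exact mul_nonneg (by positivity) (hK.nonneg _)
  -- Taylor remainder of the coefficients. Coordinates outside J contribute nothing, so inside the
  -- kernel window it costs |J|·h² times the size of the path.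
  let R : ℤ → ℝ := fun t => ∑ j, (A (gridPt n t) i j - A τ i j
    - entryDeriv A i j τ * (gridPt n t - τ)) * x (t - 1) j
  have hres : ∀ t ∈ times n, x t i - locCoef h A i τ ⬝ᵥ locReg n h τ x t = e t i + R t := by
    intro t ht
    have h1 := congrFun (hg.autoreg t ht) i
    rw [h1, dot_locReg, Pi.add_apply]
    simp only [Matrix.mulVec, dotProduct, locCoef, Sum.elim_inl, Sum.elim_inr, Pi.smul_apply,
      smul_eq_mul, R]
    have h2 : ∑ j, (A (gridPt n t) i j - A τ i j - entryDeriv A i j τ * (gridPt n t - τ))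
        * x (t - 1) j = ∑ j, A (gridPt n t) i j * x (t - 1) j
        - ∑ j, (A τ i j + h * entryDeriv A i j τ * ((gridPt n t - τ) / h)) * x (t - 1) j := by
      rw [← Finset.sum_sub_distrib]
      refine Finset.sum_congr rfl fun j _ => ?_
      field_simp
      ring
    rw [h2]
    ring
  have hR : ∀ t ∈ times n, |(gridPt n t - τ) / h| ≤ 1 →
      |R t| ≤ J.card * (L₂ * h ^ 2) * (M * √(logMax n d)) := by
    intro t ht hX
    have hsq : (gridPt n t - τ) ^ 2 ≤ h ^ 2 := by
      rw [abs_div, abs_of_pos hh, div_le_one hh] at hX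
      rw [← sq_abs]
      exact pow_le_pow_left₀ (abs_nonneg _) hX 2
    have e1 : R t = ∑ j ∈ J, (A (gridPt n t) i j - A τ i j
        - entryDeriv A i j τ * (gridPt n t - τ)) * x (t - 1) j := by
      refine (Finset.sum_subset (Finset.subset_univ J) fun j _ hj => ?_).symm
      rw [(hJ j hj t ht).1, (hJ j hj r hr).1, (hJ j hj r hr).2]
      ring
    rw [e1]
    refine (Finset.abs_sum_le_sum_abs _ _).trans ?_
    refine (Finset.sum_le_card_nsmul J _ ((L₂ * h ^ 2) * (M * √(logMax n d)))
      fun j _ => ?_).trans (le_of_eq (by rw [nsmul_eq_mul]; ring))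
    rw [abs_mul]
    refine mul_le_mul ?_ (hg.abs_x _ (lag_mem ht) j) (abs_nonneg _) (by positivity)
    exact (abs_sub_taylor_le (hsm j) (hL₂ j) hτI (gridPt_mem_Icc hn (times_subset ht))).trans
      (mul_le_mul_of_nonneg_left hsq hL₂0)
  have e2 : wscore (times n) w (locReg n h τ x) (fun t => x t i) (locCoef h A i τ) k
      = 1 / (n * h) * ∑ t ∈ times n, kernelPow K (degIdx k) ((gridPt n t - τ) / h)
          * x (t - 1) (coordIdx k) * e t i
        + ∑ t ∈ times n, w t * locReg n h τ x t k * R t := by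
    rw [wscore, Finset.mul_sum, ← Finset.sum_add_distrib]
    refine Finset.sum_congr rfl fun t ht => ?_
    rw [hres t ht, hw, locW_eq, locReg, kernelPow]
    ring
  rw [e2]
  refine (abs_add_le _ _).trans (add_le_add ?_ ?_)
  · rw [abs_mul, abs_of_pos (by positivity), one_div, ← div_eq_inv_mul]
    exact div_le_div_of_nonneg_right (hg.score _ (degIdx_le k) r hr _ _) hnh0.le
  · refine (Finset.abs_sum_le_sum_abs _ _).trans ?_
    have h3 : ∀ t ∈ times n, |w t * locReg n h τ x t k * R t|
        ≤ w t * (M ^ 2 * logMax n d * (J.card * (L₂ * h ^ 2))) := by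
      intro t ht
      rw [abs_mul]
      by_cases hX : |(gridPt n t - τ) / h| ≤ 1
      · have h4 := mul_le_mul (hg.abs_locReg_mul_le hK hn hh τ ht k) (hR t ht hX) (abs_nonneg _)
          (mul_nonneg (hw0 t) (by positivity))
        refine h4.trans (le_of_eq ?_)
        have : √(logMax n d) * √(logMax n d) = logMax n d := Real.mul_self_sqrt hL0
        linear_combination (w t * M ^ 2 * (J.card * (L₂ * h ^ 2))) * this
      · have : w t = 0 := by rw [hw, locW_eq, hK.support _ (not_le.1 hX), mul_zero]
        rw [this]; simp
    refine (Finset.sum_le_sum h3).trans ?_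
    rw [← Finset.sum_mul]
    exact mul_le_mul_of_nonneg_right (sum_locW_le hK hB hn hh hnh τ) (by positivity)

/-- A crude bound by the supremum of the path. The logarithm it costs is matched by the factor log(n
∨ d) in the lower bound imposed on λ₂. -/
theorem GoodPath.abs_sum_locReg_mul_le (hg : GoodPath n d K h b M A Sig x e) (hK : IsKernel K)
    {B : ℝ} (hB : ∀ x, K x ≤ B) (hn : 1 ≤ n) (hh : 0 < h) (hnh : 1 ≤ n * h) (hM : 0 ≤ M) (τ : ℝ)
    (k l : Fin d ⊕ Fin d) :
    |∑ t ∈ times n, locW n K h τ t * locReg n h τ x t k * locReg n h τ x t l|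
      ≤ 3 * B * (M ^ 2 * logMax n d) := by
  have hn' : (0 : ℝ) < n := by exact_mod_cast hn
  have hL0 : 0 ≤ logMax n d := Real.log_natCast_nonneg _
  refine (Finset.abs_sum_le_sum_abs _ _).trans ?_
  have h3 : ∀ t ∈ times n, |locW n K h τ t * locReg n h τ x t k * locReg n h τ x t l|
      ≤ locW n K h τ t * (M ^ 2 * logMax n d) := by
    intro t ht
    have hw0 : 0 ≤ locW n K h τ t := by
      rw [locW_eq]; exact mul_nonneg (by positivity) (hK.nonneg _)
    rw [abs_mul]
    by_cases hX : |(gridPt n t - τ) / h| ≤ 1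
    · have h5 : |locReg n h τ x t l| ≤ M * √(logMax n d) := by
        rw [locReg, abs_mul, abs_pow]
        exact (mul_le_of_le_one_left (abs_nonneg _) (pow_le_one₀ (abs_nonneg _) hX)).trans
          (hg.abs_x _ (lag_mem ht) _)
      have h4 := mul_le_mul (hg.abs_locReg_mul_le hK hn hh τ ht k) h5 (abs_nonneg _)
        (mul_nonneg hw0 (by positivity))
      refine h4.trans (le_of_eq ?_)
      have : √(logMax n d) * √(logMax n d) = logMax n d := Real.mul_self_sqrt hL0
      linear_combination (locW n K h τ t * M ^ 2) * this
    · have : locW n K h τ t = 0 := by rw [locW_eq, hK.support _ (not_le.1 hX), mul_zero]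
      rw [this]; simp
  refine (Finset.sum_le_sum h3).trans ?_
  rw [← Finset.sum_mul]
  exact mul_le_mul_of_nonneg_right (sum_locW_le hK hB hn hh hnh τ) (by positivity)

end

/-! ### Error of the estimated transition coefficients -/

section

variable {n d : ℕ} {K : ℝ → ℝ} {h b M : ℝ} {A Sig : ℝ → Mat d} {x e : ℤ → Fin d → ℝ}

/-- A coefficient that vanishes at all grid points has zero deviation there, against the minimal
signal. Hence values and slopes together involve at most 2s active coordinates. -/
theorem suppDerivAll_subset_suppAll {i : Fin d} {lam : ℝ} (hlam : 0 < lam)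
    (hsig : ∀ j ∈ suppDerivAll n A i, lam ≤ pathDev n fun t => A (gridPt n t) i j) :
    suppDerivAll n A i ⊆ suppAll n A i := by
  intro j hj
  have h1 := hsig j hj
  by_contra hcon
  have h2 : ∀ t ∈ times n, A (gridPt n t) i j = 0 := by
    intro t ht
    by_contra hne
    exact hcon (Set.mem_iUnion₂.2 ⟨t, ht, hne⟩)
  have h3 : pathDev n (fun t => A (gridPt n t) i j) = 0 := by
    refine pathNorm_eq_zero_iff.2 fun t ht => ?_
    have h4 : ∑ r ∈ times n, A (gridPt n r) i j = 0 := Finset.sum_eq_zero h2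
    change A (gridPt n t) i j - 1 / (n : ℝ) * ∑ r ∈ times n, A (gridPt n r) i j = 0
    rw [h2 t ht, h4]
    simp
  linarith

theorem lassoLoss_eq (hh : 0 < h) (lam : ℝ) (i : Fin d) (α β : Fin d → ℝ) (τ : ℝ) :
    lassoLoss n K h lam x i α β τ
      = wrss (times n) (locW n K h τ) (locReg n h τ x) (fun t => x t i) (Sum.elim α (h • β))
        + lam * ∑ k, |Sum.elim α (h • β) k| := by
  rw [lassoLoss, locLoss_eq_wrss hh, Fintype.sum_sum_type]
  simp only [Sum.elim_inl, Sum.elim_inr, Pi.smul_apply, smul_eq_mul, abs_mul, abs_of_pos hh,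
    Finset.mul_sum]

theorem groupLoss_eq (hh : 0 < h) (lam : ℝ) (i : Fin d) (a α β : ℤ → Fin d → ℝ) :
    groupLoss n K h lam x i a α β
      = ∑ r ∈ times n, wrss (times n) (locW n K h (gridPt n r)) (locReg n h (gridPt n r) x)
          (fun t => x t i) (Sum.elim (α r) (h • β r))
        + ∑ k, Sum.elim (fun j => scadDeriv lam (pathNorm n fun t => a t j))
            (fun j => scadDeriv lam (pathDev n fun t => a t j)) k
          * pathNorm n (fun r => (Sum.elim (α r) (h • β r) : Fin d ⊕ Fin d → ℝ) k) := by
  simp only [groupLoss, locLoss_eq_wrss hh, Fintype.sum_sum_type, Sum.elim_inl, Sum.elim_inr,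
    Pi.smul_apply, smul_eq_mul, add_assoc]

/-- Bound for the error of the estimated transition coefficients along a good path. -/
theorem GoodPath.coef_error (hg : GoodPath n d K h b M A Sig x e) (hK : IsKernel K) {B : ℝ}
    (hB : ∀ x, K x ≤ B) (hn : 1 ≤ n) (hh : 0 < h) (hnh : 1 ≤ n * h) (hM : 0 ≤ M) {c C₂ : ℝ}
    (hc : 0 < c) (hC₂ : 0 < C₂)
    (hdes : ∀ τ ∈ Set.Icc (0 : ℝ) 1, ∀ a b : ℝ, c * (n * h) * (a ^ 2 + b ^ 2) ≤
        ∑ t ∈ times n, K ((gridPt n t - τ) / h) * (a + b * ((gridPt n t - τ) / h)) ^ 2)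
    (hSig : ∀ τ ∈ Set.Icc (0 : ℝ) 1, ∀ u : Fin d → ℝ,
      ∑ i, u i ^ 2 ≤ C₂ * (u ⬝ᵥ (Sig τ).mulVec u)) {L₂ : ℝ}
    (hsm : ∀ i j, ContDiffOn ℝ 2 (fun τ => A τ i j) (Set.Icc 0 1))
    (hL₂ : ∀ i j, ∀ τ ∈ Set.Icc (0 : ℝ) 1,
      |iteratedDerivWithin 2 (fun τ => A τ i j) (Set.Icc 0 1) τ| ≤ L₂)
    {lam1 lam2 : ℝ} (hlam1 : 0 < lam1) (hlam2 : 0 < lam2)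
    {a₀ b₀ a₁ b₁ : Fin d → ℤ → Fin d → ℝ} (hlasso : IsLasso n K h lam1 x a₀ b₀)
    (hgroup : IsGroupLasso n K h lam2 x a₀ a₁ b₁)
    (hsig : ∀ i, ∀ j ∈ suppAll n A i,
      (scadConst + 1) * lam2 ≤ pathNorm n fun t => A (gridPt n t) i j)
    (hsigd : ∀ i, ∀ j ∈ suppDerivAll n A i,
      (scadConst + 1) * lam2 ≤ pathDev n fun t => A (gridPt n t) i j)
    {c' Dv g G : ℝ} (hc' : c' = c / C₂) (hDv : Dv = 3 * (M * (logMax n d * √(n * h)) / (n * h)))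
    (hgdef : M * (logMax n d * √(n * h)) / (n * h)
        + 3 * B * (M ^ 2 * logMax n d * (sparsity n A * (L₂ * h ^ 2))) ≤ g)
    (hG : G = 3 * B * (M ^ 2 * logMax n d))
    (h1 : 16 * (Dv * (2 * sparsity n A)) ≤ c' / 2) (h2 : g ≤ lam1 / 4)
    (h3 : √n * √(9 * lam1 ^ 2 * (2 * sparsity n A) / c' ^ 2) ≤ lam2 / 2) (h4 : 2 * L₂ ≤ lam2 / 2)
    (h5 : 2 * (√n * (g + G * (2 * sparsity n A * g / (c' / 2)))) < lam2) (i : Fin d) {r : ℤ}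
    (hr : r ∈ times n) :
    ∑ j, |A (gridPt n r) i j - a₁ i r j| ≤ 2 * sparsity n A * g / (c' / 2) := by
  classical
  have hn' : (0 : ℝ) < n := by exact_mod_cast hn
  have hnh0 : 0 < n * h := mul_pos hn' hh
  have hL0 : 0 ≤ logMax n d := Real.log_natCast_nonneg _
  have hB0 : 0 ≤ B := (hK.nonneg 0).trans (hB 0)
  have hc'0 : 0 < c' := by rw [hc']; positivity
  have hDv0 : 0 ≤ Dv := by rw [hDv]; positivity
  have hL₂0 : 0 ≤ L₂ := (abs_nonneg _).trans (hL₂ i i 0 (by simp))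
  set s := sparsity n A with hs
  let J : Finset (Fin d) := (suppAll n A i).toFinset
  let J' : Finset (Fin d) := (suppDerivAll n A i).toFinset
  have hJs : J.card ≤ s := by
    rw [← Set.ncard_eq_toFinset_card', hs]
    exact Finset.le_sup (f := fun i => (suppAll n A i).ncard) (Finset.mem_univ i)
  have hscad : 0 < scadConst + 1 := by unfold scadConst; norm_num
  have hJJ' : J' ⊆ J := by
    intro j hj
    rw [Set.mem_toFinset] at hj ⊢
    exact suppDerivAll_subset_suppAll (mul_pos hscad hlam2) (hsigd i) hj
  have hJ0 : ∀ j, j ∉ J → ∀ t ∈ times n, A (gridPt n t) i j = 0 := by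
    intro j hj t ht
    by_contra hne
    exact hj (Set.mem_toFinset.2 (Set.mem_iUnion₂.2 ⟨t, ht, hne⟩))
  have hJ0' : ∀ j, j ∉ J' → ∀ t ∈ times n, entryDeriv A i j (gridPt n t) = 0 := by
    intro j hj t ht
    by_contra hne
    exact hj (Set.mem_toFinset.2 (Set.mem_iUnion₂.2 ⟨t, ht, hne⟩))
  let S : Finset (Fin d ⊕ Fin d) := J.disjSum J'
  have hScard : (S.card : ℝ) ≤ 2 * s := by
    have h6 : S.card ≤ 2 * s := by
      have := Finset.card_le_card hJJ'
      rw [Finset.card_disjSum]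
      omega
    exact_mod_cast h6
  set w := fun r : ℤ => locW n K h (gridPt n r) with hw
  set z := fun r : ℤ => locReg n h (gridPt n r) x with hz
  set y := fun t : ℤ => x t i with hy
  have hw0 : ∀ r, ∀ t ∈ times n, 0 ≤ w r t := fun r t _ => by
    simp only [hw, locW_eq]; exact mul_nonneg (by positivity) (hK.nonneg _)
  have hRE : ∀ r ∈ times n, ∀ δ : Fin d ⊕ Fin d → ℝ,
      c' * ∑ k, δ k ^ 2 - Dv * (∑ k, |δ k|) ^ 2 ≤ gramForm (times n) (w r) (z r) δ := by
    intro r hr δ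
    rw [hc', hDv]
    exact hg.gramForm_ge hK hn hh hC₂ hdes hSig hr δ
  have hDvs : 0 ≤ Dv * (2 * s) := by positivity
  have hpos : ∀ r ∈ times n, ∀ δ : Fin d ⊕ Fin d → ℝ, (∀ k, k ∉ S → δ k = 0) →
      c' / 2 * ∑ k, δ k ^ 2 ≤ gramForm (times n) (w r) (z r) δ := fun r hr δ hδ =>
    gramForm_ge_of_support hDv0 (hRE r hr) hScard (by linarith) hδ
  have hsupp : ∀ r ∈ times n, ∀ k, k ∉ S → locCoef h A i (gridPt n r) k = 0 := by
    intro r hr k hk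
    rcases k with j | j
    · simp only [locCoef, Sum.elim_inl]
      exact hJ0 j (fun hj => hk (Finset.inl_mem_disjSum.2 hj)) r hr
    · simp only [locCoef, Sum.elim_inr, Pi.smul_apply, smul_eq_mul]
      rw [hJ0' j (fun hj => hk (Finset.inr_mem_disjSum.2 hj)) r hr, mul_zero]
  have hscore : ∀ r ∈ times n, ∀ k,
      |wscore (times n) (w r) (z r) y (locCoef h A i (gridPt n r)) k| ≤ g := by
    intro r hr k
    refine (hg.abs_wscore_le hK hB hn hh hnh i (hsm i) (hL₂ i) (J := J)
      (fun j hj t ht => ⟨hJ0 j hj t ht, hJ0' j (fun hj' => hj (hJJ' hj')) t ht⟩) hM hr k).trans ?_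
    refine le_trans ?_ hgdef
    have : (J.card : ℝ) ≤ s := by exact_mod_cast hJs
    gcongr
  have hg0 : 0 ≤ g := (abs_nonneg _).trans (hscore r hr (Sum.inl i))
  -- preliminary estimates
  have hpre : ∀ r ∈ times n, ∀ j,
      |a₀ i r j - A (gridPt n r) i j| ≤ √(9 * lam1 ^ 2 * (2 * s) / c' ^ 2) := by
    intro r hr j
    have hmin := hlasso i r hr (fun j => A (gridPt n r) i j)
      (fun j => entryDeriv A i j (gridPt n r))
    rw [lassoLoss_eq hh, lassoLoss_eq hh] at hmin
    have herr := lasso_error hc'0 hDv0 hlam1 (hw0 r) (hRE r hr) hScard h1 (hsupp r hr)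
      (fun k => (hscore r hr k).trans h2) hmin
    refine Real.abs_le_sqrt (le_trans ?_ herr)
    have := Finset.single_le_sum (f := fun k => (Sum.elim (a₀ i r) (h • b₀ i r)
      - locCoef h A i (gridPt n r)) k ^ 2) (fun k _ => sq_nonneg _) (Finset.mem_univ (Sum.inl j))
    simpa [locCoef] using this
  have hprePath : ∀ j, pathNorm n (fun t => a₀ i t j - A (gridPt n t) i j) ≤ lam2 / 2 := fun j =>
    (pathNorm_le_of_abs_le (Real.sqrt_nonneg _) fun t ht => hpre t ht j).trans h3
  -- restricted least squares
  have hex : ∀ r, ∃ θ₀ : Fin d ⊕ Fin d → ℝ, r ∈ times n → (∀ k, k ∉ S → θ₀ k = 0) ∧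
      ∀ k ∈ S, wscore (times n) (w r) (z r) y θ₀ k = 0 := by
    intro r
    by_cases hr : r ∈ times n
    · obtain ⟨θ₀, h6⟩ := exists_wscore_eq_zero (y := y) (half_pos hc'0) (hpos r hr) (hsupp r hr)
      exact ⟨θ₀, fun _ => h6⟩
    · exact ⟨0, fun h => absurd h hr⟩
  choose θ₀ hθ₀ using hex
  have herr₀ : ∀ r ∈ times n, ∑ k, |(θ₀ r - locCoef h A i (gridPt n r)) k|
      ≤ 2 * s * g / (c' / 2) := fun r hr =>
    restricted_error (half_pos hc'0) hg0 hScard (hpos r hr) (hsupp r hr) (hθ₀ r hr).1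
      (hθ₀ r hr).2 (hscore r hr)
  have hG0 : 0 ≤ G := by rw [hG]; positivity
  have hscore₀ : ∀ k, pathNorm n (fun r => wscore (times n) (w r) (z r) y (θ₀ r) k)
      ≤ √n * (g + G * (2 * s * g / (c' / 2))) := by
    intro k
    refine pathNorm_le_of_abs_le (by positivity) fun r hr => ?_
    have h6 := TVNet.abs_wscore_le (θ₀ := θ₀ r) (hscore r hr) (G := G) (fun k l => by
      rw [hG]; exact hg.abs_sum_locReg_mul_le hK hB hn hh hnh hM _ k l) k
    have h7 := mul_le_mul_of_nonneg_left (herr₀ r hr) hG0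
    linarith
  -- the weighted group LASSO
  set pen : Fin d ⊕ Fin d → ℝ := Sum.elim (fun j => scadDeriv lam2 (pathNorm n fun t => a₀ i t j))
    (fun j => scadDeriv lam2 (pathDev n fun t => a₀ i t j)) with hpendef
  -- A signal of (a₀ + 1)λ₂ minus an estimation error of λ₂/2 stays above a₀λ₂, where the SCAD
  -- derivative vanishes.
  have hpen0 : ∀ k ∈ S, pen k = 0 := by
    intro k hk
    rcases k with j | j
    · have hj : j ∈ suppAll n A i := Set.mem_toFinset.1 (Finset.inl_mem_disjSum.1 hk)
      have h6 := (pathNorm_le_of_sub_le (hprePath j)).2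
      have h7 := hsig i j hj
      simp only [hpendef, Sum.elim_inl]
      exact scadDeriv_of_ge hlam2 (by linarith)
    · have hj : j ∈ suppDerivAll n A i := Set.mem_toFinset.1 (Finset.inr_mem_disjSum.1 hk)
      have h6 := (pathDev_le_of_sub_le hn (hprePath j)).2
      have h7 := hsigd i j hj
      simp only [hpendef, Sum.elim_inr]
      exact scadDeriv_of_ge hlam2 (by linarith)
  -- Off the support the weights equal λ₂. An inactive slope still allows a path deviation of up to
  -- 2L₂ ≤ λ₂/2, which together with the LASSO error λ₂/2 just reaches the flat part of the SCAD
  -- derivative.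
  have hpen : ∀ k, k ∉ S →
      2 * pathNorm n (fun r => wscore (times n) (w r) (z r) y (θ₀ r) k) < pen k := by
    intro k hk
    have h8 : pen k = lam2 := by
      rcases k with j | j
      · have hj := hJ0 j (fun hj => hk (Finset.inl_mem_disjSum.2 hj))
        have h6 := (pathNorm_le_of_sub_le (hprePath j)).1
        rw [pathNorm_eq_zero_iff.2 hj] at h6
        simp only [hpendef, Sum.elim_inl]
        exact scadDeriv_of_le (by linarith)
      · have hj := hJ0' j (fun hj => hk (Finset.inr_mem_disjSum.2 hj))
        have h6 := (pathDev_le_of_sub_le hn (hprePath j)).1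
        have h7 := pathDev_le_of_deriv_eq_zero hn (hsm i j) (hL₂ i j) hj
        simp only [hpendef, Sum.elim_inr]
        exact scadDeriv_of_le (by linarith)
    rw [h8]
    have := hscore₀ k
    linarith
  have hmin := hgroup i (fun r j => θ₀ r (Sum.inl j)) (fun r j => h⁻¹ * θ₀ r (Sum.inr j))
  rw [groupLoss_eq hh, groupLoss_eq hh, ← hpendef] at hmin
  have hθeq : ∀ r, (Sum.elim (fun j => θ₀ r (Sum.inl j)) (h • fun j => h⁻¹ * θ₀ r (Sum.inr j))
      : Fin d ⊕ Fin d → ℝ) = θ₀ r := by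
    intro r
    funext k
    rcases k with j | j
    · rfl
    · simp [mul_inv_cancel_left₀ hh.ne']
  simp only [hθeq] at hmin
  have heq := group_lasso_eq hw0 (half_pos hc'0) hpos (fun r hr => (hθ₀ r hr).1)
    (fun r hr => (hθ₀ r hr).2) hpen0 hpen hmin r hr
  refine le_trans ?_ (herr₀ r hr)
  rw [Fintype.sum_sum_type]
  refine le_trans (le_of_eq (Finset.sum_congr rfl fun j _ => ?_))
    (le_add_of_nonneg_right (Finset.sum_nonneg fun k _ => abs_nonneg _))
  rw [← heq, abs_sub_comm]
  rfl

end

/-! ### Error of the estimated error covariance -/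

section

variable {n d : ℕ} {K : ℝ → ℝ} {h b M : ℝ} {A Sig : ℝ → Mat d} {x e : ℤ → Fin d → ℝ}

theorem IsKernel.abs_kernelMoment_le (hK : IsKernel K) {B : ℝ} (hB : ∀ x, K x ≤ B) (hn : 1 ≤ n)
    (hb : 0 < b) (hnb : 1 ≤ n * b) (p : ℕ) (τ : ℝ) :
    |kernelMoment n K b p τ| ≤ 3 * B * (n * b) :=
  (Finset.abs_sum_le_sum_abs _ _).trans (hK.sum_abs_kernelPow_le hB hn hb hnb p τ)

theorem IsKernel.abs_locWeight_le (hK : IsKernel K) {B : ℝ} (hB : ∀ x, K x ≤ B) (hn : 1 ≤ n)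
    (hb : 0 < b) (hnb : 1 ≤ n * b) (t : ℤ) (τ : ℝ) :
    |locWeight n K b t τ| ≤ 6 * B * (n * b) * K ((gridPt n t - τ) / b) := by
  have h1 := hK.abs_kernelMoment_le hB hn hb hnb 1 τ
  have h2 := hK.abs_kernelMoment_le hB hn hb hnb 2 τ
  have h3 := (hK.abs_kernelPow_le hB 1 ((gridPt n t - τ) / b)).1
  rw [kernelPow, pow_one] at h3
  have h0 := hK.nonneg ((gridPt n t - τ) / b)
  unfold locWeight
  refine (abs_sub _ _).trans ?_
  rw [abs_mul, abs_mul _ (kernelMoment n K b 1 τ), abs_of_nonneg h0]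
  have h4 := mul_le_mul_of_nonneg_left h2 h0
  have h5 := mul_le_mul h3 h1 (abs_nonneg _) h0
  linarith

/-- The local linear weights combine the kernel powers 0 and 1 with moments of order nb, so
deviations of these two kernel sums suffice. -/
theorem IsKernel.abs_sum_locWeight_mul_le (hK : IsKernel K) {B : ℝ} (hB : ∀ x, K x ≤ B)
    (hn : 1 ≤ n) (hb : 0 < b) (hnb : 1 ≤ n * b) {τ E : ℝ} {y : ℤ → ℝ}
    (hy : ∀ p ≤ 1, |∑ t ∈ times n, kernelPow K p ((gridPt n t - τ) / b) * y t| ≤ E) :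
    |∑ t ∈ times n, locWeight n K b t τ * y t| ≤ 6 * B * (n * b) * E := by
  have h1 := hK.abs_kernelMoment_le hB hn hb hnb 1 τ
  have h2 := hK.abs_kernelMoment_le hB hn hb hnb 2 τ
  have e : ∑ t ∈ times n, locWeight n K b t τ * y t
      = kernelMoment n K b 2 τ * ∑ t ∈ times n, kernelPow K 0 ((gridPt n t - τ) / b) * y t
        - kernelMoment n K b 1 τ * ∑ t ∈ times n, kernelPow K 1 ((gridPt n t - τ) / b) * y t := by
    rw [Finset.mul_sum, Finset.mul_sum, ← Finset.sum_sub_distrib]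
    refine Finset.sum_congr rfl fun t _ => ?_
    simp only [locWeight, kernelPow, pow_zero, pow_one]
    ring
  rw [e]
  refine (abs_sub _ _).trans ?_
  rw [abs_mul, abs_mul]
  have hE := (abs_nonneg _).trans h1
  have h4 := mul_le_mul h2 (hy 0 (by norm_num)) (abs_nonneg _) hE
  have h5 := mul_le_mul h1 (hy 1 le_rfl) (abs_nonneg _) hE
  linarith

theorem GoodPath.abs_residual_sub_le (hg : GoodPath n d K h b M A Sig x e) (hM : 0 ≤ M)
    {α : Fin d → ℤ → Fin d → ℝ} {E : ℝ} {i : Fin d} {t : ℤ} (ht : t ∈ times n)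
    (hα : ∑ j, |A (gridPt n t) i j - α i t j| ≤ E) :
    |residual x α t i - e t i| ≤ E * (M * √(logMax n d)) := by
  have h1 : residual x α t i - e t i
      = ∑ j, (A (gridPt n t) i j - α i t j) * x (t - 1) j := by
    have := congrFun (hg.autoreg t ht) i
    simp only [residual, this, Pi.add_apply, Matrix.mulVec, dotProduct, sub_mul,
      Finset.sum_sub_distrib]
    ring
  rw [h1]
  refine (Finset.abs_sum_le_sum_abs _ _).trans ?_
  calc ∑ j, |(A (gridPt n t) i j - α i t j) * x (t - 1) j|
      ≤ ∑ j, |A (gridPt n t) i j - α i t j| * (M * √(logMax n d)) :=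
        Finset.sum_le_sum fun j _ => by
          rw [abs_mul]
          exact mul_le_mul_of_nonneg_left (hg.abs_x _ (lag_mem ht) j) (abs_nonneg _)
    _ ≤ E * (M * √(logMax n d)) := by
        rw [← Finset.sum_mul]
        exact mul_le_mul_of_nonneg_right hα (by positivity)

/-- The cross terms are bounded through squares of the errors, whose local averages stay bounded;
using their supremum instead would cost another root of the logarithm. -/
theorem abs_mul_sub_mul_le {u v a b η : ℝ} (hη : 0 ≤ η) (hu : |u - a| ≤ η) (hv : |v - b| ≤ η) :
    |u * v - a * b| ≤ η * (1 + (a ^ 2 + b ^ 2) / 2) + η ^ 2 := by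
  have e : u * v - a * b = (u - a) * (v - b) + (u - a) * b + a * (v - b) := by ring
  have h1 : |(u - a) * (v - b)| ≤ η ^ 2 := by
    rw [abs_mul, sq]; exact mul_le_mul hu hv (abs_nonneg _) hη
  have h2 : |(u - a) * b| ≤ η * |b| := by
    rw [abs_mul]; exact mul_le_mul_of_nonneg_right hu (abs_nonneg _)
  have h3 : |a * (v - b)| ≤ η * |a| := by
    rw [abs_mul, mul_comm]; exact mul_le_mul_of_nonneg_right hv (abs_nonneg _)
  have h4 : |a| + |b| ≤ 1 + (a ^ 2 + b ^ 2) / 2 := by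
    nlinarith [sq_nonneg (|a| - 1), sq_nonneg (|b| - 1), sq_abs a, sq_abs b]
  have h5 := mul_le_mul_of_nonneg_left h4 hη
  rw [e]
  refine (abs_add_le _ _).trans ?_
  have h6 := abs_add_le ((u - a) * (v - b)) ((u - a) * b)
  linarith

/-- The diagonal of the covariance deviation at kernel power 0, plus the bounded mean; log(n ∨ d) ≤
nb makes the deviation at most of order nb. -/
theorem GoodPath.sum_mul_sq_le (hg : GoodPath n d K h b M A Sig x e) (hK : IsKernel K) {B : ℝ}
    (hB : ∀ x, K x ≤ B) (hn : 1 ≤ n) (hb : 0 < b) (hnb : 1 ≤ n * b)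
    (hLb : logMax n d ≤ n * b) (hM : 0 ≤ M) {D : ℝ}
    (hD : ∀ τ ≤ (1 : ℝ), ∀ i j, |Sig τ i j| ≤ D) {τ : ℝ} (hτ : τ ∈ Set.Icc (0 : ℝ) 1)
    (i : Fin d) :
    ∑ t ∈ times n, K ((gridPt n t - τ) / b) * e t i ^ 2 ≤ (M + 3 * B * D) * (n * b) := by
  have h1 := (le_abs_self _).trans (hg.cov 0 (by norm_num) τ hτ i i)
  have hD0 : 0 ≤ D := (abs_nonneg _).trans (hD 0 (by norm_num) i i)
  have h2 : ∑ t ∈ times n, K ((gridPt n t - τ) / b) * Sig (gridPt n t) i i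
      ≤ D * (3 * B * (n * b)) := by
    refine le_trans ?_ (mul_le_mul_of_nonneg_left (hK.sum_le hB hn hb hnb τ) hD0)
    rw [Finset.mul_sum]
    refine Finset.sum_le_sum fun t ht => ?_
    rw [mul_comm]
    exact mul_le_mul_of_nonneg_right ((le_abs_self _).trans (hD _ (gridPt_le_one hn
      (Finset.mem_Icc.1 ht).2) i i)) (hK.nonneg _)
  have h3 : √(logMax n d * (n * b)) ≤ n * b := by
    rw [Real.sqrt_le_left (by linarith), sq]
    exact mul_le_mul_of_nonneg_right hLb (by linarith)
  have e1 : ∑ t ∈ times n, kernelPow K 0 ((gridPt n t - τ) / b)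
        * (e t i * e t i - Sig (gridPt n t) i i)
      = ∑ t ∈ times n, K ((gridPt n t - τ) / b) * e t i ^ 2
        - ∑ t ∈ times n, K ((gridPt n t - τ) / b) * Sig (gridPt n t) i i := by
    rw [← Finset.sum_sub_distrib]
    refine Finset.sum_congr rfl fun t _ => ?_
    simp only [kernelPow, pow_zero]
    ring
  rw [e1] at h1
  have h4 := mul_le_mul_of_nonneg_left h3 hM
  linarith

/-- Bound for the error of the estimated error covariance along a good path. -/
theorem GoodPath.sigmaHat_error (hg : GoodPath n d K h b M A Sig x e) (hK : IsKernel K) {B : ℝ}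
    (hB : ∀ x, K x ≤ B) (hn : 1 ≤ n) (hb : 0 < b) (hnb : 1 ≤ n * b)
    (hLb : logMax n d ≤ n * b) (hM : 0 ≤ M) {D : ℝ}
    (hD : ∀ τ ≤ (1 : ℝ), ∀ i j, |Sig τ i j| ≤ D) {c : ℝ} (hc : 0 < c)
    (hdes : ∀ τ ∈ Set.Icc (0 : ℝ) 1, ∀ a a' : ℝ, c * (n * b) * (a ^ 2 + a' ^ 2) ≤
        ∑ t ∈ times n, K ((gridPt n t - τ) / b) * (a + a' * ((gridPt n t - τ) / b)) ^ 2)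
    {L₂ : ℝ} (hsm : ∀ i j, ContDiffOn ℝ 2 (fun τ => Sig τ i j) (Set.Icc 0 1))
    (hL₂ : ∀ i j, ∀ τ ∈ Set.Icc (0 : ℝ) 1,
      |iteratedDerivWithin 2 (fun τ => Sig τ i j) (Set.Icc 0 1) τ| ≤ L₂)
    {α : Fin d → ℤ → Fin d → ℝ} {E η : ℝ} (hE : 0 ≤ E)
    (hα : ∀ i, ∀ t ∈ times n, ∑ j, |A (gridPt n t) i j - α i t j| ≤ E)
    (hη : η = E * (M * √(logMax n d))) {τ : ℝ} (hτ : τ ∈ Set.Icc (0 : ℝ) 1) (i j : Fin d) :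
    |sigmaHat n K b (residual x α) τ i j - Sig τ i j|
      ≤ 6 * B / c ^ 2 * (M * √(logMax n d / (n * b)) + 3 * B * (L₂ * b ^ 2)
        + (3 * B + M + 3 * B * D) * η + 3 * B * η ^ 2) := by
  have hn' : (0 : ℝ) < n := by exact_mod_cast hn
  set m : ℝ := n * b with hm
  have hm0 : 0 < m := mul_pos hn' hb
  have hB0 : 0 ≤ B := (hK.nonneg 0).trans (hB 0)
  have hη0 : 0 ≤ η := by rw [hη]; positivity
  have hL₂0 : 0 ≤ L₂ := (abs_nonneg _).trans (hL₂ i i 0 (by simp))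
  set w : ℤ → ℝ := fun t => locWeight n K b t τ with hw
  set k : ℤ → ℝ := fun t => K ((gridPt n t - τ) / b) with hk
  have hk0 : ∀ t, 0 ≤ k t := fun t => hK.nonneg _
  have hksum : ∑ t ∈ times n, k t ≤ 3 * B * m := hK.sum_le hB hn hb hnb τ
  have hwk : ∀ t, |w t| ≤ 6 * B * m * k t := fun t => hK.abs_locWeight_le hB hn hb hnb t τ
  set W := ∑ t ∈ times n, w t with hW
  have hWge : (c * m) ^ 2 ≤ W := le_sum_locWeight (by positivity) (hdes τ hτ)
  have hW0 : 0 < W := lt_of_lt_of_le (by positivity) hWge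
  have hwabs : ∀ (y z : ℤ → ℝ) (Z : ℝ), (∀ t ∈ times n, k t * |y t| ≤ k t * z t) →
      ∑ t ∈ times n, k t * z t ≤ Z → |∑ t ∈ times n, w t * y t| ≤ 6 * B * m * Z := by
    intro y z Z hyz hZ
    refine (Finset.abs_sum_le_sum_abs _ _).trans ?_
    refine le_trans ?_ (mul_le_mul_of_nonneg_left hZ (by positivity))
    rw [Finset.mul_sum]
    refine Finset.sum_le_sum fun t ht => ?_
    rw [abs_mul]
    calc |w t| * |y t| ≤ 6 * B * m * k t * |y t| :=
          mul_le_mul_of_nonneg_right (hwk t) (abs_nonneg _)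
      _ = 6 * B * m * (k t * |y t|) := by ring
      _ ≤ 6 * B * m * (k t * z t) := mul_le_mul_of_nonneg_left (hyz t ht) (by positivity)
  set r := residual x α with hr
  set σ' := derivWithin (fun u => Sig u i j) (Set.Icc 0 1) τ with hσ'
  -- Stochastic error, Taylor remainder and residual error. The linear Taylor term may be subtracted
  -- freely, since the weights annihilate it.
  have hdec : sigmaHat n K b r τ i j - Sig τ i j
      = (∑ t ∈ times n, w t * (e t i * e t j - Sig (gridPt n t) i j)
        + ∑ t ∈ times n, w t * (Sig (gridPt n t) i j - Sig τ i j - σ' * (gridPt n t - τ))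
        + ∑ t ∈ times n, w t * (r t i * r t j - e t i * e t j)) / W := by
    have hlin : ∑ t ∈ times n, w t * (σ' * (gridPt n t - τ)) = 0 := by
      have h0 := sum_locWeight_mul n K b τ
      have h1 : ∑ t ∈ times n, w t * (σ' * (gridPt n t - τ))
          = σ' * b * ∑ t ∈ times n, locWeight n K b t τ * ((gridPt n t - τ) / b) := by
        rw [Finset.mul_sum]
        refine Finset.sum_congr rfl fun t _ => ?_
        change locWeight n K b t τ * (σ' * (gridPt n t - τ)) = _
        field_simp
      rw [h1, h0, mul_zero]
    have hnum : ∑ t ∈ times n, w t * (e t i * e t j - Sig (gridPt n t) i j)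
        + ∑ t ∈ times n, w t * (Sig (gridPt n t) i j - Sig τ i j - σ' * (gridPt n t - τ))
        + ∑ t ∈ times n, w t * (r t i * r t j - e t i * e t j)
        = ∑ t ∈ times n, w t * r t i * r t j - W * Sig τ i j := by
      have h2 : W * Sig τ i j = ∑ t ∈ times n, w t * Sig τ i j
          + ∑ t ∈ times n, w t * (σ' * (gridPt n t - τ)) := by
        rw [hlin, add_zero, hW, Finset.sum_mul]
      rw [h2, ← Finset.sum_add_distrib, ← Finset.sum_add_distrib, ← Finset.sum_add_distrib,
        ← Finset.sum_sub_distrib]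
      exact Finset.sum_congr rfl fun t _ => by ring
    rw [hnum, sub_div, mul_div_cancel_left₀ _ hW0.ne']
    rfl
  have hT1 : |∑ t ∈ times n, w t * (e t i * e t j - Sig (gridPt n t) i j)|
      ≤ 6 * B * m * (M * √(logMax n d * m)) :=
    hK.abs_sum_locWeight_mul_le hB hn hb hnb fun p hp => hg.cov p hp τ hτ i j
  have hT2 : |∑ t ∈ times n, w t * (Sig (gridPt n t) i j - Sig τ i j - σ' * (gridPt n t - τ))|
      ≤ 6 * B * m * (3 * B * m * (L₂ * b ^ 2)) := by
    refine hwabs _ (fun _ => L₂ * b ^ 2) _ (fun t ht => ?_) ?_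
    · by_cases hx : 1 < |(gridPt n t - τ) / b|
      · have : k t = 0 := hK.support _ hx
        simp [this]
      · refine mul_le_mul_of_nonneg_left ?_ (hk0 t)
        have h1 := abs_sub_taylor_le (hsm i j) (hL₂ i j) hτ (gridPt_mem_Icc hn (times_subset ht))
        refine h1.trans (mul_le_mul_of_nonneg_left ?_ hL₂0)
        rw [abs_div, abs_of_pos hb, not_lt, div_le_one hb] at hx
        exact sq_le_sq.2 (by rwa [abs_of_pos hb])
    · rw [← Finset.sum_mul]
      exact mul_le_mul_of_nonneg_right hksum (by positivity)
  have hT3 : |∑ t ∈ times n, w t * (r t i * r t j - e t i * e t j)|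
      ≤ 6 * B * m * (((3 * B + M + 3 * B * D) * η + 3 * B * η ^ 2) * m) := by
    refine hwabs _ (fun t => η * (1 + (e t i ^ 2 + e t j ^ 2) / 2) + η ^ 2) _
      (fun t ht => ?_) ?_
    · refine mul_le_mul_of_nonneg_left (abs_mul_sub_mul_le hη0 ?_ ?_) (hk0 t)
      · rw [hη]; exact hg.abs_residual_sub_le hM ht (hα i t ht)
      · rw [hη]; exact hg.abs_residual_sub_le hM ht (hα j t ht)
    · have e1 : ∑ t ∈ times n, k t * (η * (1 + (e t i ^ 2 + e t j ^ 2) / 2) + η ^ 2)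
          = (η + η ^ 2) * ∑ t ∈ times n, k t + η / 2 * ∑ t ∈ times n, k t * e t i ^ 2
            + η / 2 * ∑ t ∈ times n, k t * e t j ^ 2 := by
        rw [Finset.mul_sum, Finset.mul_sum, Finset.mul_sum, ← Finset.sum_add_distrib,
          ← Finset.sum_add_distrib]
        exact Finset.sum_congr rfl fun t _ => by ring
      rw [e1]
      have h1 := mul_le_mul_of_nonneg_left hksum (by positivity : 0 ≤ η + η ^ 2)
      have h2 := mul_le_mul_of_nonneg_left
        (hg.sum_mul_sq_le hK hB hn hb hnb hLb hM hD hτ i) (by positivity : 0 ≤ η / 2)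
      have h3 := mul_le_mul_of_nonneg_left
        (hg.sum_mul_sq_le hK hB hn hb hnb hLb hM hD hτ j) (by positivity : 0 ≤ η / 2)
      linarith
  rw [hdec, abs_div, abs_of_pos hW0, div_le_iff₀ hW0]
  have hsq : √(logMax n d * m) = m * √(logMax n d / m) := by
    have : logMax n d * m = m ^ 2 * (logMax n d / m) := by field_simp
    rw [this, Real.sqrt_mul (by positivity), Real.sqrt_sq hm0.le]
  rw [hsq] at hT1
  have hD0 : 0 ≤ D := (abs_nonneg _).trans (hD 0 (by norm_num) i i)
  set R := M * √(logMax n d / m) + 3 * B * (L₂ * b ^ 2)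
        + (3 * B + M + 3 * B * D) * η + 3 * B * η ^ 2 with hR
  have hR0 : 0 ≤ R := by positivity
  calc _ ≤ 6 * B * m * (M * (m * √(logMax n d / m))) + 6 * B * m * (3 * B * m * (L₂ * b ^ 2))
          + 6 * B * m * (((3 * B + M + 3 * B * D) * η + 3 * B * η ^ 2) * m) :=
        (abs_add_three _ _ _).trans (by linarith)
    _ = 6 * B / c ^ 2 * R * (c * m) ^ 2 := by rw [hR]; field_simp; ring
    _ ≤ 6 * B / c ^ 2 * R * W := mul_le_mul_of_nonneg_left hWge (by positivity)

end

/-! ### Tuning parameters -/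

theorem logMax_mul_sqrt_div {n d : ℕ} {h : ℝ} (M : ℝ) :
    M * (logMax n d * √(n * h)) / (n * h) = M * (logMax n d * (1 / √(n * h))) := by
  rw [mul_div_assoc, mul_div_assoc, Real.sqrt_div_self']

theorem logMax_nonneg (n d : ℕ) : 0 ≤ logMax n d := Real.log_natCast_nonneg _

theorem zeta_nonneg (n d s : ℕ) (h : ℝ) : 0 ≤ zeta n d s h :=
  mul_nonneg (logMax_nonneg n d) (by positivity)

theorem nuStar_nonneg (n d s : ℕ) (h : ℝ) : 0 ≤ nuStar n d s h :=
  mul_nonneg (mul_nonneg (Nat.cast_nonneg _) (zeta_nonneg n d s h)) (Real.sqrt_nonneg _)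

theorem logMax_div_sqrt_le_zeta (n d s : ℕ) (h : ℝ) :
    logMax n d * (1 / √(n * h)) ≤ zeta n d s h :=
  mul_le_mul_of_nonneg_left (le_add_of_nonneg_right (by positivity)) (logMax_nonneg n d)

theorem mul_zeta_le_nuStar {n d s : ℕ} {h : ℝ} (hL : 1 ≤ logMax n d) :
    s * zeta n d s h ≤ nuStar n d s h :=
  le_mul_of_one_le_right (mul_nonneg (Nat.cast_nonneg _) (zeta_nonneg n d s h))
    (Real.one_le_sqrt.2 hL)

/-- Numerical consequences of the conditions on the tuning parameters. -/
theorem tuning_bounds {n d s : ℕ} {h lam1 lam2 B M c L₂ Cg T : ℝ} (hn : 1 ≤ n) (hs : 1 ≤ s)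
    (hL : 1 ≤ logMax n d) (hh : 0 < h) (hh1 : h ≤ 1) (hB : 0 ≤ B) (hM : 0 ≤ M) (hc : 0 < c)
    (hL₂ : 0 ≤ L₂) (hlam1 : 0 < lam1) (hCg : Cg = M + 3 * B * (M ^ 2 * L₂))
    (hT : T = 1 + 10 / c + 4 * L₂ + 2 * Cg * (1 + 12 * B * M ^ 2 / c))
    (hg : 4 * Cg * zeta n d s h ≤ lam1) (hnu : 192 * M * nuStar n d s h ≤ c)
    (hlam : T * (√n * s * logMax n d * zeta n d s h + √((n : ℝ) * s) * lam1) ≤ lam2) :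
    M * (logMax n d * √(n * h)) / (n * h)
        + 3 * B * (M ^ 2 * logMax n d * (s * (L₂ * h ^ 2))) ≤ Cg * zeta n d s h ∧
    16 * (3 * (M * (logMax n d * √(n * h)) / (n * h)) * (2 * s)) ≤ c / 2 ∧
    Cg * zeta n d s h ≤ lam1 / 4 ∧
    √n * √(9 * lam1 ^ 2 * (2 * s) / c ^ 2) ≤ lam2 / 2 ∧ 2 * L₂ ≤ lam2 / 2 ∧
    2 * (√n * (Cg * zeta n d s h
      + 3 * B * (M ^ 2 * logMax n d) * (2 * s * (Cg * zeta n d s h) / (c / 2)))) < lam2 := by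
  have hn' : (1 : ℝ) ≤ n := by exact_mod_cast hn
  have hs' : (1 : ℝ) ≤ s := by exact_mod_cast hs
  have hζ := zeta_nonneg n d s h
  have hCg0 : 0 ≤ Cg := by rw [hCg]; positivity
  have hLz := logMax_div_sqrt_le_zeta n d s h
  have hsz := mul_zeta_le_nuStar (s := s) (h := h) hL
  set L := logMax n d
  set ζ := zeta n d s h with hζdef
  have hL0 : 0 ≤ L := zero_le_one.trans hL
  have hU0 : 0 ≤ √(n : ℝ) * s * L * ζ := by positivity
  have hV0 : 0 ≤ √((n : ℝ) * s) * lam1 := by positivity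
  -- Because h ≤ 1, the first term dominated by λ₂ is at least one; this is how λ₂ also dominates
  -- the constant 4L₂.
  have hU1 : 1 ≤ √(n : ℝ) * s * L * ζ := by
    have h1 : 1 ≤ √(n : ℝ) * (1 / √(n * h)) := by
      rw [Real.sqrt_mul (by positivity), mul_one_div, div_mul_cancel_left₀ (by positivity),
        one_le_inv₀ (Real.sqrt_pos.2 hh)]
      exact Real.sqrt_le_one.2 hh1
    have h2 : 1 ≤ √(n : ℝ) * ζ := by
      calc (1 : ℝ) ≤ √(n : ℝ) * (1 / √(n * h)) := h1
        _ ≤ √(n : ℝ) * (L * (1 / √(n * h))) :=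
          mul_le_mul_of_nonneg_left (le_mul_of_one_le_left (by positivity) hL) (by positivity)
        _ ≤ √(n : ℝ) * ζ := mul_le_mul_of_nonneg_left hLz (by positivity)
    have h3 : 1 ≤ (s : ℝ) * L := one_le_mul_of_one_le_of_one_le hs' hL
    calc (1 : ℝ) ≤ (√(n : ℝ) * ζ) * (s * L) := one_le_mul_of_one_le_of_one_le h2 h3
      _ = _ := by ring
  set U := √(n : ℝ) * s * L * ζ with hU
  set V := √((n : ℝ) * s) * lam1 with hV
  have hQ0 : 0 ≤ 2 * Cg * (1 + 12 * B * M ^ 2 / c) := by positivity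
  -- T collects the constants required by the individual bounds; each of them spends its own part of
  -- T. The summand 1 produces the strict inequality at the end.
  have hT0 : ∀ y, 0 ≤ y → ∀ z, 0 ≤ z → z ≤ U + V → y ≤ T → y * z ≤ lam2 := fun y hy z hz hzU hyT =>
    (mul_le_mul hyT hzU hz (hy.trans hyT)).trans hlam
  have h10 : 0 ≤ 10 / c := by positivity
  rw [logMax_mul_sqrt_div]
  refine ⟨?_, ?_, by linarith, ?_, ?_, ?_⟩
  · have e : Cg * ζ = M * (L * (1 / √(n * h))) + 3 * B * (M ^ 2 * L * (s * (L₂ * h ^ 2)))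
        + (M * (L * (s * h ^ 2)) + 3 * B * (M ^ 2 * L₂) * (L * (1 / √(n * h)))) := by
      rw [hCg, hζdef, zeta]; ring
    rw [e]
    exact le_add_of_nonneg_right (by positivity)
  · have h1 := mul_le_mul_of_nonneg_left hLz hM
    have h2 := mul_le_mul_of_nonneg_right h1 (by positivity : (0 : ℝ) ≤ 96 * s)
    have h3 := mul_le_mul_of_nonneg_left hsz (by positivity : 0 ≤ 96 * M)
    linarith
  · have h1 : √(9 * lam1 ^ 2 * (2 * s) / c ^ 2) ≤ 5 * lam1 / c * √(s : ℝ) := by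
      rw [Real.sqrt_le_left (by positivity), mul_pow, Real.sq_sqrt (by positivity), div_pow,
        div_mul_eq_mul_div]
      refine div_le_div_of_nonneg_right ?_ (by positivity)
      nlinarith [mul_nonneg (sq_nonneg lam1) (zero_le_one.trans hs')]
    have h2 := hT0 (10 / c) h10 V hV0 (by linarith) (by rw [hT]; linarith)
    calc √(n : ℝ) * √(9 * lam1 ^ 2 * (2 * s) / c ^ 2) ≤ √(n : ℝ) * (5 * lam1 / c * √(s : ℝ)) :=
          mul_le_mul_of_nonneg_left h1 (by positivity)
      _ = 10 / c * V / 2 := by rw [hV, Real.sqrt_mul (by positivity)]; ring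
      _ ≤ lam2 / 2 := by linarith
  · have h2 := hT0 (4 * L₂) (by positivity) 1 zero_le_one (by linarith) (by rw [hT]; linarith)
    linarith
  · have h1 : √(n : ℝ) * ζ ≤ U := by
      have : 1 ≤ (s : ℝ) * L := one_le_mul_of_one_le_of_one_le hs' hL
      calc √(n : ℝ) * ζ ≤ √(n : ℝ) * ζ * (s * L) := le_mul_of_one_le_right (by positivity) this
        _ = U := by rw [hU]; ring
    have e : 2 * (√(n : ℝ) * (Cg * ζ + 3 * B * (M ^ 2 * L) * (2 * s * (Cg * ζ) / (c / 2))))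
        = 2 * Cg * (√(n : ℝ) * ζ) + 2 * Cg * (12 * B * M ^ 2 / c) * U := by
      rw [hU]; field_simp; ring
    have h3 := mul_le_mul_of_nonneg_left h1 (by positivity : 0 ≤ 2 * Cg)
    have h4 := hT0 (1 + 2 * Cg * (1 + 12 * B * M ^ 2 / c)) (by linarith) U hU0 (by linarith)
      (by rw [hT]; linarith)
    rw [e]
    nlinarith

/-! ### Consequences of the asymptotic conditions -/

theorem tendsto_logMax (d : ℕ → ℕ) : Tendsto (fun n => logMax n (d n)) atTop atTop := by
  refine tendsto_atTop_mono' _ ?_ (Real.tendsto_log_atTop.comp tendsto_natCast_atTop_atTop)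
  filter_upwards [eventually_ge_atTop 1] with n hn
  refine Real.log_le_log (by exact_mod_cast hn) ?_
  exact_mod_cast le_max_left _ _

theorem le_of_le_div_logMax_pow {n d k : ℕ} {R y : ℝ} (hL : 1 ≤ logMax n d) (hR : 0 ≤ R)
    (hk : 1 ≤ k) (h : R ≤ y / logMax n d ^ k) : R * logMax n d ≤ y := by
  have hL0 : 0 < logMax n d := zero_lt_one.trans_le hL
  rw [le_div_iff₀ (by positivity)] at h
  exact (mul_le_mul_of_nonneg_left (le_self_pow₀ hL (by omega)) hR).trans h

/-- As s and log(n ∨ d) are eventually at least one, sh² log(n ∨ d) → 0 forces h → 0. -/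
theorem BandwidthCond.eventually_le {d s : ℕ → ℕ} {h : ℕ → ℝ} (hh : BandwidthCond d s h)
    (hs : ∀ᶠ n in atTop, 1 ≤ s n) {δ : ℝ} (hδ : 0 < δ) : ∀ᶠ n in atTop, h n ≤ δ := by
  filter_upwards [hs, (tendsto_logMax d).eventually_ge_atTop 1,
    hh.small.eventually (gt_mem_nhds (by positivity : (0 : ℝ) < δ ^ 2))] with n h1 h2 h3
  have h1' : (1 : ℝ) ≤ s n := by exact_mod_cast h1
  have h4 : h n ^ 2 ≤ s n * h n ^ 2 * logMax n (d n) :=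
    (le_mul_of_one_le_left (sq_nonneg _) h1').trans (le_mul_of_one_le_right (by positivity) h2)
  exact le_of_sq_le_sq (h4.trans h3.le) hδ.le

theorem eventually_mul_le_of_isLittleO {f g : ℕ → ℝ} (hfg : f =o[atTop] g)
    (hg : ∀ n, 1 ≤ n → 0 < g n) {T : ℝ} (hT : 0 < T) : ∀ᶠ n in atTop, T * f n ≤ g n := by
  filter_upwards [hfg.bound (inv_pos.2 hT), eventually_ge_atTop 1] with n h1 h2
  rw [Real.norm_eq_abs, Real.norm_eq_abs, abs_of_pos (hg n h2)] at h1
  have h3 := mul_le_mul_of_nonneg_left ((le_abs_self _).trans h1) hT.le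
  rwa [mul_inv_cancel_left₀ hT.ne'] at h3

theorem sparsity_pos_dim {n d : ℕ} {A : ℝ → Mat d} (h : 1 ≤ sparsity n A) : 1 ≤ d := by
  rcases Nat.eq_zero_or_pos d with rfl | hd
  · simp [sparsity] at h
  · exact hd

theorem SupIsBigOP.of_bound {S : ℕ → Type*} [∀ n, MeasurableSpace (S n)] {P : ∀ n, Measure (S n)}
    {E : ∀ n, S n → Prop} {Y : ∀ n, S n → ℝ → ℝ} {r : ℕ → ℝ} {M : ℝ} (hM : 0 < M)
    (hE : ∀ δ : ℝ, 0 < δ → ∀ᶠ n in atTop, P n {ω | ¬ E n ω} ≤ ENNReal.ofReal δ)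
    (hY : ∀ᶠ n in atTop, ∀ ω, E n ω → ∀ τ ∈ Set.Icc (0 : ℝ) 1, Y n ω τ ≤ M * r n) :
    SupIsBigOP P Y r := by
  intro δ hδ
  refine ⟨M, hM, ?_⟩
  filter_upwards [hE δ hδ, hY] with n h1 h2
  refine (measure_mono ?_).trans h1
  rintro ω ⟨τ, hτ, hlt⟩ hω
  exact absurd (h2 ω hω τ hτ) (not_le.2 hlt)

/-- The failure probability is O(1/(n ∨ d)) with M fixed, so M can be chosen before δ. -/
theorem eventually_measure_not_goodPath_le {S : ℕ → Type*} [∀ n, MeasurableSpace (S n)]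
    {P : ∀ n, Measure (S n)} [∀ n, IsProbabilityMeasure (P n)] {d s : ℕ → ℕ}
    {A Sig : ∀ n, ℝ → Mat (d n)} {ε X : ∀ n, ℤ → S n → Fin (d n) → ℝ} {K : ℝ → ℝ} {h b : ℕ → ℝ}
    (hmodel : ∀ n, 1 ≤ n → IsTVVAR (P n) n (d n) (A n) (Sig n) (ε n) (X n))
    (hreg : RegularVAR P d A Sig ε) (hK : IsKernel K)
    (hh : BandwidthCond d s h) (hb : ClimeBandwidthCond d s h b) :
    ∃ M : ℝ, 0 < M ∧ ∀ δ : ℝ, 0 < δ → ∀ᶠ n in atTop,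
      P n {ω | ¬ GoodPath n (d n) K (h n) (b n) M (A n) (Sig n) (fun t => X n t ω)
        (fun t => varError n (Sig n) (ε n) t ω)} ≤ ENNReal.ofReal δ := by
  obtain ⟨C₁, ρ, hC₁, hρ0, hρ1, hdecay⟩ := hreg.ma_decay
  obtain ⟨D', hD'⟩ := hreg.bounded_Sig
  obtain ⟨ι, C', hι, -, hsub⟩ := hreg.subGaussian
  obtain ⟨B, hB1, hB⟩ := hK.exists_bound
  obtain ⟨Lk, hLk0, hLk⟩ := hK.exists_lipschitz_kernelPow
  set C := max C' 1 with hC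
  set D := max D' 1 with hD
  have hD0 : 0 < D := zero_lt_one.trans_le (le_max_right _ _)
  have hC0 : 0 < C := zero_lt_one.trans_le (le_max_right _ _)
  have hv : ∀ n, 1 ≤ n → VARBound (P n) n (d n) (A n) (Sig n) (ε n) ι C D C₁ ρ := fun n hn =>
    { n_pos := hn
      iota_pos := hι
      one_le_C := le_max_right _ _
      D_pos := hD0
      C₁_pos := hC₁
      rho_pos := hρ0
      rho_lt := hρ1
      subGaussian := fun t u hu =>
        (hsub n hn t u hu).trans (ENNReal.ofReal_le_ofReal (le_max_left _ _))
      posSemidef := hreg.posSemidef n hn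
      bound := fun τ hτ => (hD' n hn τ hτ).trans (le_max_left _ _)
      decay := hdecay n hn }
  have hρ' : 0 < 1 - ρ := by linarith
  have hsq : ∀ a y : ℝ, 0 < a → 1 ≤ y → 3 / a ≤ y → 3 ≤ a * y ^ 2 := by
    intro a y ha hy1 hy
    rw [div_le_iff₀ ha] at hy
    have := mul_le_mul_of_nonneg_left hy1 (by positivity : 0 ≤ a * y)
    nlinarith
  set a := ι / D with ha
  set a' := ι / (C₁ ^ 2 * D) * (1 - ρ) ^ 2 with ha'
  have ha0 : 0 < a := by positivity
  have ha'0 : 0 < a' := by positivity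
  set M₀ := 1 + 3 / a + 3 / a' with hM₀
  have h3a : 0 < 3 / a := by positivity
  have h3a' : 0 < 3 / a' := by positivity
  have hM₀0 : 0 ≤ M₀ := by positivity
  set M₁ := 8 * (Real.exp (a * D) * C) / a ^ 2 * (3 * B ^ 2) + 5 with hM₁
  have hM₁0 : 0 < M₁ := by positivity
  set M₂ := (C + 1) / a * (3 * B ^ 2 * (2 * M₀) ^ 2) + 4 with hM₂
  have hM₂0 : 0 < M₂ := by positivity
  have hM₃0 : 0 ≤ Lk * (M₀ ^ 2 + D) := by positivity
  set M := 2 * M₀ + M₂ + (M₁ + Lk * (M₀ ^ 2 + D)) with hM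
  refine ⟨M, by positivity, fun δ hδ => ?_⟩
  -- Once nh and nb exceed R log(n ∨ d), both choices of θ satisfy θB ≤ a/2, the range of the
  -- sub-exponential bound.
  set R := 1 + (2 * B / a) ^ 2 with hR
  have hR0 : 0 ≤ R := by positivity
  have hR1 : 1 ≤ R := le_add_of_nonneg_right (by positivity)
  have hBa : (2 * B / a) ^ 2 ≤ R := le_add_of_nonneg_left zero_le_one
  filter_upwards [eventually_ge_atTop 1, (tendsto_logMax d).eventually_ge_atTop 1,
    hh.large.eventually_ge_atTop R, hb.large.eventually_ge_atTop R,
    tendsto_natCast_atTop_atTop.eventually_ge_atTop ((4 * C + 24) / δ)] with n hn hL hnh hnb hnδ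
  have hL0 : 0 < logMax n (d n) := zero_lt_one.trans_le hL
  replace hnh := le_of_le_div_logMax_pow hL hR0 (by norm_num) hnh
  replace hnb := le_of_le_div_logMax_pow hL hR0 (by norm_num) hnb
  have hRL : R ≤ R * logMax n (d n) := le_mul_of_one_le_right hR0 hL
  have hnh0 : 0 < n * h n := by linarith
  have hnb0 : 0 < n * b n := by linarith
  refine ((hv n hn).measure_not_goodPath_le (hmodel n hn) hK hB hLk0 hLk hM₀0
    (hsq a M₀ ha0 (by linarith) (by linarith)) (hsq a' M₀ ha'0 (by linarith) (by linarith))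
    hM₁.ge (by linarith) (show M₂ ≤ M by linarith) (by linarith) hL (hh.pos n hn) (by linarith) ?_
    (hb.pos n hn) (by linarith) ?_ ?_).trans (ENNReal.ofReal_le_ofReal ?_)
  · have h1 : 2 * B / a ≤ √(n * h n) := Real.le_sqrt_of_sq_le (by linarith)
    rw [inv_mul_le_iff₀ (Real.sqrt_pos.2 hnh0)]
    rw [div_le_iff₀ ha0] at h1
    linarith
  · have := mul_le_mul_of_nonneg_right hR1 hL0.le
    linarith
  · have h1 : √(logMax n (d n) / (n * b n)) ≤ a / (2 * B) := by
      rw [Real.sqrt_le_left (by positivity), div_le_iff₀ hnb0]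
      have h2 : (2 * B / a) ^ 2 * logMax n (d n) ≤ n * b n :=
        (mul_le_mul_of_nonneg_right hBa hL0.le).trans hnb
      have h3 := mul_le_mul_of_nonneg_left h2 (by positivity : 0 ≤ (a / (2 * B)) ^ 2)
      have e : (a / (2 * B)) ^ 2 * ((2 * B / a) ^ 2 * logMax n (d n)) = logMax n (d n) := by
        field_simp
      rwa [e] at h3
    have hB0 : 0 < B := by linarith
    calc √(logMax n (d n) / (n * b n)) * B ≤ a / (2 * B) * B :=
          mul_le_mul_of_nonneg_right h1 hB0.le
      _ = a / 2 := by field_simp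
  · have hmax : (0 : ℝ) < ((max n (d n) : ℕ) : ℝ) := by
      exact_mod_cast lt_of_lt_of_le (by omega : 0 < n) (le_max_left _ _)
    rw [div_le_iff₀ hδ] at hnδ
    rw [div_le_iff₀ hmax]
    have : (n : ℝ) ≤ ((max n (d n) : ℕ) : ℝ) := by exact_mod_cast le_max_left _ _
    nlinarith

theorem covariance_rate_le {M k Q H ν r β L : ℝ} (hM : 0 ≤ M) (hkL : 0 ≤ k * L) (hQ : 0 ≤ Q)
    (hH : 0 ≤ H) (hν : 0 ≤ ν) (hν1 : ν ≤ 1) (hr : 0 ≤ r) (hβ : 0 ≤ β) (hk : 0 ≤ k) :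
    M * r + k * (L * β) + Q * (H * ν) + k * (H * ν) ^ 2
      ≤ (M + k * L + Q * H + k * H ^ 2) * (r + β + ν) := by
  have e2 := mul_le_mul_of_nonneg_left (pow_le_of_le_one hν hν1 two_ne_zero)
    (by positivity : 0 ≤ k * H ^ 2)
  have p1 : 0 ≤ M * (β + ν) := by positivity
  have p2 : 0 ≤ k * L * (r + ν) := by positivity
  have p3 : 0 ≤ (Q * H + k * H ^ 2) * (r + β) := by positivity
  linarith

/-- Purely deterministic: on a good path the bound holds for all minimisers at once, so no
measurability of the estimators is involved. -/
theorem eventually_sigmaHat_error {S : ℕ → Type*} [∀ n, MeasurableSpace (S n)]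
    {P : ∀ n, Measure (S n)} {d s : ℕ → ℕ}
    {A Sig : ∀ n, ℝ → Mat (d n)} {ε X : ∀ n, ℤ → S n → Fin (d n) → ℝ} {K : ℝ → ℝ}
    {h b lam1 lam2 ξ : ℕ → ℝ} {q C₂ M : ℝ}
    (hs : ∀ n, s n = sparsity n (A n)) (hs_pos : ∀ᶠ n in atTop, 1 ≤ s n)
    (hreg : RegularVAR P d A Sig ε) (hK : IsKernel K) (hh : BandwidthCond d s h)
    (hlasso : LassoCond P d s A X K h lam1) (hgroup : GroupLassoCond d s A h lam1 lam2)
    (hb : ClimeBandwidthCond d s h b)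
    (hsparse : ∀ n, 1 ≤ n → SparseClass q (ξ n) C₂ (fun τ => (Sig n τ)⁻¹)) (hM : 0 < M) :
    ∃ Cσ : ℝ, 0 < Cσ ∧ ∀ᶠ n in atTop, ∀ (x e : ℤ → Fin (d n) → ℝ)
      (a₀ b₀ a₁ b₁ : Fin (d n) → ℤ → Fin (d n) → ℝ),
      GoodPath n (d n) K (h n) (b n) M (A n) (Sig n) x e →
      IsLasso n K (h n) (lam1 n) x a₀ b₀ → IsGroupLasso n K (h n) (lam2 n) x a₀ a₁ b₁ →
      ∀ τ ∈ Set.Icc (0 : ℝ) 1, ∀ i j,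
        |sigmaHat n K (b n) (residual x a₁) τ i j - Sig n τ i j|
          ≤ Cσ * (nuDiamond n (d n) (b n) + nuStar n (d n) (s n) (h n)) := by
  obtain ⟨D', hD'⟩ := hreg.bounded_Sig
  obtain ⟨L₂', hL₂'⟩ := hreg.second_deriv_bound
  obtain ⟨B, hB1, hB⟩ := hK.exists_bound
  obtain ⟨c, N, hc, hdes⟩ := hK.exists_design_bound
  set D := max D' 1 with hD
  have hD0 : 0 < D := zero_lt_one.trans_le (le_max_right _ _)
  set L₂ := max L₂' 0 with hL₂
  have hL₂0 : 0 ≤ L₂ := le_max_right _ _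
  set C := max C₂ 1 with hC
  have hC0 : 0 < C := zero_lt_one.trans_le (le_max_right _ _)
  have hB0 : 0 < B := by linarith
  set c' := c / C with hc'
  have hc'0 : 0 < c' := by positivity
  set Cg := M + 3 * B * (M ^ 2 * L₂) with hCg
  have hCg0 : 0 < Cg := by positivity
  set T := 1 + 10 / c' + 4 * L₂ + 2 * Cg * (1 + 12 * B * M ^ 2 / c') with hT
  have hT0 : 0 < T := by positivity
  set H := 4 * Cg * M / c' with hH
  have hH0 : 0 < H := by positivity
  set R := max N 1 with hR
  have hR1 : 1 ≤ R := le_max_right _ _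
  have hR0 : 0 ≤ R := by linarith
  refine ⟨6 * B / c ^ 2 * (M + 3 * B * L₂ + (3 * B + M + 3 * B * D) * H + 3 * B * H ^ 2),
    by positivity, ?_⟩
  have hbsmall : ∀ᶠ n in atTop, b n ≤ 1 / 2 :=
    (hb.small.eventually (gt_mem_nhds (by norm_num : (0 : ℝ) < 1 / 2))).mono fun n hn => hn.le
  have hnu1 : ∀ᶠ n in atTop, nuStar n (d n) (s n) (h n) < 1 :=
    hb.zeta_small.eventually (gt_mem_nhds zero_lt_one)
  have hnu2 : ∀ᶠ n in atTop, nuStar n (d n) (s n) (h n) < c' / (192 * M) :=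
    hb.zeta_small.eventually (gt_mem_nhds (by positivity))
  filter_upwards [eventually_ge_atTop 1, hs_pos, (tendsto_logMax d).eventually_ge_atTop 1,
    hh.large.eventually_ge_atTop R, hb.large.eventually_ge_atTop R,
    hh.eventually_le hs_pos (by norm_num : (0 : ℝ) < 1 / 2), hbsmall, hnu1, hnu2,
    eventually_mul_le_of_isLittleO hlasso.dominates hlasso.pos (by positivity : 0 < 4 * Cg),
    eventually_mul_le_of_isLittleO hgroup.dominates hgroup.pos hT0, hgroup.signal,
    hgroup.signal_deriv] with n hn hsn hL hnh hnb hh2 hb2 hν1 hν2 hdom1 hdom2 hsig hsigd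
  intro x e a₀ b₀ a₁ b₁ hg hla hgr τ hτ i j
  have hh0 := hh.pos n hn
  have hb0 := hb.pos n hn
  replace hnh := le_of_le_div_logMax_pow hL hR0 (by norm_num) hnh
  replace hnb := le_of_le_div_logMax_pow hL hR0 (by norm_num) hnb
  have hL0 : 0 < logMax n (d n) := zero_lt_one.trans_le hL
  have hRL : R ≤ R * logMax n (d n) := le_mul_of_one_le_right hR0 hL
  have hLR : logMax n (d n) ≤ R * logMax n (d n) := le_mul_of_one_le_left hL0.le hR1
  have hNR : N ≤ R := le_max_left _ _
  have hν := nuStar_nonneg n (d n) (s n) (h n)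
  rw [lt_div_iff₀ (by positivity)] at hν2
  obtain ⟨hgd, hc1, hc2, hc3, hc4, hc5⟩ := tuning_bounds hn hsn hL hh0 (by linarith) hB0.le hM.le
    hc'0 hL₂0 (hlasso.pos n hn) hCg hT hdom1 (by linarith) hdom2
  have hSig : ∀ τ ∈ Set.Icc (0 : ℝ) 1, ∀ u : Fin (d n) → ℝ,
      ∑ i, u i ^ 2 ≤ C * (u ⬝ᵥ (Sig n τ).mulVec u) := fun τ hτ u =>
    (sum_sq_le_of_inv_colSum (hreg.posSemidef n hn τ hτ.2) (hreg.posDef n hn τ hτ) hC0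
      (fun j => ((sum_abs_le_colSumNorm _ j).trans (hsparse n hn τ hτ).2.1).trans
        (le_max_left _ _)) u).2.2
  set E := 2 * s n * (Cg * zeta n (d n) (s n) (h n)) / (c' / 2) with hE
  have hcoef : ∀ i, ∀ r ∈ times n, ∑ j, |A n (gridPt n r) i j - a₁ i r j| ≤ E := fun i r hr => by
    rw [hE, hs n] at hc5
    rw [hs n] at hgd hc1 hc2 hc3
    rw [hE, hs n]
    exact hg.coef_error hK hB hn hh0 (by linarith) hM.le hc hC0
      (hdes n hn (h n) hh0 hh2 (by linarith)) hSig (hreg.smooth_A n hn)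
      (fun i j τ hτ => (hL₂' n hn i j τ hτ).1.trans (le_max_left _ _)) (hlasso.pos n hn)
      (hgroup.pos n hn) hla hgr (hsig) (hsigd) hc' rfl hgd rfl hc1 hc2 hc3 hc4 hc5 i hr
  have hE0 : 0 ≤ E := by
    have := zeta_nonneg n (d n) (s n) (h n)
    positivity
  -- The ℓ₁ coefficient error times the supremum bound of the path is exactly a multiple of ν*.
  have hη : H * nuStar n (d n) (s n) (h n) = E * (M * √(logMax n (d n))) := by
    rw [hE, hH, nuStar]
    field_simp
    ring
  refine (hg.sigmaHat_error (D := D) (L₂ := L₂) hK hB hn hb0 (by linarith) (by linarith) hM.le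
    (fun τ hτ i j => ((abs_apply_le_opNorm _ i j).trans (hD' n hn τ hτ)).trans (le_max_left _ _))
    hc (hdes n hn (b n) hb0 hb2 (by linarith)) (hreg.smooth_Sig n hn)
    (fun i j τ hτ => (hL₂' n hn i j τ hτ).2.trans (le_max_left _ _)) hE0 hcoef hη hτ i j).trans ?_
  rw [mul_assoc (6 * B / c ^ 2)]
  refine mul_le_mul_of_nonneg_left ?_ (by positivity)
  exact covariance_rate_le hM.le (by positivity) (by positivity) hH0.le hν hν1.le
    (Real.sqrt_nonneg _) (sq_nonneg _) (by positivity)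

end TVNet

end

/-! ### CLIME on the good event. -/

theorem theorem4p3 {S : ℕ → Type*} [∀ n, MeasurableSpace (S n)]
    (P : ∀ n, MeasureTheory.Measure (S n)) [∀ n, MeasureTheory.IsProbabilityMeasure (P n)]
    (d s : ℕ → ℕ) (A Sig : ∀ n, ℝ → TVNet.Mat (d n))
    (ε X : ∀ n, ℤ → S n → Fin (d n) → ℝ)
    (K : ℝ → ℝ) (h b lam1 lam2 ξ : ℕ → ℝ) (q C₂ : ℝ)
    (hmodel : ∀ n, 1 ≤ n → TVNet.IsTVVAR (P n) n (d n) (A n) (Sig n) (ε n) (X n))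
    (hs : ∀ n, s n = TVNet.sparsity n (A n))
    (hs_pos : ∀ᶠ n in Filter.atTop, 1 ≤ s n)
    (hreg : TVNet.RegularVAR P d A Sig ε)
    (hK : TVNet.IsKernel K)
    (hh : TVNet.BandwidthCond d s h)
    (hlasso : TVNet.LassoCond P d s A X K h lam1)
    (hgroup : TVNet.GroupLassoCond d s A h lam1 lam2)
    (hb : TVNet.ClimeBandwidthCond d s h b)
    (hq : 0 ≤ q ∧ q < 1)
    (hsparse : ∀ n, 1 ≤ n → TVNet.SparseClass q (ξ n) C₂ (fun τ => (Sig n τ)⁻¹)) :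
    ∃ C₀ : ℝ, 0 < C₀ ∧ ∀ C₃ : ℝ, C₀ ≤ C₃ →
      -- preliminary LASSO estimates, group LASSO estimates and CLIME estimates
      ∀ (aPre bPre aHat bHat : ∀ n, S n → Fin (d n) → ℤ → Fin (d n) → ℝ)
        (OmTilde : ∀ n, S n → ℝ → TVNet.Mat (d n)),
        (∀ n, 1 ≤ n → ∀ ω, TVNet.IsLasso n K (h n) (lam1 n) (fun t => X n t ω)
          (aPre n ω) (bPre n ω)) →
        (∀ n, 1 ≤ n → ∀ ω, TVNet.IsGroupLasso n K (h n) (lam2 n) (fun t => X n t ω)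
          (aPre n ω) (aHat n ω) (bHat n ω)) →
        (∀ n, 1 ≤ n → TVNet.IsClimeSelection
          (fun ω => TVNet.sigmaHat n K (b n)
            (TVNet.residual (fun t => X n t ω) (aHat n ω)))
          (C₃ * (TVNet.nuDiamond n (d n) (b n) + TVNet.nuStar n (d n) (s n) (h n)))
          (OmTilde n)) →
        TVNet.SupIsBigOP P
          (fun n ω τ => TVNet.maxNorm (TVNet.symmetrise (OmTilde n ω τ) - (Sig n τ)⁻¹))
          (fun n => TVNet.nuDiamond n (d n) (b n) + TVNet.nuStar n (d n) (s n) (h n)) ∧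
        TVNet.SupIsBigOP P
          (fun n ω τ => TVNet.opNorm (TVNet.symmetrise (OmTilde n ω τ) - (Sig n τ)⁻¹))
          (fun n => ξ n *
            (TVNet.nuDiamond n (d n) (b n) + TVNet.nuStar n (d n) (s n) (h n)) ^ (1 - q)) ∧
        TVNet.SupIsBigOP P
          (fun n ω τ => 1 / (d n : ℝ) *
            TVNet.frobNorm (TVNet.symmetrise (OmTilde n ω τ) - (Sig n τ)⁻¹) ^ 2)
          (fun n => ξ n *
            (TVNet.nuDiamond n (d n) (b n) + TVNet.nuStar n (d n) (s n) (h n)) ^ (2 - q)) := by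
  obtain ⟨M, hM, hgood⟩ := TVNet.eventually_measure_not_goodPath_le hmodel hreg hK hh hb
  obtain ⟨Cσ, hCσ, hsig⟩ := TVNet.eventually_sigmaHat_error hs hs_pos hreg hK hh hlasso hgroup hb
    hsparse hM
  set C := max C₂ 1 with hC
  have hC0 : 0 < C := zero_lt_one.trans_le (le_max_right _ _)
  -- This threshold makes λ₃ dominate the covariance error times the column sums of Ω, so that Ω is
  -- feasible.
  refine ⟨Cσ * C, by positivity, ?_⟩
  intro C₃ hC₃ aPre bPre aHat bHat OmTilde hpre hhat hclime
  have hC₃0 : 0 < C₃ := lt_of_lt_of_le (by positivity) hC₃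
  -- The factor of the rate in the maximum norm bound of `clime_error`, with λ₃ = C₃ν and covariance
  -- error Cσν.
  set Ct := (C₃ + Cσ * C) * C with hCt
  have hCt0 : 0 < Ct := by positivity
  have key : ∀ᶠ n in Filter.atTop, ∀ ω, TVNet.GoodPath n (d n) K (h n) (b n) M (A n) (Sig n)
      (fun t => X n t ω) (fun t => TVNet.varError n (Sig n) (ε n) t ω) →
      ∀ τ ∈ Set.Icc (0 : ℝ) 1,
        TVNet.maxNorm (TVNet.symmetrise (OmTilde n ω τ) - (Sig n τ)⁻¹)
          ≤ Ct * (TVNet.nuDiamond n (d n) (b n) + TVNet.nuStar n (d n) (s n) (h n)) ∧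
        TVNet.opNorm (TVNet.symmetrise (OmTilde n ω τ) - (Sig n τ)⁻¹)
          ≤ 2 * Ct ^ (1 - q) * (ξ n *
            (TVNet.nuDiamond n (d n) (b n) + TVNet.nuStar n (d n) (s n) (h n)) ^ (1 - q)) ∧
        1 / (d n : ℝ) * TVNet.frobNorm (TVNet.symmetrise (OmTilde n ω τ) - (Sig n τ)⁻¹) ^ 2
          ≤ 2 * Ct ^ (2 - q) * (ξ n *
            (TVNet.nuDiamond n (d n) (b n) + TVNet.nuStar n (d n) (s n) (h n)) ^ (2 - q)) := by
    filter_upwards [Filter.eventually_ge_atTop 1, hs_pos, hsig] with n hn hsn hsig ω hω τ hτ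
    have hν : 0 < TVNet.nuDiamond n (d n) (b n) + TVNet.nuStar n (d n) (s n) (h n) := by
      have h1 := TVNet.nuStar_nonneg n (d n) (s n) (h n)
      have h2 : 0 < TVNet.nuDiamond n (d n) (b n) :=
        add_pos_of_nonneg_of_pos (Real.sqrt_nonneg _) (pow_pos (hb.pos n hn) 2)
      linarith
    set ν := TVNet.nuDiamond n (d n) (b n) + TVNet.nuStar n (d n) (s n) (h n)
    have hcol : ∀ j, ∑ i, |(Sig n τ)⁻¹ i j| ≤ C := fun j =>
      ((TVNet.sum_abs_le_colSumNorm _ j).trans (hsparse n hn τ hτ).2.1).trans (le_max_left _ _)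
    obtain ⟨hinv, hsymm, -⟩ := TVNet.sum_sq_le_of_inv_colSum (hreg.posSemidef n hn τ hτ.2)
      (hreg.posDef n hn τ hτ) hC0 hcol 0
    have h1 := TVNet.clime_error (lam := C₃ * ν) (v := Cσ * ν) (q := q) (ξ := ξ n) (t := Ct * ν)
      (TVNet.sparsity_pos_dim (hs n ▸ hsn)) hinv hsymm hcol hC0.le (by positivity)
      (hsig _ _ _ _ _ _ hω (hpre n hn ω) (hhat n hn ω) τ hτ)
      (by have := mul_le_mul_of_nonneg_right hC₃ hν.le; linarith)
      (hclime n hn ω τ hτ) hq.1 hq.2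
      (fun i => by convert (hsparse n hn τ hτ).2.2 i)
      (by rw [hCt]; ring) (by positivity)
    rw [Real.mul_rpow hCt0.le hν.le, Real.mul_rpow hCt0.le hν.le] at h1
    exact ⟨h1.1, h1.2.1.trans_eq (by ring), h1.2.2.trans_eq (by ring)⟩
  refine ⟨TVNet.SupIsBigOP.of_bound hCt0 hgood (key.mono fun n hn ω hω τ hτ => (hn ω hω τ hτ).1),
    TVNet.SupIsBigOP.of_bound (by positivity) hgood
      (key.mono fun n hn ω hω τ hτ => (hn ω hω τ hτ).2.1),
    TVNet.SupIsBigOP.of_bound (by positivity) hgood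
      (key.mono fun n hn ω hω τ hτ => (hn ω hω τ hτ).2.2)⟩
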